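/- Theorem. Fix a group $\Gamma$, a ring $\Lambda$, and an equivariant homology theory $\mathcal{H}^?_*$ over $\Gamma$ with values in $\Lambda$-modules. That is, $\mathcal{H}^?_*$ assigns to every group over $\Gamma$, i.e. every (discrete) group $G$ with a homomorphism $\xi\colon G\to\Gamma$, a $G$-homology theory $\mathcal{H}^G_*$ on $G$-CW-pairs ($\mathbb{Z}$-graded functors to $\Lambda$-modules with natural boundary maps, satisfying $G$-homotopy invariance, the long exact sequence of a pair, excision for adjunction spaces along cellular maps, and the disjoint union axiom for arbitrary families), together with an induction structure: for every homomorphism $\alpha\colon(H,\xi)\to(G,\mu)$ of groups over $\Gamma$ (so $\mu\circ\alpha=\xi$) and every $n \in \mathbb{Z}$ there are natural homomorphisms $\operatorname{ind}_\alpha\colon\mathcal{H}^H_n(X,A)\to\mathcal{H}^G_n(\alpha_*(X,A))$, where $\alpha_*X=G\times_\alpha X$, which are compatible with the boundary maps, functorial in $\alpha$, satisfy $\operatorname{ind}_{c(g)}=\mathcal{H}^G_n(x\mapsto(1,g^{-1}x))$ for the conjugation $c(g)$ with an element $g\in G$ such that $\xi(g)=1$, and are bijective for $(X,A)=(\{\bullet\},\emptyset)$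 if $\alpha$ is the inclusion of a subgroup. For $\alpha\colon(H,\xi)\to(G,\mu)$ let $a_n(\alpha)$ be the composite $\mathcal{H}^H_n(\{\bullet\})\xrightarrow{\operatorname{ind}_\alpha}\mathcal{H}^G_n(\alpha_*\{\bullet\})\to\mathcal{H}^G_n(\{\bullet\})$, where the second map is induced by the projection. Given a group $(G,\xi)$ over $\Gamma$ and a directed system of groups $\{G_i\mid i\in I\}$ (over a non-empty directed index set) with $G=\operatorname{colim}_{i\in I}G_i$ and structure maps $\psi_i\colon G_i\to G$, regard $G_i$ as a group over $\Gamma$ by $\xi\circ\psi_i$; the maps $a_n(\psi_i)$ induce a map $$t_n\colon\operatorname{colim}_{i\in I}\mathcal{H}^{G_i}_n(\{\bullet\})\to\mathcal{H}^G_n(\{\bullet\}).$$ The theory $\mathcal{H}^?_*$ is called strongly continuous if $t_n$ is an isomorphism for all such $(G,\xi)$ and $\{G_i\}$ and all $n\in\mathbb{Z}$. It is called continuous if this holds whenever $G$ is the directed union of subgroups $G_i$ and the $\psi_i$ are the inclusions. A family $\mathcal{F}$ of subgroups of $G$ is a collection of subgroups closed under conjugation and under passing to subgroups; for a homomorphism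 $\phi\colon K\to G$ put $\phi^*\mathcal{F}=\{L\subseteq K\mid\phi(L)\in\mathcal{F}\}$, written $\mathcal{F}|_K$ if $\phi$ is the inclusion of a subgroup. The classifying space $E_{\mathcal{F}}(G)$ is the $G$-CW-complex, unique up to $G$-homotopy equivalence, such that $E_{\mathcal{F}}(G)^L$ is contractible for $L\in\mathcal{F}$ and empty for $L\notin\mathcal{F}$. The Isomorphism Conjecture (for $\mathcal{H}^?_*$) holds for $(G,\xi)$ and $\mathcal{F}$ if the projection $E_{\mathcal{F}}(G)\to\{\bullet\}$ induces an isomorphism $\mathcal{H}^G_n(E_{\mathcal{F}}(G))\to\mathcal{H}^G_n(\{\bullet\})$ for all $n\in\mathbb{Z}$. Let $(G,\xi)$ be a group over $\Gamma$ and let $\mathcal{F}$ be a family of subgroups of $G$. (a) Let $G$ be the directed union of subgroups $\{G_i\mid i\in I\}$. Suppose that $\mathcal{H}^?_*$ is continuous and that for every $i\in I$ the Isomorphism Conjecture holds for $(G_i,\xi|_{G_i})$ and $\mathcal{F}|_{G_i}$. Then the Isomorphism Conjecture holds for $(G,\xi)$ and $\mathcal{F}$. (b) Let $\{G_i\mid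 i\in I\}$ be a directed system of groups (with not necessarily injective structure maps) with $G=\operatorname{colim}_{i\in I}G_i$ and structure maps $\psi_i\colon G_i\to G$. Suppose that $\mathcal{H}^?_*$ is strongly continuous and that for every $i\in I$ the Isomorphism Conjecture holds for $(G_i,\xi\circ\psi_i)$ and $\psi_i^*\mathcal{F}$. Then the Isomorphism Conjecture holds for $(G,\xi)$ and $\mathcal{F}$. -/

import Mathlib

open CategoryTheory Set

universe u v w z

namespace EquivHom

/-! ### `G`-CW-complexes and `G`-CW-pairs (for a discrete group `G`) -/

/-- The closed unit disk of dimension `n`. -/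
abbrev Disk (n : ℕ) : Type := Metric.closedBall (0 : EuclideanSpace ℝ (Fin n)) 1

/-- A `G`-CW-structure on a `G`-space `X`: a filtration `∅ = skel 0 ⊆ skel 1 ⊆ ...` of `X` by
`G`-invariant subspaces (`skel n` is the `(n - 1)`-skeleton) such that `X` carries the colimit
topology and such that `skel (n + 1)` arises from `skel n` by attaching equivariant cells
`G ⧸ stab n i × Disk n` along their boundaries. The characteristic map of the `i`-th equivariant
`n`-cell is `(g, d) ↦ g • map n i d`; as `G` is discrete, a subset of `G ⧸ stab n i × Disk n` is
closed if and only if all its slices are closed in `Disk n`. -/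
structure GCWStructure (G : Type u) [Group G] (X : Type u) [TopologicalSpace X]
    [MulAction G X] where
  skel : ℕ → Set X
  skel_zero : skel 0 = ∅
  skel_subset : ∀ n, skel n ⊆ skel (n + 1)
  iUnion_skel : ⋃ n, skel n = univ
  smul_mem_skel : ∀ n (g : G) (x : X), x ∈ skel n → g • x ∈ skel n
  /-- `X` carries the colimit topology of its skeleta. -/
  isClosed_of_skel : ∀ C : Set X, (∀ n, IsClosed (C ∩ skel n)) → IsClosed C
  /-- The index type of the equivariant `n`-cells. -/
  cell : ℕ → Type u
  stab : ∀ n, cell n → Subgroup G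
  map : ∀ n, cell n → C(Disk n, X)
  smul_map : ∀ n i (g : G), g ∈ stab n i → ∀ d, g • map n i d = map n i d
  map_mem : ∀ n i d, map n i d ∈ skel (n + 1)
  map_boundary : ∀ n i (d : Disk n), ‖d.1‖ = 1 → map n i d ∈ skel n
  /-- The characteristic maps restrict to a bijection from the disjoint union of the open
  equivariant `n`-cells onto `skel (n + 1) \ skel n`. -/
  map_interior_notMem : ∀ n i (d : Disk n), ‖d.1‖ < 1 → map n i d ∉ skel n
  map_interior_inj : ∀ n i j (g : G) (d d' : Disk n), ‖d.1‖ < 1 → ‖d'.1‖ < 1 →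
    g • map n i d = map n j d' → i = j ∧ d = d' ∧ g ∈ stab n i
  exists_cell : ∀ n, ∀ x ∈ skel (n + 1), x ∉ skel n →
    ∃ (i : cell n) (g : G) (d : Disk n), ‖d.1‖ < 1 ∧ g • map n i d = x
  /-- `skel (n + 1)` carries the pushout topology. -/
  isClosed_of_cells : ∀ n, ∀ C ⊆ skel (n + 1), IsClosed (C ∩ skel n) →
    (∀ i (g : G), IsClosed {d | g • map n i d ∈ C}) → IsClosed C

/-- A `G`-space is a `G`-CW-complex if it carries a `G`-CW-structure. -/
def IsGCWComplex (G : Type u) [Group G] (X : Type u) [TopologicalSpace X] [MulAction G X] : Prop :=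
  Nonempty (GCWStructure G X)

/-- A `G`-invariant subset is a subcomplex if it contains the whole closed cell
as soon as it meets the interior of that cell. -/
def GCWStructure.IsSubcomplex {G : Type u} [Group G] {X : Type u} [TopologicalSpace X]
    [MulAction G X] (S : GCWStructure G X) (A : SubMulAction G X) : Prop :=
  ∀ n i (d : Disk n), ‖d.1‖ < 1 → S.map n i d ∈ A → ∀ d', S.map n i d' ∈ A

section CW

variable {G : Type u} [Group G] {X : Type u} [TopologicalSpace X] [MulAction G X]

theorem GCWStructure.isClosed_skel (S : GCWStructure G X) (n : ℕ) : IsClosed (S.skel n) := by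
  induction n with
  | zero => rw [S.skel_zero]; exact isClosed_empty
  | succ n ih =>
    refine S.isClosed_of_cells n _ Subset.rfl ?_ ?_
    · rwa [inter_eq_right.2 (S.skel_subset n)]
    · intro i g
      have : {d | g • S.map n i d ∈ S.skel (n + 1)} = univ :=
        eq_univ_of_forall fun d => S.smul_mem_skel _ _ _ (S.map_mem n i d)
      rw [this]; exact isClosed_univ

theorem GCWStructure.norm_eq_one_of_mem (S : GCWStructure G X) {n : ℕ} {i : S.cell n}
    {d : Disk n} (h : S.map n i d ∈ S.skel n) : ‖d.1‖ = 1 := by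
  have h1 : ‖d.1‖ ≤ 1 := mem_closedBall_zero_iff.1 d.2
  rcases h1.lt_or_eq with h2 | h2
  · exact (S.map_interior_notMem n i d h2 h).elim
  · exact h2

instance [ContinuousConstSMul G X] (A : SubMulAction G X) : ContinuousConstSMul G A where
  continuous_const_smul g :=
    Continuous.subtype_mk (continuous_subtype_val.const_smul g) _

/-- A subset of a subcomplex is closed if it satisfies the criteria for cells. -/
theorem GCWStructure.isClosed_of_subcomplex [ContinuousConstSMul G X] (S : GCWStructure G X)
    (A : SubMulAction G X) (hA : S.IsSubcomplex A) (n : ℕ) (C : Set X) (hC : C ⊆ S.skel (n + 1))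
    (hCA : C ⊆ A) (h0 : IsClosed (C ∩ S.skel n))
    (h1 : ∀ i (g : G), (∀ d, S.map n i d ∈ A) → IsClosed {d | g • S.map n i d ∈ C}) :
    IsClosed C := by
  refine S.isClosed_of_cells n C hC h0 fun i g => ?_
  by_cases hi : ∀ d, S.map n i d ∈ A
  · exact h1 i g hi
  · have : {d | g • S.map n i d ∈ C} = (fun d => g • S.map n i d) ⁻¹' (C ∩ S.skel n) := by
      ext d
      refine ⟨fun hd => ⟨hd, ?_⟩, fun hd => hd.1⟩
      have h1 : ‖d.1‖ ≤ 1 := mem_closedBall_zero_iff.1 d.2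
      rcases h1.lt_or_eq with h2 | h2
      · refine (hi (hA n i d h2 ?_)).elim
        have := hCA hd
        exact (A.smul_mem_iff' g).1 this
      · exact S.smul_mem_skel _ _ _ (S.map_boundary n i d h2)
    rw [this]
    exact h0.preimage ((S.map n i).continuous.const_smul g)

theorem GCWStructure.isClosed_subcomplex_inter [ContinuousConstSMul G X] (S : GCWStructure G X)
    (A : SubMulAction G X) (hA : S.IsSubcomplex A) (n : ℕ) :
    IsClosed ((A : Set X) ∩ S.skel n) := by
  induction n with
  | zero => simp [S.skel_zero]
  | succ n ih =>
    refine S.isClosed_of_subcomplex A hA n _ inter_subset_right inter_subset_left ?_ ?_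
    · rwa [inter_assoc, inter_eq_right.2 (S.skel_subset n)]
    · intro i g hi
      have : {d | g • S.map n i d ∈ (A : Set X) ∩ S.skel (n + 1)} = univ :=
        eq_univ_of_forall fun d =>
          ⟨A.smul_mem g (hi d), S.smul_mem_skel _ _ _ (S.map_mem n i d)⟩
      rw [this]; exact isClosed_univ

theorem GCWStructure.isClosed_subcomplex [ContinuousConstSMul G X] (S : GCWStructure G X)
    (A : SubMulAction G X) (hA : S.IsSubcomplex A) : IsClosed (A : Set X) :=
  S.isClosed_of_skel _ (S.isClosed_subcomplex_inter A hA)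

/-- The induced `G`-CW-structure on a subcomplex. -/
def GCWStructure.restrict [ContinuousConstSMul G X] (S : GCWStructure G X)
    (A : SubMulAction G X) (hA : S.IsSubcomplex A) : GCWStructure G A where
  skel n := Subtype.val ⁻¹' S.skel n
  skel_zero := by rw [S.skel_zero, preimage_empty]
  skel_subset n := preimage_mono (S.skel_subset n)
  iUnion_skel := by rw [← preimage_iUnion, S.iUnion_skel, preimage_univ]
  smul_mem_skel n g x hx := S.smul_mem_skel n g x.1 hx
  isClosed_of_skel C hC := by
    have hcl := (S.isClosed_subcomplex A hA).isClosedEmbedding_subtypeVal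
    rw [hcl.isClosed_iff_image_isClosed]
    refine S.isClosed_of_skel _ fun n => ?_
    have := (hcl.isClosed_iff_image_isClosed).1 (hC n)
    exact (image_inter_preimage Subtype.val C (S.skel n)) ▸ this
  cell n := {i : S.cell n // ∀ d, S.map n i d ∈ A}
  stab n i := S.stab n i.1
  map n i := ⟨fun d => ⟨S.map n i.1 d, i.2 d⟩, by fun_prop⟩
  smul_map n i g hg d := Subtype.ext (S.smul_map n i.1 g hg d)
  map_mem n i d := S.map_mem n i.1 d
  map_boundary n i d hd := S.map_boundary n i.1 d hd
  map_interior_notMem n i d hd := S.map_interior_notMem n i.1 d hd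
  map_interior_inj n i j g d d' hd hd' h := by
    obtain ⟨h1, h2, h3⟩ := S.map_interior_inj n i.1 j.1 g d d' hd hd' (congrArg Subtype.val h)
    exact ⟨Subtype.ext h1, h2, h3⟩
  exists_cell n x hx hx' := by
    obtain ⟨i, g, d, hd, h⟩ := S.exists_cell n x.1 hx hx'
    refine ⟨⟨i, hA n i d hd ?_⟩, g, d, hd, Subtype.ext h⟩
    refine (A.smul_mem_iff' g).1 ?_
    exact h ▸ x.2
  isClosed_of_cells n C hC h0 h1 := by
    have hcl := (S.isClosed_subcomplex A hA).isClosedEmbedding_subtypeVal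
    rw [hcl.isClosed_iff_image_isClosed] at h0 ⊢
    have h0 := (image_inter_preimage Subtype.val C (S.skel n)) ▸ h0
    refine S.isClosed_of_subcomplex A hA n _ (image_subset_iff.2 hC) ?_ h0 ?_
    · rintro _ ⟨y, -, rfl⟩
      exact y.2
    intro i g hi
    convert h1 ⟨i, hi⟩ g using 1
    ext d
    constructor
    · rintro ⟨y, hy, hyd⟩
      have : y = g • (⟨S.map n i d, hi d⟩ : A) := Subtype.ext hyd
      rw [this] at hy
      exact hy
    · intro hd
      exact ⟨_, hd, rfl⟩

end CW

/-- A `G`-CW-pair `(X, A)`: a `G`-CW-complex `X` with a `G`-CW-subcomplex `A`. -/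
structure GCWPair (G : Type u) [Group G] where
  X : Type u
  [top : TopologicalSpace X]
  [act : MulAction G X]
  [cont : ContinuousConstSMul G X]
  A : SubMulAction G X
  isGCW : ∃ S : GCWStructure G X, S.IsSubcomplex A

attribute [instance] GCWPair.top GCWPair.act GCWPair.cont

/-- Maps of `G`-CW-pairs are all continuous `G`-equivariant maps of pairs. -/
@[ext]
structure GCWPair.Hom {G : Type u} [Group G] (P Q : GCWPair G) where
  toFun : P.X → Q.X
  continuous_toFun : Continuous toFun
  map_smul : ∀ (g : G) (x : P.X), toFun (g • x) = g • toFun x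
  map_mem : ∀ x ∈ P.A, toFun x ∈ Q.A

/-- The category of `G`-CW-pairs. -/
instance (G : Type u) [Group G] : Category (GCWPair G) where
  Hom := GCWPair.Hom
  id P := ⟨id, continuous_id, fun _ _ => rfl, fun _ h => h⟩
  comp f g := ⟨g.toFun ∘ f.toFun, g.continuous_toFun.comp f.continuous_toFun,
    fun a x => by simp [f.map_smul, g.map_smul], fun x hx => g.map_mem _ (f.map_mem x hx)⟩

namespace GCWPair

variable {G : Type u} [Group G]

@[ext]
theorem hom_ext {P Q : GCWPair G} {f g : P ⟶ Q} (h : f.toFun = g.toFun) : f = g :=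
  Hom.ext h

@[simp]
theorem comp_toFun {P Q R : GCWPair G} (f : P ⟶ Q) (g : Q ⟶ R) :
    (f ≫ g).toFun = g.toFun ∘ f.toFun := rfl

@[simp]
theorem id_toFun (P : GCWPair G) : Hom.toFun (𝟙 P) = id := rfl

/-- A `G`-CW-complex `X` regarded as the pair `(X, ∅)`. -/
def ofComplex (X : Type u) [TopologicalSpace X] [MulAction G X] [ContinuousConstSMul G X]
    (h : IsGCWComplex G X) : GCWPair G where
  X := X
  A := ⊥
  isGCW := h.elim fun S => ⟨S, fun _ _ _ _ hd => hd.elim⟩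

/-- The pair `(X, ∅)` of a pair `(X, A)`. -/
def abs (P : GCWPair G) : GCWPair G :=
  ofComplex P.X (P.isGCW.elim fun S _ => ⟨S⟩)

/-- The pair `(A, ∅)` of a pair `(X, A)`. -/
def sub (P : GCWPair G) : GCWPair G :=
  ofComplex P.A (P.isGCW.elim fun S hS => ⟨S.restrict P.A hS⟩)

/-- The inclusion `i : A → X`. -/
def incl (P : GCWPair G) : P.sub ⟶ P.abs :=
  Hom.mk (P := P.sub) (Q := P.abs) (fun x : P.A => (x.1 : P.X)) continuous_subtype_val
    (fun _ _ => rfl) (fun _ h => h.elim)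

/-- The inclusion `j : X → (X, A)`. -/
def toPair (P : GCWPair G) : P.abs ⟶ P :=
  Hom.mk (P := P.abs) (Q := P) (fun x : P.X => x) continuous_id
    (fun _ _ => rfl) (fun _ h => h.elim)

/-- The restriction `A → B` of a map of pairs `(X, A) → (Y, B)`. -/
def subMap {P Q : GCWPair G} (f : P ⟶ Q) : P.sub ⟶ Q.sub :=
  Hom.mk (P := P.sub) (Q := Q.sub) (fun x : P.A => (⟨f.toFun x.1, f.map_mem x.1 x.2⟩ : Q.A))
    (Continuous.subtype_mk (f.continuous_toFun.comp continuous_subtype_val) _)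
    (fun g x => Subtype.ext (f.map_smul g x.1)) (fun _ h => h.elim)

/-- The functor `(X, A) ↦ (A, ∅)`. -/
def subFunctor (G : Type u) [Group G] : GCWPair G ⥤ GCWPair G where
  obj := sub
  map := subMap

/-- Two maps `(X, A) → (Y, B)` are `G`-homotopic (as maps of pairs). -/
def Homotopic {P Q : GCWPair G} (f₀ f₁ : P ⟶ Q) : Prop :=
  ∃ h : P.X × unitInterval → Q.X, Continuous h ∧
    (∀ (g : G) x t, h (g • x, t) = g • h (x, t)) ∧ (∀ x ∈ P.A, ∀ t, h (x, t) ∈ Q.A) ∧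
    (∀ x, h (x, 0) = f₀.toFun x) ∧ ∀ x, h (x, 1) = f₁.toFun x

/-- `F : (X, A) → (Y, B)` exhibits `Y` as the adjunction space `X ∪_f B` for the restriction
`f : A → B` of `F`: the canonical continuous map `X ∪_f B → Y` is bijective and closed. -/
structure IsAdjunction {P Q : GCWPair G} (F : P ⟶ Q) : Prop where
  bijOn : BijOn F.toFun (P.A : Set P.X)ᶜ (Q.A : Set Q.X)ᶜ
  isClosed_of : ∀ C : Set Q.X, IsClosed (F.toFun ⁻¹' C) →
    IsClosed (Subtype.val ⁻¹' C : Set Q.A) → IsClosed C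

/-- The restriction `f : A → B` of `F : (X, A) → (Y, B)` is cellular for some `G`-CW-structures
on `(X, A)` and on `B`. -/
def IsCellularOnSub {P Q : GCWPair G} (F : P ⟶ Q) : Prop :=
  ∃ (S : GCWStructure G P.X) (T : GCWStructure G Q.A), S.IsSubcomplex P.A ∧
    ∀ n (x : P.A), x.1 ∈ S.skel n → (⟨F.toFun x.1, F.map_mem x.1 x.2⟩ : Q.A) ∈ T.skel n

/-! ### The one-point space -/

/-- The one-point space with its unique `G`-CW-structure. -/
def pointStructure (G : Type u) [Group G] : GCWStructure G PUnit.{u + 1} where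
  skel n := {_x | 0 < n}
  skel_zero := by simp
  skel_subset n := by intro x hx; simp
  iUnion_skel := eq_univ_of_forall fun _ => mem_iUnion.2 ⟨1, by simp⟩
  smul_mem_skel n g x hx := hx
  isClosed_of_skel C _ := isClosed_discrete C
  cell n := ULift (PLift (n = 0))
  stab _ _ := ⊤
  map _ _ := ⟨fun _ => PUnit.unit, continuous_const⟩
  smul_map _ _ _ _ _ := rfl
  map_mem n i d := by simp
  map_boundary n i d hd := by
    obtain ⟨⟨rfl⟩⟩ := i
    have : d.1 = 0 := Subsingleton.elim _ _
    simp [this] at hd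
  map_interior_notMem n i d hd := by
    obtain ⟨⟨rfl⟩⟩ := i
    simp
  map_interior_inj n i j g d d' _ _ _ := by
    obtain ⟨⟨h⟩⟩ := i
    subst h
    exact ⟨Subsingleton.elim _ _, Subtype.ext (Subsingleton.elim _ _), trivial⟩
  exists_cell n x _ hx := by
    have hn : n = 0 := by simpa using hx
    subst hn
    exact ⟨⟨⟨rfl⟩⟩, 1, ⟨0, by simp⟩, by simp, rfl⟩
  isClosed_of_cells n C _ _ _ := isClosed_discrete C

instance : ContinuousConstSMul G PUnit.{u + 1} := ⟨fun _ => continuous_const⟩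

/-- The pair `({•}, ∅)`. -/
def point (G : Type u) [Group G] : GCWPair G := ofComplex PUnit.{u + 1} ⟨pointStructure G⟩

/-- The projection of a pair of the form `(X, ∅)` to the one-point space. -/
def toPoint (P : GCWPair G) (h : P.A = ⊥) : P ⟶ point G :=
  Hom.mk (P := P) (Q := point G) (fun _ => PUnit.unit) continuous_const (fun _ _ => rfl)
    (fun x hx => by rw [h] at hx; exact hx.elim)

theorem hom_point_ext {P : GCWPair G} (f g : P ⟶ point G) : f = g :=
  hom_ext (funext fun _ => Subsingleton.elim (α := PUnit) _ _)

/-! ### Disjoint unions -/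

section Sigma

variable {ι : Type u} (X : ι → Type u) [∀ i, TopologicalSpace (X i)] [∀ i, MulAction G (X i)]

instance [∀ i, ContinuousConstSMul G (X i)] : ContinuousConstSMul G (Σ i, X i) where
  continuous_const_smul g :=
    continuous_sigma fun i => continuous_sigmaMk.comp (continuous_const_smul g)

/-- The `G`-CW-structure on a disjoint union. -/
def sigmaStructure (S : ∀ i, GCWStructure G (X i)) : GCWStructure G (Σ i, X i) where
  skel n := {x | x.2 ∈ (S x.1).skel n}
  skel_zero := by ext x; simp [(S x.1).skel_zero]
  skel_subset n x hx := (S x.1).skel_subset n hx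
  iUnion_skel := eq_univ_of_forall fun x => by
    have : x.2 ∈ ⋃ n, (S x.1).skel n := by rw [(S x.1).iUnion_skel]; trivial
    obtain ⟨n, hn⟩ := mem_iUnion.1 this
    exact mem_iUnion.2 ⟨n, hn⟩
  smul_mem_skel n g x hx := (S x.1).smul_mem_skel n g x.2 hx
  isClosed_of_skel C hC := by
    rw [isClosed_sigma_iff]
    intro i
    exact (S i).isClosed_of_skel _ fun n => (isClosed_sigma_iff.1 (hC n)) i
  cell n := Σ i, (S i).cell n
  stab n i := (S i.1).stab n i.2
  map n i := ⟨fun d => ⟨i.1, (S i.1).map n i.2 d⟩, by fun_prop⟩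
  smul_map n i g hg d := by
    change (⟨i.1, g • (S i.1).map n i.2 d⟩ : Σ i, X i) = ⟨i.1, (S i.1).map n i.2 d⟩
    rw [(S i.1).smul_map n i.2 g hg d]
  map_mem n i d := (S i.1).map_mem n i.2 d
  map_boundary n i d hd := (S i.1).map_boundary n i.2 d hd
  map_interior_notMem n i d hd := (S i.1).map_interior_notMem n i.2 d hd
  map_interior_inj n i j g d d' hd hd' h := by
    obtain ⟨i, a⟩ := i
    obtain ⟨j, b⟩ := j
    obtain rfl : i = j := congrArg Sigma.fst h
    have h' : g • (S i).map n a d = (S i).map n b d' := by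
      have := h
      exact eq_of_heq (Sigma.mk.inj this).2
    obtain ⟨h1, h2, h3⟩ := (S i).map_interior_inj n a b g d d' hd hd' h'
    exact ⟨by rw [h1], h2, h3⟩
  exists_cell n x hx hx' := by
    obtain ⟨i, y⟩ := x
    obtain ⟨a, g, d, hd, h⟩ := (S i).exists_cell n y hx hx'
    refine ⟨⟨i, a⟩, g, d, hd, ?_⟩
    change (⟨i, g • (S i).map n a d⟩ : Σ i, X i) = ⟨i, y⟩
    rw [h]
  isClosed_of_cells n C hC h0 h1 := by
    rw [isClosed_sigma_iff] at h0 ⊢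
    intro i
    exact (S i).isClosed_of_cells n _ (fun x hx => hC hx) (h0 i) fun a g => h1 ⟨i, a⟩ g

variable [∀ i, ContinuousConstSMul G (X i)] (hX : ∀ i, IsGCWComplex G (X i))

/-- The disjoint union of a family of `G`-CW-complexes. -/
def coprod : GCWPair G :=
  ofComplex (Σ i, X i) ⟨sigmaStructure X fun i => Classical.choice (hX i)⟩

/-- The canonical inclusion of a summand into the disjoint union. -/
def coprodIncl (i : ι) : ofComplex (X i) (hX i) ⟶ coprod X hX :=
  Hom.mk (P := ofComplex (X i) (hX i)) (Q := coprod X hX) (fun x => (⟨i, x⟩ : Σ i, X i))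
    (continuous_sigmaMk : Continuous fun x : X i => (⟨i, x⟩ : Σ i, X i))
    (fun _ _ => rfl) (fun _ h => h.elim)

end Sigma

end GCWPair

/-! ### Induction of `H`-CW-pairs along a group homomorphism -/

section Induction

variable {H G : Type u} [Group H] [Group G]

/-- The orbit relation on `G × X` of the right action `(g, x) · h = (g α(h), h⁻¹ x)` of `H`.
The sigma type is the product of the discrete space `G` with `X`. -/
def indSetoid (α : H →* G) (X : Type u) [MulAction H X] : Setoid (Σ _ : G, X) where
  r p q := ∃ h : H, q.1 = p.1 * α h ∧ q.2 = h⁻¹ • p.2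
  iseqv :=
    { refl := fun p => ⟨1, by simp⟩
      symm := by
        rintro p q ⟨h, h1, h2⟩
        exact ⟨h⁻¹, by simp [h1], by simp [h2]⟩
      trans := by
        rintro p q r ⟨h, h1, h2⟩ ⟨k, k1, k2⟩
        exact ⟨h * k, by simp [h1, k1, mul_assoc], by simp [h2, k2, mul_smul]⟩ }

/-- The underlying space of the induction `G ×_α X` of an `H`-space `X` along `α : H → G`. -/
def Ind (α : H →* G) (X : Type u) [MulAction H X] : Type u := Quotient (indSetoid α X)

namespace Ind

variable (α : H →* G) {X : Type u} [MulAction H X]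

/-- The class of `(g, x)`. -/
def mk (g : G) (x : X) : Ind α X := Quotient.mk (indSetoid α X) ⟨g, x⟩

variable {α}

theorem mk_eq_mk {g g' : G} {x x' : X} :
    mk α g x = mk α g' x' ↔ ∃ h : H, g' = g * α h ∧ x' = h⁻¹ • x :=
  Quotient.eq (r := indSetoid α X)

theorem mk_mul (g : G) (h : H) (x : X) : mk α (g * α h) x = mk α g (h • x) :=
  (mk_eq_mk.2 ⟨h, rfl, by simp⟩).symm

theorem ind {p : Ind α X → Prop} (h : ∀ g x, p (mk α g x)) (y : Ind α X) : p y :=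
  Quotient.ind (fun a => h a.1 a.2) y

/-- Maps out of `G ×_α X`. -/
def lift {Z : Type*} (f : G → X → Z) (hf : ∀ g h x, f (g * α h) x = f g (h • x)) :
    Ind α X → Z :=
  Quotient.lift (fun p : Σ _ : G, X => f p.1 p.2) (by
    rintro ⟨g, x⟩ ⟨g', x'⟩ ⟨h, h1, h2⟩
    dsimp only at h1 h2 ⊢
    rw [h1, hf, h2, smul_inv_smul])

@[simp]
theorem lift_mk {Z : Type*} (f : G → X → Z) (hf : ∀ g h x, f (g * α h) x = f g (h • x))
    (g : G) (x : X) : lift f hf (mk α g x) = f g x := rfl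

instance : MulAction G (Ind α X) where
  smul g := lift (fun g' x => mk α (g * g') x) fun g' h x => by rw [← mul_assoc, mk_mul]
  one_smul := by
    refine Ind.ind fun g x => ?_
    change mk α (1 * g) x = mk α g x
    rw [one_mul]
  mul_smul a b := by
    refine Ind.ind fun g x => ?_
    change mk α (a * b * g) x = mk α (a * (b * g)) x
    rw [mul_assoc]

@[simp]
theorem smul_mk (g g' : G) (x : X) : g • mk α g' x = mk α (g * g') x := rfl

variable [TopologicalSpace X]

instance : TopologicalSpace (Ind α X) :=
  inferInstanceAs (TopologicalSpace (Quotient (indSetoid α X)))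

theorem continuous_mk (g : G) : Continuous (mk α g : X → Ind α X) :=
  continuous_quotient_mk'.comp continuous_sigmaMk

theorem continuous_lift {Z : Type*} [TopologicalSpace Z] (f : G → X → Z)
    (hf : ∀ g h x, f (g * α h) x = f g (h • x)) (hc : ∀ g, Continuous (f g)) :
    Continuous (lift (α := α) f hf) :=
  Continuous.quotient_lift (continuous_sigma hc) _

theorem isClosed_iff (C : Set (Ind α X)) : IsClosed C ↔ ∀ g, IsClosed {x | mk α g x ∈ C} := by
  refine Iff.trans (isQuotientMap_quotient_mk' (s := indSetoid α X)).isClosed_preimage.symm ?_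
  exact isClosed_sigma_iff

instance : ContinuousConstSMul G (Ind α X) where
  continuous_const_smul g := continuous_lift _ _ fun g' => continuous_mk (g * g')

variable (α) in
/-- The image `G ×_α A` of a subspace. -/
def sub (A : SubMulAction H X) : SubMulAction G (Ind α X) where
  carrier := {y | ∃ g, ∃ x ∈ A, mk α g x = y}
  smul_mem' := by
    rintro g _ ⟨g', x, hx, rfl⟩
    exact ⟨g * g', x, hx, rfl⟩

theorem mk_mem_sub {A : SubMulAction H X} {g : G} {x : X} : mk α g x ∈ sub α A ↔ x ∈ A := by
  constructor
  · rintro ⟨g', x', hx', h⟩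
    obtain ⟨k, -, rfl⟩ := mk_eq_mk.1 h
    exact A.smul_mem _ hx'
  · intro hx
    exact ⟨g, x, hx, rfl⟩

variable (α) in
/-- The induced `G`-CW-structure on `G ×_α X`. -/
def structure_ [ContinuousConstSMul H X] (S : GCWStructure H X) : GCWStructure G (Ind α X) :=
  have key : ∀ n g x, mk α g x ∈ {y : Ind α X | ∃ g, ∃ x ∈ S.skel n, mk α g x = y} ↔
      x ∈ S.skel n := by
    intro n g x
    constructor
    · rintro ⟨g', x', hx', h⟩
      obtain ⟨k, -, rfl⟩ := mk_eq_mk.1 h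
      exact S.smul_mem_skel _ _ _ hx'
    · intro hx
      exact ⟨g, x, hx, rfl⟩
  { skel := fun n => {y | ∃ g, ∃ x ∈ S.skel n, mk α g x = y}
    skel_zero := by ext y; simp [S.skel_zero]
    skel_subset := by
      rintro n _ ⟨g, x, hx, rfl⟩
      exact ⟨g, x, S.skel_subset n hx, rfl⟩
    iUnion_skel := eq_univ_of_forall <| Ind.ind fun g x => by
      have : x ∈ ⋃ n, S.skel n := by rw [S.iUnion_skel]; trivial
      obtain ⟨n, hn⟩ := mem_iUnion.1 this
      exact mem_iUnion.2 ⟨n, g, x, hn, rfl⟩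
    smul_mem_skel := by
      rintro n g _ ⟨g', x, hx, rfl⟩
      exact ⟨g * g', x, hx, rfl⟩
    isClosed_of_skel := by
      intro C hC
      rw [isClosed_iff]
      refine fun g => S.isClosed_of_skel _ fun n => ?_
      convert (isClosed_iff _).1 (hC n) g using 1
      ext x
      exact and_congr_right fun _ => (key n g x).symm
    cell := S.cell
    stab := fun n i => (S.stab n i).map α
    map := fun n i => ⟨fun d => mk α 1 (S.map n i d),
      (continuous_mk 1).comp (S.map n i).continuous⟩
    smul_map := by
      rintro n i _ ⟨h, hh, rfl⟩ d
      change mk α (α h * 1) (S.map n i d) = mk α 1 (S.map n i d)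
      rw [mul_one, ← one_mul (α h), mk_mul, S.smul_map n i h hh]
    map_mem := fun n i d => ⟨1, _, S.map_mem n i d, rfl⟩
    map_boundary := fun n i d hd => ⟨1, _, S.map_boundary n i d hd, rfl⟩
    map_interior_notMem := fun n i d hd h =>
      S.map_interior_notMem n i d hd ((key n 1 (S.map n i d)).1 h)
    map_interior_inj := by
      intro n i j g d d' hd hd' h
      obtain ⟨k, hk, hk'⟩ := mk_eq_mk.1 h
      obtain ⟨h1, h2, h3⟩ := S.map_interior_inj n i j k⁻¹ d d' hd hd' hk'.symm
      refine ⟨h1, h2, k⁻¹, h3, ?_⟩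
      rw [mul_one] at hk
      rw [map_inv]
      exact (eq_inv_of_mul_eq_one_left hk.symm).symm
    exists_cell := by
      rintro n _ ⟨g, x, hx, rfl⟩ hx'
      obtain ⟨i, h, d, hd, rfl⟩ := S.exists_cell n x hx (fun h => hx' ⟨g, x, h, rfl⟩)
      refine ⟨i, g * α h, d, hd, ?_⟩
      change mk α (g * α h * 1) (S.map n i d) = mk α g (h • S.map n i d)
      rw [mul_one, mk_mul]
    isClosed_of_cells := by
      intro n C hC h0 h1
      rw [isClosed_iff] at h0 ⊢
      intro g
      refine S.isClosed_of_cells n _ (fun x hx => (key (n + 1) g x).1 (hC hx)) ?_ ?_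
      · convert h0 g using 1
        ext x
        exact and_congr_right fun _ => (key n g x).symm
      · intro i h
        convert h1 i (g * α h) using 1
        ext d
        change mk α g (h • S.map n i d) ∈ C ↔ mk α (g * α h * 1) (S.map n i d) ∈ C
        rw [mul_one, mk_mul] }

theorem isSubcomplex [ContinuousConstSMul H X] (S : GCWStructure H X) (A : SubMulAction H X)
    (hA : S.IsSubcomplex A) : (structure_ α S).IsSubcomplex (sub α A) := by
  intro n i d hd h d'
  exact mk_mem_sub.2 (hA n i d hd (mk_mem_sub.1 h) d')

end Ind

namespace GCWPair

/-- The induction `α_* (X, A)` of an `H`-CW-pair. -/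
def indObj (α : H →* G) (P : GCWPair H) : GCWPair G where
  X := Ind α P.X
  A := Ind.sub α P.A
  isGCW := P.isGCW.elim fun S hS => ⟨Ind.structure_ α S, Ind.isSubcomplex S P.A hS⟩

/-- The map `α_* f : (g, x) ↦ (g, f x)`. -/
def indMap (α : H →* G) {P Q : GCWPair H} (f : P ⟶ Q) : indObj α P ⟶ indObj α Q :=
  Hom.mk (P := indObj α P) (Q := indObj α Q)
    (Ind.lift (fun g x => Ind.mk α g (f.toFun x)) fun g h x => by rw [Ind.mk_mul, f.map_smul])
    (Ind.continuous_lift _ _ fun g => (Ind.continuous_mk g).comp f.continuous_toFun)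
    (fun g => Ind.ind fun _ _ => rfl)
    (by
      rintro _ ⟨g, x, hx, rfl⟩
      exact ⟨g, f.toFun x, f.map_mem x hx, rfl⟩)

/-- Induction along `α` as a functor. -/
def indFunctor (α : H →* G) : GCWPair H ⥤ GCWPair G where
  obj := indObj α
  map := indMap α
  map_id _ := hom_ext (funext (Ind.ind fun _ _ => rfl))
  map_comp _ _ := hom_ext (funext (Ind.ind fun _ _ => rfl))

/-- The identification `α_* (A, ∅) → (α_* A, ∅)`, `(g, a) ↦ (g, a)`. -/
def indSub (α : H →* G) (P : GCWPair H) : (indFunctor α).obj P.sub ⟶ ((indFunctor α).obj P).sub :=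
  Hom.mk (P := indObj α P.sub) (Q := (indObj α P).sub)
    (Ind.lift (X := P.A)
      (fun g x => (⟨Ind.mk α g x.1, Ind.mk_mem_sub.2 x.2⟩ : Ind.sub α P.A))
      fun g h x => Subtype.ext (Ind.mk_mul g h x.1))
    (Ind.continuous_lift (X := P.A) _ _ fun g =>
      Continuous.subtype_mk ((Ind.continuous_mk g).comp continuous_subtype_val) _)
    (fun g => Ind.ind fun _ _ => rfl)
    (by
      rintro _ ⟨g, x, hx, rfl⟩
      exact hx.elim)

/-- The natural map `f₁ : β_* α_* (X, A) → (β ∘ α)_* (X, A)`, `(k, g, x) ↦ (k β(g), x)`. -/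
def indComp {K : Type u} [Group K] (β : G →* K) (α : H →* G) (P : GCWPair H) :
    (indFunctor β).obj ((indFunctor α).obj P) ⟶ (indFunctor (β.comp α)).obj P :=
  Hom.mk (P := indObj β (indObj α P)) (Q := indObj (β.comp α) P)
    (Ind.lift (X := Ind α P.X)
      (fun k => Ind.lift (fun g x => Ind.mk (β.comp α) (k * β g) x) fun g h x => by
        rw [map_mul, ← mul_assoc]; exact Ind.mk_mul (α := β.comp α) _ h x)
      (fun k g => Ind.ind fun g' x => by
        change Ind.mk (β.comp α) (k * β g * β g') x = Ind.mk (β.comp α) (k * β (g * g')) x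
        rw [map_mul, mul_assoc]))
    (Ind.continuous_lift (X := Ind α P.X) _ _ fun k =>
      Ind.continuous_lift _ _ fun g => Ind.continuous_mk _)
    (fun g => Ind.ind fun k => Ind.ind fun g' x => by
      change Ind.mk (β.comp α) (g * k * β g') x = Ind.mk (β.comp α) (g * (k * β g')) x
      rw [mul_assoc])
    (by
      rintro _ ⟨k, _, ⟨g, x, hx, rfl⟩, rfl⟩
      exact ⟨k * β g, x, hx, rfl⟩)

/-- The map `f₂ : (X, A) → c(g)_* (X, A)`, `x ↦ (1, g⁻¹ x)`, where `c(g)` is conjugation. -/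
def conjMap (g : G) (P : GCWPair G) :
    P ⟶ (indFunctor (MulAut.conj g).toMonoidHom).obj P :=
  Hom.mk (P := P) (Q := indObj (MulAut.conj g).toMonoidHom P)
    (fun x => Ind.mk (MulAut.conj g).toMonoidHom 1 (g⁻¹ • x))
    ((Ind.continuous_mk 1).comp (continuous_const_smul g⁻¹))
    (fun k x => by
      change Ind.mk (MulAut.conj g).toMonoidHom 1 (g⁻¹ • k • x) =
        Ind.mk (MulAut.conj g).toMonoidHom (k * 1) (g⁻¹ • x)
      refine (Ind.mk_eq_mk.2 ⟨g⁻¹ * k * g, ?_, ?_⟩)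
      · simp [mul_assoc]
      · simp [mul_smul])
    (fun x hx => ⟨1, g⁻¹ • x, P.A.smul_mem _ hx, rfl⟩)

theorem indObj_point_A (α : H →* G) : ((indFunctor α).obj (point H)).A = ⊥ := by
  ext y
  constructor
  · rintro ⟨_, _, hx, _⟩
    exact hx.elim
  · intro h
    exact h.elim

end GCWPair

end Induction

/-! ### (Equivariant) homology theories -/

open GCWPair in
open Classical in
/-- A `G`-homology theory with values in `Λ`-modules. -/
structure GHomologyTheory (G : Type u) [Group G] (Λ : Type v) [Ring Λ] where
  H : ℤ → GCWPair G ⥤ ModuleCat.{w} Λ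
  /-- The boundary homomorphisms `∂ : H n (X, A) → H (n - 1) (A)`. -/
  boundary : ∀ n, H n ⟶ subFunctor G ⋙ H (n - 1)
  homotopy_invariance : ∀ {P Q : GCWPair G} (f₀ f₁ : P ⟶ Q), Homotopic f₀ f₁ →
    ∀ n, (H n).map f₀ = (H n).map f₁
  exact_abs : ∀ (P : GCWPair G) n,
    Function.Exact ((H n).map P.incl).hom ((H n).map P.toPair).hom
  exact_pair : ∀ (P : GCWPair G) n,
    Function.Exact ((H n).map P.toPair).hom ((boundary n).app P).hom
  exact_sub : ∀ (P : GCWPair G) n,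
    Function.Exact ((boundary n).app P).hom ((H (n - 1)).map P.incl).hom
  excision : ∀ {P Q : GCWPair G} (F : P ⟶ Q), IsCellularOnSub F → IsAdjunction F →
    ∀ n, Function.Bijective ((H n).map F).hom
  disjoint_union : ∀ {ι : Type u} (X : ι → Type u) [∀ i, TopologicalSpace (X i)]
    [∀ i, MulAction G (X i)] [∀ i, ContinuousConstSMul G (X i)]
    (hX : ∀ i, IsGCWComplex G (X i)) (n : ℤ),
    Function.Bijective (DirectSum.toModule Λ ι ((H n).obj (coprod X hX))
      fun i => ((H n).map (coprodIncl X hX i)).hom)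

open GCWPair in
/-- An equivariant homology theory over `Γ` with values in `Λ`-modules: a `G`-homology theory for
every group `(G, ξ)` over `Γ`, together with an induction structure. -/
structure EquivariantHomologyTheory (Γ : Type z) [Group Γ] (Λ : Type v) [Ring Λ] where
  theory : ∀ (G : Type u) [Group G], (G →* Γ) → GHomologyTheory.{u, v, w} G Λ
  /-- The natural homomorphisms `ind_α : H n (X, A) → H n (α_* (X, A))` for a homomorphism
  `α : (H, ξ) → (G, μ)` of groups over `Γ`. -/
  ind : ∀ {H G : Type u} [Group H] [Group G] (ξ : H →* Γ) (μ : G →* Γ) (α : H →* G),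
    μ.comp α = ξ → ∀ n : ℤ, (theory H ξ).H n ⟶ indFunctor α ⋙ (theory G μ).H n
  ind_boundary : ∀ {H G : Type u} [Group H] [Group G] (ξ : H →* Γ) (μ : G →* Γ) (α : H →* G)
    (hα : μ.comp α = ξ) (n : ℤ) (P : GCWPair H),
    (ind ξ μ α hα n).app P ≫ ((theory G μ).boundary n).app ((indFunctor α).obj P) =
      ((theory H ξ).boundary n).app P ≫ (ind ξ μ α hα (n - 1)).app P.sub ≫
        ((theory G μ).H (n - 1)).map (indSub α P)
  ind_comp : ∀ {H G K : Type u} [Group H] [Group G] [Group K] (ξ : H →* Γ) (μ : G →* Γ)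
    (ν : K →* Γ) (α : H →* G) (β : G →* K) (hα : μ.comp α = ξ) (hβ : ν.comp β = μ)
    (hβα : ν.comp (β.comp α) = ξ) (n : ℤ) (P : GCWPair H),
    (ind ξ ν (β.comp α) hβα n).app P =
      (ind ξ μ α hα n).app P ≫ (ind μ ν β hβ n).app ((indFunctor α).obj P) ≫
        ((theory K ν).H n).map (indComp β α P)
  ind_conj : ∀ {G : Type u} [Group G] (ξ : G →* Γ) (g : G), ξ g = 1 →
    ∀ (hg : ξ.comp (MulAut.conj g).toMonoidHom = ξ) (n : ℤ) (P : GCWPair G),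
      (ind ξ ξ (MulAut.conj g).toMonoidHom hg n).app P =
        ((theory G ξ).H n).map (conjMap g P)
  ind_bijective : ∀ {G : Type u} [Group G] (μ : G →* Γ) (K : Subgroup G) (n : ℤ),
    Function.Bijective ((ind (μ.comp K.subtype) μ K.subtype rfl n).app (point K)).hom

/-! ### Families of subgroups and classifying spaces -/

/-- A family of subgroups: closed under conjugation and under taking subgroups. -/
structure SubgroupFamily (G : Type u) [Group G] where
  carrier : Set (Subgroup G)
  conj_mem : ∀ K ∈ carrier, ∀ g : G, K.map (MulAut.conj g).toMonoidHom ∈ carrier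
  mem_of_le : ∀ K ∈ carrier, ∀ L ≤ K, L ∈ carrier

/-- The family `φ^* F` of all subgroups `L` with `φ(L) ∈ F`. -/
def SubgroupFamily.comap {K G : Type u} [Group K] [Group G] (F : SubgroupFamily G)
    (φ : K →* G) : SubgroupFamily K where
  carrier := {L | L.map φ ∈ F.carrier}
  conj_mem L hL k := by
    have h := F.conj_mem _ hL (φ k)
    have e : (L.map (MulAut.conj k).toMonoidHom).map φ =
        (L.map φ).map (MulAut.conj (φ k)).toMonoidHom := by
      rw [Subgroup.map_map, Subgroup.map_map]
      congr 1
      ext x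
      simp
    change _ ∈ F.carrier
    rw [e]
    exact h
  mem_of_le L hL M hM := F.mem_of_le _ hL _ (Subgroup.map_mono hM)

/-- The `G`-CW-complex `E` is a model for the classifying space of the family `F`: the fixed point
space `E^L` is contractible (in particular non-empty) if `L ∈ F` and empty if `L ∉ F`. -/
structure IsClassifyingSpace {G : Type u} [Group G] (F : SubgroupFamily G) (E : Type u)
    [TopologicalSpace E] [MulAction G E] : Prop where
  isGCW : IsGCWComplex G E
  contractible : ∀ L ∈ F.carrier, ContractibleSpace {x : E | ∀ g ∈ L, g • x = x}
  empty : ∀ L ∉ F.carrier, {x : E | ∀ g ∈ L, g • x = x} = ∅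

/-! ### Colimits of groups, continuity and the Isomorphism Conjecture -/

/-- `G` together with the structure maps `ψ i` is the colimit of the system of groups
`(Gi, φ)`. -/
structure IsGroupColimit {I : Type u} [Preorder I] {Gi : I → Type u} [∀ i, Group (Gi i)]
    (φ : ∀ i j, i ≤ j → Gi i →* Gi j) {G : Type u} [Group G] (ψ : ∀ i, Gi i →* G) : Prop where
  comp_eq : ∀ i j (h : i ≤ j), (ψ j).comp (φ i j h) = ψ i
  existsUnique_desc : ∀ (L : Type u) [Group L] (f : ∀ i, Gi i →* L),
    (∀ i j (h : i ≤ j), (f j).comp (φ i j h) = f i) →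
      ∃! d : G →* L, ∀ i, d.comp (ψ i) = f i

namespace EquivariantHomologyTheory

open GCWPair

variable {Γ : Type z} [Group Γ] {Λ : Type v} [Ring Λ]
  (ℋ : EquivariantHomologyTheory.{u, v, w, z} Γ Λ)

/-- `H_n^G({•})`. -/
abbrev coeff {G : Type u} [Group G] (ξ : G →* Γ) (n : ℤ) : ModuleCat.{w} Λ :=
  ((ℋ.theory G ξ).H n).obj (point G)

/-- The map `a_n({•}, α) : H_n^H({•}) → H_n^G(α_* {•}) → H_n^G({•})`. -/
def pointMap {H G : Type u} [Group H] [Group G] (ξ : H →* Γ) (μ : G →* Γ) (α : H →* G)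
    (hα : μ.comp α = ξ) (n : ℤ) : ℋ.coeff ξ n ⟶ ℋ.coeff μ n :=
  (ℋ.ind ξ μ α hα n).app (point H) ≫
    ((ℋ.theory G μ).H n).map (toPoint _ (indObj_point_A α))

theorem pointMap_comp {H G K : Type u} [Group H] [Group G] [Group K] (ξ : H →* Γ) (μ : G →* Γ)
    (ν : K →* Γ) (α : H →* G) (β : G →* K) (γ : H →* K) (hα : μ.comp α = ξ)
    (hβ : ν.comp β = μ) (hγ : ν.comp γ = ξ) (h : β.comp α = γ) (n : ℤ) :
    ℋ.pointMap ξ μ α hα n ≫ ℋ.pointMap μ ν β hβ n = ℋ.pointMap ξ ν γ hγ n := by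
  subst h
  unfold pointMap
  rw [ℋ.ind_comp ξ μ ν α β hα hβ hγ n (point H)]
  simp only [Category.assoc]
  congr 1
  rw [← Category.assoc, (ℋ.ind μ ν β hβ n).naturality]
  simp only [Category.assoc]
  congr 1
  rw [Functor.comp_map, ← Functor.map_comp, ← Functor.map_comp]
  congr 1

open Classical in
/-- The map `t_n({•}) : colim_i H_n^{G_i}({•}) → H_n^G({•})` of a system of groups `Gi` with
compatible maps `ψ i` to a group `(G, ξ)` over `Γ`, where `G_i` is a group over `Γ` by
`ξ ∘ ψ i`. -/
noncomputable def colimMap {I : Type u} [Preorder I] {Gi : I → Type u} [∀ i, Group (Gi i)]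
    (φ : ∀ i j, i ≤ j → Gi i →* Gi j) {G : Type u} [Group G] (ψ : ∀ i, Gi i →* G)
    (hψ : ∀ i j (h : i ≤ j), (ψ j).comp (φ i j h) = ψ i) (ξ : G →* Γ) (n : ℤ) :
    Module.DirectLimit (fun i => ℋ.coeff (ξ.comp (ψ i)) n)
      (fun i j h => (ℋ.pointMap (ξ.comp (ψ i)) (ξ.comp (ψ j)) (φ i j h)
        (by rw [MonoidHom.comp_assoc, hψ]) n).hom) →ₗ[Λ] ℋ.coeff ξ n :=
  Module.DirectLimit.lift Λ I _ _
    (fun i => (ℋ.pointMap (ξ.comp (ψ i)) ξ (ψ i) rfl n).hom) (fun i j h x => by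
      rw [← ℋ.pointMap_comp (ξ.comp (ψ i)) (ξ.comp (ψ j)) ξ (φ i j h) (ψ j) (ψ i)
        (by rw [MonoidHom.comp_assoc, hψ]) rfl rfl (hψ i j h) n]
      rfl)

/-- Continuity: `t_n({•})` is an isomorphism whenever `G` is a directed union of subgroups. -/
def IsContinuous : Prop :=
  ∀ (G : Type u) [Group G] (ξ : G →* Γ) (I : Type u) [Preorder I] [IsDirectedOrder I]
    [Nonempty I] (K : I → Subgroup G) (hK : Monotone K), (∀ g : G, ∃ i, g ∈ K i) →
    ∀ n : ℤ, Function.Bijective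
      (ℋ.colimMap (fun _ _ h => Subgroup.inclusion (hK h)) (fun i => (K i).subtype)
        (fun _ _ _ => rfl) ξ n)

/-- Strong continuity: `t_n({•})` is an isomorphism whenever `G` is the colimit of a directed
system of groups. -/
def IsStronglyContinuous : Prop :=
  ∀ (G : Type u) [Group G] (ξ : G →* Γ) (I : Type u) [Preorder I] [IsDirectedOrder I]
    [Nonempty I] (Gi : I → Type u) [∀ i, Group (Gi i)] (φ : ∀ i j, i ≤ j → Gi i →* Gi j)
    [DirectedSystem Gi (fun i j h => φ i j h)] (ψ : ∀ i, Gi i →* G)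
    (hψ : IsGroupColimit φ ψ) (n : ℤ),
    Function.Bijective (ℋ.colimMap φ ψ hψ.comp_eq ξ n)

/-- `(G, ξ)` and the family `F` satisfy the Isomorphism Conjecture: the projection from the
classifying space of `F` (which is unique up to `G`-homotopy equivalence; every model is
considered) to the one-point space induces isomorphisms `H_n^G(E) → H_n^G({•})`. -/
def IsomorphismConjecture {G : Type u} [Group G] (ξ : G →* Γ) (F : SubgroupFamily G) : Prop :=
  ∀ (E : Type u) [TopologicalSpace E] [MulAction G E] [ContinuousConstSMul G E]
    (hE : IsClassifyingSpace F E) (n : ℤ),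
    Function.Bijective
      (((ℋ.theory G ξ).H n).map (toPoint (ofComplex E hE.isGCW) rfl)).hom

end EquivariantHomologyTheory

end EquivHom

namespace EquivHom

/-! ### Closed subsets and continuous maps in terms of cells -/

namespace GCWStructure

variable {G : Type u} [Group G] {X : Type u} [TopologicalSpace X] [MulAction G X]

/-! For a `G`-CW-complex `X` the groups `H_n^{G_i}(ψ_i^* X)` of its restrictions form a directed
system with compatible maps to `H_n^G(X)`. Under the continuity hypothesis of either part,
`H_n^G(X)` is the colimit of this system for every `X`. Granting this, compare `X = E_F(G)` with the
one-point space. The restriction of `E_F(G)` along `ψ_i` is a model for the classifying space of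
`ψ_i^* F` (`IsClassifyingSpace.res`), so the projection to the point is an isomorphism at every
stage, hence also on the colimits (`isomorphismConjecture_of_isColim`).

For an orbit `G / L` the colimit statement is continuity applied to the group `L` (`isColim_orbit`).
The restriction of `G / L` to `G_j` contains `G_j / ψ_j⁻¹(L)` as the orbit of the base coset. Every
homology class lives on finitely many orbits, and at a later stage these are all mapped into the
orbit of the base coset, because the images of the `G_j` exhaust `G`. So the colimit is that of the
coefficients of the groups `ψ_j⁻¹(L)`. Their colimit is `L`, and `H_n^L({•}) = H_n^G(G / L)`. If the
`G_i` are subgroups, then `ψ_i⁻¹(L) = G_i ∩ L` and plain continuity suffices.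

To pass from orbits to all complexes, note that the pairs with the colimit property form a
localizing class (`isLocalizing_resSystem`): directed colimits are exact and commute with direct
sums, and restriction respects homotopies, excision and coproducts. A localizing class containing
all orbits contains all `G`-CW-complexes (`IsLocalizing.ofComplex_mem`). Skeleta are reached by
attaching cells. Attaching maps need not be cellular, and this is circumvented by collapsing a
subcomplex (`IsLocalizing.of_isAdjunction`). An infinite-dimensional `X` is a homotopy retract of
the telescope, the union of the `skel k × [k, k + 1]` in `X × ℝ`. The telescope is the union of two
subcomplexes which are, like their intersection, homotopy equivalent to disjoint unions of skeleta,
so Mayer-Vietoris applies. The map from `X` to the telescope is built from an explicit radial flow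
(`exists_flow_height`), which replaces homotopy extension arguments. -/

theorem skel_mono (S : GCWStructure G X) : Monotone S.skel :=
  monotone_nat_of_le_succ S.skel_subset

theorem exists_mem_skel (S : GCWStructure G X) (x : X) : ∃ n, x ∈ S.skel n :=
  mem_iUnion.1 (S.iUnion_skel ▸ mem_univ x)

theorem smul_mem_skel_iff (S : GCWStructure G X) {n : ℕ} {g : G} {x : X} :
    g • x ∈ S.skel n ↔ x ∈ S.skel n :=
  ⟨fun h => by simpa using S.smul_mem_skel n g⁻¹ _ h, S.smul_mem_skel n g x⟩

/-- Every point lies in exactly one open cell. -/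
theorem exists_open_cell (S : GCWStructure G X) (x : X) :
    ∃ (n : ℕ) (i : S.cell n) (g : G) (d : Disk n), ‖d.1‖ < 1 ∧ g • S.map n i d = x := by
  classical
  have h := S.exists_mem_skel x
  obtain ⟨n, hn⟩ : ∃ n, Nat.find h = n + 1 := by
    refine Nat.exists_eq_succ_of_ne_zero fun h0 => ?_
    have := Nat.find_spec h
    rw [h0, S.skel_zero] at this
    exact this
  have h1 := Nat.find_spec h
  rw [hn] at h1
  obtain ⟨i, g, d, hd, hx⟩ := S.exists_cell n x h1 (Nat.find_min h (by omega))
  exact ⟨n, i, g, d, hd, hx⟩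

/-- Induction over the skeleta merges the colimit topology and the pushout topologies into a single
test on all translated closed cells. -/
theorem isClosed_iff_cells [ContinuousConstSMul G X] (S : GCWStructure G X) (C : Set X) :
    IsClosed C ↔ ∀ n i (g : G), IsClosed {d | g • S.map n i d ∈ C} := by
  refine ⟨fun h n i g => h.preimage ((S.map n i).continuous.const_smul g), fun h => ?_⟩
  refine S.isClosed_of_skel C fun n => ?_
  induction n with
  | zero => simp [S.skel_zero]
  | succ n ih =>
    refine S.isClosed_of_cells n _ inter_subset_right ?_ fun i g => ?_
    · rwa [inter_assoc, inter_eq_right.2 (S.skel_subset n)]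
    · convert h n i g using 1
      ext d
      exact and_iff_left (S.smul_mem_skel _ _ _ (S.map_mem n i d))

/-- The skeleta as invariant subspaces. -/
def skelSub (S : GCWStructure G X) (n : ℕ) : SubMulAction G X where
  carrier := S.skel n
  smul_mem' g x hx := S.smul_mem_skel n g x hx

@[simp]
theorem mem_skelSub (S : GCWStructure G X) {n : ℕ} {x : X} : x ∈ S.skelSub n ↔ x ∈ S.skel n :=
  Iff.rfl

theorem lt_of_interior_mem_skel (S : GCWStructure G X) {m n : ℕ} {i : S.cell m} {d : Disk m}
    (hd : ‖d.1‖ < 1) (h : S.map m i d ∈ S.skel n) : m < n := by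
  by_contra! hn
  exact S.map_interior_notMem m i d hd (S.skel_mono hn h)

theorem isSubcomplex_skelSub (S : GCWStructure G X) (n : ℕ) : S.IsSubcomplex (S.skelSub n) :=
  fun m i _ hd h d' => S.skel_mono (S.lt_of_interior_mem_skel hd h) (S.map_mem m i d')

/-- The union of all characteristic maps. -/
def cellsMap (S : GCWStructure G X) : (Σ p : (Σ n, S.cell n) × G, Disk p.1.1) → X :=
  fun p => p.1.2 • S.map p.1.1.1 p.1.1.2 p.2

/-- The weak topology in the form of a quotient map, which is the form that survives taking the
product with a locally compact space. -/
theorem isQuotientMap_cellsMap [ContinuousConstSMul G X] (S : GCWStructure G X) :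
    Topology.IsQuotientMap S.cellsMap := by
  rw [Topology.isQuotientMap_iff_isClosed]
  refine ⟨fun x => ?_, fun C => ?_⟩
  · obtain ⟨n, i, g, d, -, h⟩ := S.exists_open_cell x
    exact ⟨⟨⟨⟨n, i⟩, g⟩, d⟩, h⟩
  · rw [S.isClosed_iff_cells, isClosed_sigma_iff]
    exact ⟨fun h p => h p.1.1 p.1.2 p.2, fun h n i g => h ⟨⟨n, i⟩, g⟩⟩

/-- The product of a `G`-CW-complex with a locally compact space carries the weak topology. -/
theorem isClosed_prod_iff_cells [ContinuousConstSMul G X] (S : GCWStructure G X) {Y : Type*}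
    [TopologicalSpace Y] [LocallyCompactSpace Y] (C : Set (X × Y)) :
    IsClosed C ↔ ∀ n i (g : G),
      IsClosed {p : Disk n × Y | (g • S.map n i p.1, p.2) ∈ C} := by
  refine ⟨fun h n i g => h.preimage (by fun_prop), fun h => ?_⟩
  rw [← isOpen_compl_iff]
  -- Openness of the complement is continuity of a `Prop`-valued function, and continuity on a
  -- product with a locally compact factor can be tested after a quotient map in the other factor.
  refine continuous_Prop.1 ((S.isQuotientMap_cellsMap).continuous_lift_prod_left
    (g := fun p : X × Y => p ∉ C) ?_)
  rw [continuous_Prop]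
  have e : {p : (Σ p : (Σ n, S.cell n) × G, Disk p.1.1) × Y | (S.cellsMap p.1, p.2) ∉ C} =
      (Homeomorph.sigmaProdDistrib (Y := Y)
        (X := fun p : (Σ n, S.cell n) × G => Disk p.1.1)) ⁻¹'
        {q | (S.cellsMap ⟨q.1, q.2.1⟩, q.2.2) ∉ C} := by
    ext ⟨⟨p, d⟩, y⟩
    rfl
  rw [e, Homeomorph.isOpen_preimage, isOpen_sigma_iff]
  exact fun p => (h p.1.1 p.1.2 p.2).isOpen_compl

theorem isClosed_prod_of_skel [ContinuousConstSMul G X] (S : GCWStructure G X) {Y : Type*}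
    [TopologicalSpace Y] [LocallyCompactSpace Y] (C : Set (X × Y))
    (h : ∀ n, IsClosed (C ∩ Prod.fst ⁻¹' S.skel n)) : IsClosed C := by
  rw [S.isClosed_prod_iff_cells]
  intro n i g
  convert (h (n + 1)).preimage (f := fun p : Disk n × Y => (g • S.map n i p.1, p.2))
    (by fun_prop) using 1
  ext p
  exact (and_iff_left (S.smul_mem_skel _ _ _ (S.map_mem n i p.1))).symm

/-- The test on all cells is applied to the subcomplex `skel (n + 1)`. Its cells have dimension at
most `n`: those of dimension `n` are covered by `h1`, the others by `h0`. -/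
theorem isClosed_prod_of_cells [ContinuousConstSMul G X] (S : GCWStructure G X) {Y : Type*}
    [TopologicalSpace Y] [LocallyCompactSpace Y] (n : ℕ) (C : Set (X × Y))
    (hC : C ⊆ Prod.fst ⁻¹' S.skel (n + 1)) (h0 : IsClosed (C ∩ Prod.fst ⁻¹' S.skel n))
    (h1 : ∀ i (g : G), IsClosed {p : Disk n × Y | (g • S.map n i p.1, p.2) ∈ C}) :
    IsClosed C := by
  have hA := S.isSubcomplex_skelSub (n + 1)
  have hcl := ((S.isClosed_subcomplex _ hA).isClosedEmbedding_subtypeVal).prodMap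
    (Topology.IsClosedEmbedding.id (X := Y))
  have e : C = Prod.map Subtype.val id '' (Prod.map Subtype.val id ⁻¹' C :
      Set (S.skelSub (n + 1) × Y)) := by
    rw [image_preimage_eq_inter_range, eq_comm, inter_eq_left]
    exact fun p hp => ⟨(⟨p.1, hC hp⟩, p.2), rfl⟩
  rw [e]
  refine hcl.isClosedMap _ (((S.restrict _ hA).isClosed_prod_iff_cells _).2 fun m i g => ?_)
  obtain ⟨i, hi⟩ := i
  have hm : m < n + 1 := S.lt_of_interior_mem_skel (d := ⟨0, by simp⟩) (by simp) (hi _)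
  rcases (Nat.lt_succ_iff.1 hm).eq_or_lt with rfl | hm
  · exact h1 i g
  · convert h0.preimage (f := fun p : Disk m × Y => (g • S.map m i p.1, p.2)) (by fun_prop)
      using 1
    ext p
    exact (and_iff_left (S.smul_mem_skel _ _ _ (S.skel_mono hm (S.map_mem m i p.1)))).symm

/-- A map that is continuous on a skeleton and on the cells of the next dimension is continuous
on the next skeleton. -/
theorem continuousOn_skel_succ_prod [ContinuousConstSMul G X] (S : GCWStructure G X)
    {Y Z : Type*} [TopologicalSpace Y] [LocallyCompactSpace Y] [TopologicalSpace Z] {J : Set Y}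
    (hJ : IsClosed J) (f : X × Y → Z) (n : ℕ) (h0 : ContinuousOn f (S.skel n ×ˢ J))
    (h1 : ∀ i (g : G), ContinuousOn (fun p : Disk n × Y => f (g • S.map n i p.1, p.2))
      (univ ×ˢ J)) : ContinuousOn f (S.skel (n + 1) ×ˢ J) := by
  rw [continuousOn_iff_isClosed] at h0 ⊢
  intro t ht
  refine ⟨f ⁻¹' t ∩ S.skel (n + 1) ×ˢ J, S.isClosed_prod_of_cells n _ ?_ ?_ ?_, ?_⟩
  · rintro p ⟨-, hp, -⟩
    exact hp
  · obtain ⟨u, hu, hu'⟩ := h0 t ht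
    convert hu.inter ((S.isClosed_skel n).prod hJ) using 1
    rw [← hu']
    ext p
    constructor
    · rintro ⟨⟨h2, h3, h4⟩, h5⟩
      exact ⟨h2, h5, h4⟩
    · rintro ⟨h2, h5, h4⟩
      exact ⟨⟨h2, S.skel_subset n h5, h4⟩, h5⟩
  · intro i g
    obtain ⟨u, hu, hu'⟩ := continuousOn_iff_isClosed.1 (h1 i g) t ht
    convert hu.inter (isClosed_univ.prod hJ) using 1
    rw [← hu']
    ext p
    constructor
    · rintro ⟨h2, h3, h4⟩
      exact ⟨h2, trivial, h4⟩
    · rintro ⟨h2, -, h4⟩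
      exact ⟨h2, S.smul_mem_skel _ _ _ (S.map_mem n i p.1), h4⟩
  · rw [inter_assoc, inter_self]

/-- The flow constructed below is controlled only for parameters in a closed interval, whence the
version relative to a closed set `J`. -/
theorem continuousOn_of_skel_prod [ContinuousConstSMul G X] (S : GCWStructure G X)
    {Y Z : Type*} [TopologicalSpace Y] [LocallyCompactSpace Y] [TopologicalSpace Z] {J : Set Y}
    (hJ : IsClosed J) (f : X × Y → Z) (h : ∀ n, ContinuousOn f (S.skel n ×ˢ J)) :
    ContinuousOn f (univ ×ˢ J) := by
  rw [continuousOn_iff_isClosed]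
  intro t ht
  refine ⟨f ⁻¹' t ∩ univ ×ˢ J, S.isClosed_prod_of_skel _ fun n => ?_, by
    rw [inter_assoc, inter_self]⟩
  obtain ⟨u, hu, hu'⟩ := continuousOn_iff_isClosed.1 (h n) t ht
  convert hu.inter ((S.isClosed_skel n).prod hJ) using 1
  rw [← hu']
  ext p
  constructor
  · rintro ⟨⟨h2, h3, h4⟩, h5⟩
    exact ⟨h2, h5, h4⟩
  · rintro ⟨h2, h5, h4⟩
    exact ⟨⟨h2, trivial, h4⟩, h5⟩

end GCWStructure
/-! ### The radial flow on a `G`-CW-complex -/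

/-- The point `r⁻¹ d`, moved to the boundary along a ray if it lies outside of the disk. -/
noncomputable def Disk.rescale {n : ℕ} (r : ℝ) (d : Disk n) : Disk n :=
  ⟨(max 1 ‖r⁻¹ • d.1‖)⁻¹ • r⁻¹ • d.1, by
    have h : 0 < max 1 ‖r⁻¹ • d.1‖ := lt_max_of_lt_left one_pos
    rw [mem_closedBall_zero_iff, norm_smul, norm_inv, Real.norm_of_nonneg h.le,
      inv_mul_le_one₀ h]
    exact le_max_right _ _⟩

namespace Disk

variable {n : ℕ}

theorem norm_le_one (d : Disk n) : ‖d.1‖ ≤ 1 := mem_closedBall_zero_iff.1 d.2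

theorem rescale_of_le {r : ℝ} (hr : 0 < r) {d : Disk n} (h : ‖d.1‖ ≤ r) :
    (rescale r d).1 = r⁻¹ • d.1 := by
  have : ‖r⁻¹ • d.1‖ ≤ 1 := by
    rw [norm_smul, norm_inv, Real.norm_of_nonneg hr.le, inv_mul_le_one₀ hr]
    exact h
  simp [rescale, max_eq_left this]

theorem rescale_one (d : Disk n) : rescale 1 d = d :=
  Subtype.ext (by rw [rescale_of_le one_pos d.norm_le_one, inv_one, one_smul])

theorem norm_rescale_norm {d : Disk n} (h : d.1 ≠ 0) : ‖(rescale ‖d.1‖ d).1‖ = 1 := by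
  have h' := norm_pos_iff.2 h
  rw [rescale_of_le h' le_rfl, norm_smul, norm_inv, norm_norm, inv_mul_cancel₀ h'.ne']

theorem continuousAt_rescale {p : Disk n × ℝ} (h : p.2 ≠ 0) :
    ContinuousAt (fun p : Disk n × ℝ => rescale p.2 p.1) p := by
  rw [Topology.IsInducing.subtypeVal.continuousAt_iff]
  change ContinuousAt (fun p : Disk n × ℝ => (max 1 ‖p.2⁻¹ • p.1.1‖)⁻¹ • p.2⁻¹ • p.1.1) p
  have h1 : ContinuousAt (fun p : Disk n × ℝ => p.2⁻¹ • p.1.1) p :=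
    (continuousAt_snd.inv₀ h).smul (continuous_subtype_val.comp continuous_fst).continuousAt
  exact ((continuousAt_const.max h1.norm).inv₀
    (lt_max_of_lt_left one_pos : (0 : ℝ) < max 1 _).ne').smul h1

end Disk

namespace GCWStructure

variable {G : Type u} [Group G] {X : Type u} [TopologicalSpace X] [MulAction G X]

theorem smul_mem_boundary (S : GCWStructure G X) {n : ℕ} {i : S.cell n} (g : G) {d : Disk n}
    (h : d.1 ≠ 0) : g • S.map n i (d.rescale ‖d.1‖) ∈ S.skel n :=
  S.smul_mem_skel _ _ _ (S.map_boundary n i _ (Disk.norm_rescale_norm h))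

theorem smul_interior_notMem (S : GCWStructure G X) {n : ℕ} {i : S.cell n} (g : G) {d : Disk n}
    (h : ‖d.1‖ < 1) : g • S.map n i d ∉ S.skel n :=
  fun h' => S.map_interior_notMem n i d h (S.smul_mem_skel_iff.1 h')

theorem smul_map_eq_smul_map (S : GCWStructure G X) {n : ℕ} {i j : S.cell n} {g k : G}
    {d e : Disk n} (hd : ‖d.1‖ < 1) (he : ‖e.1‖ < 1) (h : g • S.map n i d = k • S.map n j e) :
    d = e ∧ (fun d => g • S.map n i d) = fun d => k • S.map n j d := by
  obtain ⟨rfl, h2, h3⟩ := S.map_interior_inj n i j (k⁻¹ * g) d e hd he (by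
    rw [mul_smul, h, inv_smul_smul])
  refine ⟨h2, funext fun x => ?_⟩
  have := S.smul_map n i _ h3 x
  rw [mul_smul, inv_smul_eq_iff] at this
  exact this

open Classical in
/-- Functions on a `G`-CW-complex can be defined recursively on the skeleta: the value at an
interior point of a cell may depend on the cell, on the point and on the value at the radial
projection of the point to the boundary. -/
theorem exists_radial (S : GCWStructure G X) {Z : Type*} (z₀ : Z)
    (R : ∀ n, (Disk n → X) → Disk n → Z → Z) :
    ∃ f : X → Z, ∀ n (i : S.cell n) (g : G) (d : Disk n), ‖d.1‖ < 1 →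
        f (g • S.map n i d) = R n (fun d => g • S.map n i d) d
          (if d.1 = 0 then z₀ else f (g • S.map n i (d.rescale ‖d.1‖))) := by
  -- The translated characteristic map and the interior coordinate depend on the point alone: two
  -- descriptions of the same cell differ by an element of its isotropy group, which fixes the cell
  -- pointwise. This makes the recursion well defined.
  have hc : ∀ n x, x ∈ S.skel (n + 1) → x ∉ S.skel n → ∃ p : (Disk n → X) × Disk n,
      ∀ (i : S.cell n) (g : G) (d : Disk n), ‖d.1‖ < 1 → g • S.map n i d = x →
        p = (fun d => g • S.map n i d, d) := by
    intro n x hx hx'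
    obtain ⟨i, g, d, hd, rfl⟩ := S.exists_cell n x hx hx'
    refine ⟨(fun d => g • S.map n i d, d), fun j k e he h => ?_⟩
    obtain ⟨h1, h2⟩ := S.smul_map_eq_smul_map hd he h.symm
    rw [h1, h2]
  choose c hc using hc
  -- Passing from `F n` to `F (n + 1)` changes values only on the open `n`-cells, so the value at a
  -- point may be read off at any stage whose skeleton contains it.
  let F : ℕ → X → Z := fun n => n.rec (fun _ => z₀) fun n f x =>
    if h : x ∈ S.skel (n + 1) ∧ x ∉ S.skel n then
      R n (c n x h.1 h.2).1 (c n x h.1 h.2).2 (if (c n x h.1 h.2).2.1 = 0 then z₀ else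
        f ((c n x h.1 h.2).1 ((c n x h.1 h.2).2.rescale ‖(c n x h.1 h.2).2.1‖)))
    else f x
  have hF : ∀ n x, F (n + 1) x = if h : x ∈ S.skel (n + 1) ∧ x ∉ S.skel n then
      R n (c n x h.1 h.2).1 (c n x h.1 h.2).2 (if (c n x h.1 h.2).2.1 = 0 then z₀ else
        F n ((c n x h.1 h.2).1 ((c n x h.1 h.2).2.rescale ‖(c n x h.1 h.2).2.1‖)))
      else F n x := fun _ _ => rfl
  have hF' : ∀ n m x, x ∈ S.skel n → F (n + m) x = F n x := by
    intro n m x hx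
    induction m with
    | zero => rfl
    | succ m ih =>
      rw [← add_assoc, hF, dif_neg, ih]
      exact fun h => h.2 (S.skel_mono (Nat.le_add_right n m) hx)
  have hf : ∀ n x, x ∈ S.skel n → F (Nat.find (S.exists_mem_skel x)) x = F n x := by
    intro n x hx
    obtain ⟨m, hm⟩ := Nat.exists_eq_add_of_le (Nat.find_min' (S.exists_mem_skel x) hx)
    rw [hm, hF' _ _ _ (Nat.find_spec (S.exists_mem_skel x))]
  refine ⟨fun x => F (Nat.find (S.exists_mem_skel x)) x, fun n i g d hd => ?_⟩
  have h1 : g • S.map n i d ∈ S.skel (n + 1) := S.smul_mem_skel _ _ _ (S.map_mem n i d)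
  have h2 : g • S.map n i d ∉ S.skel n := S.smul_interior_notMem g hd
  change F (Nat.find (S.exists_mem_skel (g • S.map n i d))) (g • S.map n i d) = _
  rw [hf _ _ h1, hF, dif_pos ⟨h1, h2⟩, hc n _ h1 h2 i g d hd rfl]
  dsimp only
  split_ifs with h0
  · rfl
  · rw [hf n _ (S.smul_mem_boundary g h0)]

/-- Two functions satisfying radial recursion formulas agree if the formulas do. -/
theorem radial_induction (S : GCWStructure G X) {p : X → Prop}
    (h : ∀ n (i : S.cell n) (g : G) (d : Disk n), ‖d.1‖ < 1 →
      (d.1 ≠ 0 → p (g • S.map n i (d.rescale ‖d.1‖))) → p (g • S.map n i d)) (x : X) : p x := by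
  obtain ⟨n, hn⟩ := S.exists_mem_skel x
  induction n generalizing x with
  | zero => rw [S.skel_zero] at hn; exact hn.elim
  | succ n ih =>
    by_cases hx : x ∈ S.skel n
    · exact ih x hx
    · obtain ⟨i, g, d, hd, rfl⟩ := S.exists_cell n x hn hx
      exact h n i g d hd fun h0 => ih _ (S.smul_mem_boundary g h0)

/-- The radial distance functions: there are continuous invariant functions `u k` with
`u k = 1` on `skel k`, which are homogeneous along rays in the cells outside of `skel k`. -/
theorem exists_dist [ContinuousConstSMul G X] (S : GCWStructure G X) (k : ℕ) :
    ∃ u : X → ℝ, Continuous u ∧ (∀ (g : G) x, u (g • x) = u x) ∧ (∀ x, 0 ≤ u x ∧ u x ≤ 1) ∧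
      (∀ x ∈ S.skel k, u x = 1) ∧
      ∀ n (i : S.cell n) (g : G) (d : Disk n), k ≤ n →
        u (g • S.map n i d) = ‖d.1‖ * u (g • S.map n i (d.rescale ‖d.1‖)) := by
  -- Cells of dimension less than `k` make up `skel k`, where the value is 1. On all other cells `u`
  -- is extended linearly along rays, with value 0 at the centre.
  obtain ⟨u, hu⟩ := S.exists_radial (0 : ℝ) fun n _ d z => if n < k then 1 else ‖d.1‖ * z
  have h1 : ∀ x ∈ S.skel k, u x = 1 := by
    intro x hx
    obtain ⟨n, i, g, d, hd, rfl⟩ := S.exists_open_cell x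
    rw [hu n i g d hd, if_pos (S.lt_of_interior_mem_skel hd (S.smul_mem_skel_iff.1 hx))]
  have h2 : ∀ n (i : S.cell n) (g : G) (d : Disk n), k ≤ n →
        u (g • S.map n i d) = ‖d.1‖ * u (g • S.map n i (d.rescale ‖d.1‖)) := by
    intro n i g d hn
    rcases d.norm_le_one.lt_or_eq with hd | hd
    · rw [hu n i g d hd, if_neg (not_lt.2 hn)]
      split_ifs with h0
      · simp [h0]
      · rfl
    · rw [hd, d.rescale_one, one_mul]
  have h3 : ∀ x, 0 ≤ u x ∧ u x ≤ 1 := by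
    refine S.radial_induction fun n i g d hd ih => ?_
    rw [hu n i g d hd]
    split_ifs with h4 h0
    · simp
    · simp
    · exact ⟨mul_nonneg (norm_nonneg _) (ih h0).1,
        mul_le_one₀ d.norm_le_one (ih h0).1 (ih h0).2⟩
  refine ⟨u, ?_, ?_, h3, h1, h2⟩
  · have key : ∀ n, ContinuousOn (fun p : X × ℝ => u p.1) (S.skel n ×ˢ univ) := by
      intro n
      induction n with
      | zero => simp [S.skel_zero]
      | succ n ih =>
        refine S.continuousOn_skel_succ_prod isClosed_univ _ n ih fun i g => ?_
        refine Continuous.continuousOn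
          ((continuous_iff_continuousAt.2 fun d => ?_ : Continuous fun d : Disk n =>
            u (g • S.map n i d)).comp continuous_fst)
        rcases lt_or_ge n k with hn | hn
        · have : (fun d : Disk n => u (g • S.map n i d)) = fun _ => 1 :=
            funext fun d => h1 _ (S.skel_mono hn (S.smul_mem_skel _ _ _ (S.map_mem n i d)))
          rw [this]
          exact continuousAt_const
        rw [funext fun d => h2 n i g d hn]
        -- At the centre the radial projection has no limit, but `u` is bounded by 1, so the factor
        -- `‖e‖` forces the limit 0. Elsewhere the projection is continuous with values in `skel n`,
        -- where `u` is continuous by induction.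
        by_cases h0 : d.1 = 0
        · rw [ContinuousAt, h0, norm_zero, zero_mul]
          refine squeeze_zero (f := fun e : Disk n =>
            ‖e.1‖ * u (g • S.map n i (e.rescale ‖e.1‖)))
            (fun e => mul_nonneg (norm_nonneg _) (h3 _).1)
            (fun e => mul_le_of_le_one_right (norm_nonneg e.1) (h3 _).2) ?_
          have : Continuous fun e : Disk n => ‖e.1‖ := by fun_prop
          have h9 := this.tendsto d
          rwa [h0, norm_zero] at h9
        · have h4 : ContinuousAt (fun e : Disk n => g • S.map n i (e.rescale ‖e.1‖)) d :=
            (((S.map n i).continuous.const_smul g).continuousAt).comp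
              (f := fun e : Disk n => e.rescale ‖e.1‖)
              ((Disk.continuousAt_rescale (p := (d, ‖d.1‖)) (norm_ne_zero_iff.2 h0)).comp
                (f := fun e : Disk n => (e, ‖e.1‖)) (by fun_prop))
          have h5 : ∀ᶠ e : Disk n in nhds d, g • S.map n i (e.rescale ‖e.1‖) ∈ S.skel n := by
            have : ∀ᶠ e : Disk n in nhds d, e.1 ≠ 0 :=
              (isOpen_ne.preimage continuous_subtype_val).mem_nhds h0
            filter_upwards [this] with e he using S.smul_mem_boundary g he
          have h6 : ContinuousOn u (S.skel n) :=
            ih.comp (f := fun x => (x, (0 : ℝ))) (by fun_prop) fun x hx => ⟨hx, trivial⟩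
          have h7 := (h6 _ (S.smul_mem_boundary g h0 (i := i))).tendsto.comp
            (tendsto_nhdsWithin_iff.2 ⟨h4, h5⟩)
          have h8 : Continuous fun e : Disk n => ‖e.1‖ := by fun_prop
          exact h8.continuousAt.mul h7
    have := S.continuousOn_of_skel_prod isClosed_univ _ key
    rw [univ_prod_univ, continuousOn_univ] at this
    exact this.comp (f := fun x => (x, (0 : ℝ))) (by fun_prop)
  · intro g
    refine S.radial_induction fun n i k d hd ih => ?_
    rw [smul_smul, hu n i _ d hd, hu n i _ d hd]
    split_ifs with h4 h0
    · rfl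
    · rfl
    · have := ih h0
      rw [smul_smul] at this
      rw [this]

/-- The flow `Φ x s`, `1 ≥ s ≥ 1 / 2`, moves the points of a cell along the rays to the boundary,
and then along the cells of lower dimension. -/
theorem exists_flow [ContinuousConstSMul G X] (S : GCWStructure G X) :
    ∃ Φ : X → ℝ → X, ContinuousOn (fun p : X × ℝ => Φ p.1 p.2) (univ ×ˢ Icc (1 / 2) 1) ∧
      (∀ (g : G) x, ∀ s ∈ Icc (1 / 2 : ℝ) 1, Φ (g • x) s = g • Φ x s) ∧ (∀ x, Φ x 1 = x) ∧
      ∀ n (i : S.cell n) (g : G) (d : Disk n), ∀ s ∈ Icc (1 / 2 : ℝ) 1,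
        (‖d.1‖ ≤ s → Φ (g • S.map n i d) s = g • S.map n i (d.rescale s)) ∧
        (s ≤ ‖d.1‖ → Φ (g • S.map n i d) s =
          Φ (g • S.map n i (d.rescale ‖d.1‖)) (s / ‖d.1‖)) := by
  rcases isEmpty_or_nonempty X with hX | ⟨⟨x₀⟩⟩
  · refine ⟨fun x => isEmptyElim x, ?_, fun g x => isEmptyElim x, fun x => isEmptyElim x,
      fun n i g d => isEmptyElim (S.map n i d)⟩
    rw [continuousOn_iff_continuous_domRestrict]
    exact continuous_of_const fun p => isEmptyElim p.1.1
  classical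
  -- The parameter is multiplicative: a point of radius `r` is moved to radius `r / s` while `r ≤
  -- s`, reaches the boundary at `s = r`, and spends the remaining factor `s / r` on the flow of its
  -- boundary point. The default `x₀` plays no role for admissible `s`, as the radius 0 is less than
  -- `1 / 2`.
  obtain ⟨Φ, hΦ⟩ := S.exists_radial (fun _ : ℝ => x₀) fun n c d z s =>
    if ‖d.1‖ ≤ s then c (d.rescale s) else z (s / ‖d.1‖)
  have hpos : ∀ s ∈ Icc (1 / 2 : ℝ) 1, 0 < s := fun s hs => lt_of_lt_of_le (by norm_num) hs.1
  have hdiv : ∀ s ∈ Icc (1 / 2 : ℝ) 1, ∀ r, r ≤ 1 → s ≤ r → s / r ∈ Icc (1 / 2 : ℝ) 1 := by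
    intro s hs r hr h
    have hr' := (hpos s hs).trans_le h
    exact ⟨(le_div_iff₀ hr').2 (by nlinarith [hs.1]), (div_le_one hr').2 h⟩
  have h1 : ∀ x, Φ x 1 = x := by
    intro x
    obtain ⟨n, i, g, d, hd, rfl⟩ := S.exists_open_cell x
    rw [hΦ n i g d hd]
    dsimp only
    rw [if_pos hd.le, d.rescale_one]
  have h2 : ∀ n (i : S.cell n) (g : G) (d : Disk n), ∀ s ∈ Icc (1 / 2 : ℝ) 1,
      ‖d.1‖ ≤ s → Φ (g • S.map n i d) s = g • S.map n i (d.rescale s) := by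
    intro n i g d s hs h
    rcases d.norm_le_one.lt_or_eq with hd | hd
    · rw [hΦ n i g d hd]
      exact if_pos h
    · obtain rfl : s = 1 := le_antisymm hs.2 (hd ▸ h)
      rw [h1, d.rescale_one]
  have h3 : ∀ n (i : S.cell n) (g : G) (d : Disk n), ∀ s ∈ Icc (1 / 2 : ℝ) 1,
      s ≤ ‖d.1‖ → Φ (g • S.map n i d) s =
        Φ (g • S.map n i (d.rescale ‖d.1‖)) (s / ‖d.1‖) := by
    intro n i g d s hs h
    have h0 : d.1 ≠ 0 := norm_pos_iff.1 ((hpos s hs).trans_le h)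
    rcases d.norm_le_one.lt_or_eq with hd | hd
    · rcases h.lt_or_eq with h | h
      · rw [hΦ n i g d hd]
        dsimp only
        rw [if_neg (not_le.2 h), if_neg h0]
      · rw [h2 n i g d s hs h.ge, ← h, div_self (hpos s hs).ne', h1]
    · rw [hd, d.rescale_one, div_one]
  refine ⟨Φ, ?_, ?_, h1, fun n i g d s hs => ⟨h2 n i g d s hs, h3 n i g d s hs⟩⟩
  · refine S.continuousOn_of_skel_prod isClosed_Icc _ fun n => ?_
    induction n with
    | zero => simp [S.skel_zero]
    | succ n ih =>
      refine S.continuousOn_skel_succ_prod isClosed_Icc _ n ih fun i g => ?_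
      -- The flow on a cell is glued from two closed regions. On `B` the radius is at least `1 / 2`,
      -- which keeps it away from the centre, where the radial projection is discontinuous.
      let A : Set (Disk n × ℝ) := {p | ‖p.1.1‖ ≤ p.2 ∧ p.2 ∈ Icc (1 / 2 : ℝ) 1}
      let B : Set (Disk n × ℝ) := {p | p.2 ≤ ‖p.1.1‖ ∧ p.2 ∈ Icc (1 / 2 : ℝ) 1}
      have hA : IsClosed A := (isClosed_le (by fun_prop) (by fun_prop) :
          IsClosed {p : Disk n × ℝ | ‖p.1.1‖ ≤ p.2}).inter
        (isClosed_Icc.preimage continuous_snd)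
      have hB : IsClosed B := (isClosed_le (by fun_prop) (by fun_prop) :
          IsClosed {p : Disk n × ℝ | p.2 ≤ ‖p.1.1‖}).inter
        (isClosed_Icc.preimage continuous_snd)
      have hAB : (univ : Set (Disk n)) ×ˢ Icc (1 / 2 : ℝ) 1 = A ∪ B := by
        ext p
        constructor
        · rintro ⟨-, h⟩
          exact (le_total ‖p.1.1‖ p.2).imp (fun h' => ⟨h', h⟩) fun h' => ⟨h', h⟩
        · rintro (h | h)
          exacts [⟨trivial, h.2⟩, ⟨trivial, h.2⟩]
      rw [hAB]
      refine ContinuousOn.union_of_isClosed ?_ ?_ hA hB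
      · have h4 : ContinuousOn (fun p : Disk n × ℝ => g • S.map n i (p.1.rescale p.2)) A :=
          fun p hp => ((((S.map n i).continuous.const_smul g).continuousAt).comp
            (Disk.continuousAt_rescale (hpos _ hp.2).ne')).continuousWithinAt
        exact h4.congr fun p hp => h2 n i g p.1 p.2 hp.2 hp.1
      · have h0 : ∀ p ∈ B, p.1.1 ≠ 0 := fun p hp =>
          norm_pos_iff.1 ((hpos _ hp.2).trans_le hp.1)
        have h4 : ContinuousOn (fun p : Disk n × ℝ =>
            (g • S.map n i (p.1.rescale ‖p.1.1‖), p.2 / ‖p.1.1‖)) B := by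
          intro p hp
          have h5 : ContinuousAt (fun p : Disk n × ℝ => p.1.rescale ‖p.1.1‖) p :=
            (Disk.continuousAt_rescale (p := (p.1, ‖p.1.1‖)) (norm_ne_zero_iff.2 (h0 p hp))).comp
              (f := fun p : Disk n × ℝ => (p.1, ‖p.1.1‖)) (by fun_prop)
          have h6 : Continuous fun p : Disk n × ℝ => ‖p.1.1‖ := by fun_prop
          exact (((((S.map n i).continuous.const_smul g).continuousAt).comp
            (f := fun p : Disk n × ℝ => p.1.rescale ‖p.1.1‖) h5).prodMk
            (continuousAt_snd.div h6.continuousAt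
              (norm_ne_zero_iff.2 (h0 p hp)))).continuousWithinAt
        exact (ih.comp h4 fun p hp => ⟨S.smul_mem_boundary g (h0 p hp),
          hdiv _ hp.2 _ p.1.norm_le_one hp.1⟩).congr fun p hp => h3 n i g p.1 p.2 hp.2 hp.1
  · intro g
    refine S.radial_induction fun n i k d hd ih s hs => ?_
    rw [smul_smul]
    rcases le_total ‖d.1‖ s with h | h
    · rw [h2 n i _ d s hs h, h2 n i _ d s hs h, smul_smul]
    · have h0 : d.1 ≠ 0 := norm_pos_iff.1 ((hpos s hs).trans_le h)
      have := ih h0 _ (hdiv s hs _ d.norm_le_one h)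
      rw [smul_smul] at this
      rw [h3 n i _ d s hs h, h3 n i _ d s hs h, this]

/-- A `G`-CW-complex is mapped to itself by a map homotopic to the identity, which maps the set
of all points with `τ < k + 1` into `skel k`. -/
theorem exists_flow_height [ContinuousConstSMul G X] (S : GCWStructure G X) :
    ∃ (Φ : X → ℝ → X) (τ : X → ℝ),
      ContinuousOn (fun p : X × ℝ => Φ p.1 p.2) (univ ×ˢ Icc (1 / 2) 1) ∧
      (∀ (g : G) x, ∀ s ∈ Icc (1 / 2 : ℝ) 1, Φ (g • x) s = g • Φ x s) ∧ (∀ x, Φ x 1 = x) ∧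
      Continuous τ ∧ (∀ (g : G) x, τ (g • x) = τ x) ∧ (∀ x, 0 ≤ τ x) ∧
      ∀ (k : ℕ) x, τ x < k + 1 → Φ x (1 / 2) ∈ S.skel k := by
  obtain ⟨Φ, h1, h2, h3, h4⟩ := S.exists_flow
  choose u hu huG hu1 huk hur using S.exists_dist
  have hpos : ∀ s ∈ Icc (1 / 2 : ℝ) 1, 0 < s := fun s hs => lt_of_lt_of_le (by norm_num) hs.1
  -- `u k` and the flow obey the same recursion: on a cell of dimension at least `k`, both sides of
  -- `s ≤ u k x` are divided by the radius when passing to the boundary point.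
  have hΦu : ∀ k x, ∀ s ∈ Icc (1 / 2 : ℝ) 1, s ≤ u k x → Φ x s ∈ S.skel k := by
    intro k
    refine S.radial_induction fun n i g d hd ih s hs h => ?_
    rcases lt_or_ge n k with hn | hn
    · rcases le_total ‖d.1‖ s with h' | h'
      · rw [(h4 n i g d s hs).1 h']
        exact S.skel_mono hn (S.smul_mem_skel _ _ _ (S.map_mem n i _))
      · have h0 : 0 < ‖d.1‖ := (hpos s hs).trans_le h'
        rw [(h4 n i g d s hs).2 h']
        refine ih (norm_pos_iff.1 h0) _ ⟨(le_div_iff₀ h0).2 ?_, (div_le_one h0).2 h'⟩ ?_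
        · nlinarith [hs.1, d.norm_le_one]
        · rw [huk k _ (S.skel_mono hn (S.smul_mem_skel _ _ _ (S.map_mem n i _)))]
          exact (div_le_one h0).2 h'
    · rw [hur k n i g d hn] at h
      have h' : s ≤ ‖d.1‖ := h.trans (mul_le_of_le_one_right (norm_nonneg d.1) (hu1 k _).2)
      have h0 : 0 < ‖d.1‖ := (hpos s hs).trans_le h'
      rw [(h4 n i g d s hs).2 h']
      refine ih (norm_pos_iff.1 h0) _ ⟨(le_div_iff₀ h0).2 ?_, (div_le_one h0).2 h'⟩ ?_
      · nlinarith [hs.1, d.norm_le_one]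
      · rw [div_le_iff₀ h0, mul_comm]
        exact h
  have humono : ∀ k x, u k x ≤ u (k + 1) x := by
    intro k
    refine S.radial_induction fun n i g d hd ih => ?_
    rcases lt_or_ge n (k + 1) with hn | hn
    · rw [huk (k + 1) _ (S.skel_mono hn (S.smul_mem_skel _ _ _ (S.map_mem n i _)))]
      exact (hu1 k _).2
    · rw [hur k n i g d (by omega), hur (k + 1) n i g d hn]
      by_cases h0 : d.1 = 0
      · simp [h0]
      · exact mul_le_mul_of_nonneg_left (ih h0) (norm_nonneg d.1)
  have humono' : ∀ x, Monotone fun k => u k x := fun x => monotone_nat_of_le_succ fun k =>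
    humono k x
  -- A continuous cutoff, equal to 1 where `u k ≤ 1 / 2` and to 0 where `u k ≥ 3 / 4`. The height is
  -- the sum of all `b k`. It is locally finite, since near a point of `skel n` all terms with `k ≥
  -- n` vanish.
  let b : ℕ → X → ℝ := fun k x => min 1 (max 0 (3 - 4 * u k x))
  have hb0 : ∀ k x, 0 ≤ b k x := fun k x => le_min zero_le_one (le_max_left _ _)
  have hfin : LocallyFinite fun k => Function.support (b k) := by
    intro x
    obtain ⟨n, hn⟩ := S.exists_mem_skel x
    refine ⟨{y | 3 / 4 < u n y}, (isOpen_lt continuous_const (hu n)).mem_nhds ?_, ?_⟩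
    · change 3 / 4 < u n x
      rw [huk n x hn]
      norm_num
    · refine (finite_Iio n).subset ?_
      rintro k ⟨y, hy, hy'⟩
      by_contra hk
      refine hy ?_
      have h5 : 3 / 4 < u k y := lt_of_lt_of_le hy' (humono' y (not_lt.1 hk))
      change min 1 (max 0 (3 - 4 * u k y)) = 0
      rw [max_eq_left (by linarith), min_eq_right zero_le_one]
  refine ⟨Φ, fun x => ∑ᶠ k, b k x, h1, h2, h3, ?_, ?_, ?_, ?_⟩
  · exact continuous_finsum (fun k => by have := hu k; fun_prop) hfin
  · intro g x
    simp only [b, huG]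
  · exact fun x => finsum_nonneg fun k => hb0 k x
  · intro k x hx
    by_contra h
    refine hx.not_ge ?_
    -- If the flow has not reached `skel k` at parameter `1 / 2`, then `u j x < 1 / 2` for all `j ≤
    -- k`. So `k + 1` summands are equal to 1 and the height is at least `k + 1`.
    have h5 : ∀ j ≤ k, b j x = 1 := by
      intro j hj
      have : u k x < 1 / 2 := by
        by_contra! h'
        exact h (hΦu k x (1 / 2) ⟨le_rfl, by norm_num⟩ h')
      have h6 := (humono' x hj).trans_lt this
      dsimp only at h6
      change min 1 (max 0 (3 - 4 * u j x)) = 1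
      rw [max_eq_right (by linarith), min_eq_left (by linarith)]
    have h6 : (Function.support fun j => b j x).Finite := hfin.point_finite x
    have h7 : ∑ j ∈ Finset.range (k + 1), b j x = k + 1 := by
      rw [Finset.sum_congr rfl fun j hj => h5 j (by simpa [Nat.lt_succ_iff] using hj)]
      simp
    dsimp only
    rw [← h7, finsum_eq_sum_of_support_subset (s := h6.toFinset ∪ Finset.range (k + 1)) _
      (by intro j hj; simp only [Finset.coe_union, Finite.coe_toFinset]; exact Or.inl hj)]
    exact Finset.sum_le_sum_of_subset_of_nonneg Finset.subset_union_right
      fun j _ _ => hb0 j x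

end GCWStructure
/-! ### Localizing classes of `G`-CW-pairs -/

open GCWPair

/-- A class of `G`-CW-pairs on which a transformation of `G`-homology theories is bijective has
the following closure properties. -/
structure IsLocalizing {G : Type u} [Group G] (𝒞 : GCWPair G → Prop) : Prop where
  retract : ∀ {P Q : GCWPair G} (f : P ⟶ Q) (g : Q ⟶ P), Homotopic (f ≫ g) (𝟙 P) → 𝒞 Q → 𝒞 P
  pair : ∀ P : GCWPair G, 𝒞 P.sub → 𝒞 P.abs → 𝒞 P
  abs : ∀ P : GCWPair G, 𝒞 P.sub → 𝒞 P → 𝒞 P.abs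
  excision : ∀ {P Q : GCWPair G} (F : P ⟶ Q), IsCellularOnSub F → IsAdjunction F → (𝒞 P ↔ 𝒞 Q)
  coprod : ∀ {ι : Type u} (X : ι → Type u) [∀ i, TopologicalSpace (X i)]
    [∀ i, MulAction G (X i)] [∀ i, ContinuousConstSMul G (X i)]
    (hX : ∀ i, IsGCWComplex G (X i)), (∀ i, 𝒞 (ofComplex (X i) (hX i))) → 𝒞 (coprod X hX)

section

variable {G : Type u} [Group G] {X : Type u} [TopologicalSpace X] [MulAction G X]

theorem GCWPair.Homotopic.refl {P Q : GCWPair G} (f : P ⟶ Q) : Homotopic f f :=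
  ⟨fun p => f.toFun p.1, f.continuous_toFun.comp continuous_fst, fun g x _ => f.map_smul g x,
    fun x hx _ => f.map_mem x hx, fun _ => rfl, fun _ => rfl⟩

/-- Serves to transport membership along isomorphisms of pairs; only one of the two composites has
to be checked. -/
theorem IsLocalizing.retract_of_eq {𝒞 : GCWPair G → Prop} (h : IsLocalizing 𝒞) {P Q : GCWPair G}
    (f : P ⟶ Q) (g : Q ⟶ P) (hfg : ∀ x, g.toFun (f.toFun x) = x) (hQ : 𝒞 Q) : 𝒞 P := by
  refine h.retract f g ?_ hQ
  have : f ≫ g = 𝟙 P := hom_ext (funext hfg)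
  rw [this]
  exact Homotopic.refl _

/-- Equivariant continuous maps between `G`-CW-complexes. -/
def GCWPair.ofMap {Y : Type u} [TopologicalSpace Y] [MulAction G Y] [ContinuousConstSMul G X]
    [ContinuousConstSMul G Y] {hX : IsGCWComplex G X} {hY : IsGCWComplex G Y} (f : X → Y)
    (hf : Continuous f) (hf' : ∀ (g : G) x, f (g • x) = g • f x) :
    ofComplex X hX ⟶ ofComplex Y hY :=
  Hom.mk (P := ofComplex X hX) (Q := ofComplex Y hY) f hf hf' fun _ h => h.elim

/-- A map of pairs is cellular on the subcomplex if its target is of dimension zero. -/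
theorem GCWPair.isCellularOnSub_of_skel_one {P Q : GCWPair G} (F : P ⟶ Q)
    (S : GCWStructure G Q.X) (hS : S.IsSubcomplex Q.A) (h : ∀ x ∈ Q.A, x ∈ S.skel 1) :
    IsCellularOnSub F := by
  obtain ⟨T, hT⟩ := P.isGCW
  refine ⟨T, S.restrict Q.A hS, hT, fun n x hx => ?_⟩
  cases n with
  | zero => rw [T.skel_zero] at hx; exact hx.elim
  | succ n => exact S.skel_mono (Nat.le_add_left 1 n) (h _ (F.map_mem _ x.2))

/-! ### Pairs of subcomplexes and the Mayer-Vietoris property. -/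

namespace GCWStructure

variable [ContinuousConstSMul G X] (S : GCWStructure G X)

/-- A subcomplex of a `G`-CW-complex. -/
def sub (A : SubMulAction G X) (hA : S.IsSubcomplex A) : GCWPair G :=
  ofComplex A ⟨S.restrict A hA⟩

/-- The pair `(B, A ∩ B)` of subcomplexes. -/
def subPair (A B : SubMulAction G X) (hA : S.IsSubcomplex A) (hB : S.IsSubcomplex B) :
    GCWPair G where
  X := B
  A := { carrier := {x | x.1 ∈ A}, smul_mem' := fun g _ hx => A.smul_mem g hx }
  isGCW := ⟨S.restrict B hB, fun n i d hd h d' => hA n i.1 d hd h d'⟩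

variable {S} {𝒞 : GCWPair G → Prop} (h𝒞 : IsLocalizing 𝒞)
include h𝒞

/-- The subcomplex of `(B, A ∩ B)` is a subtype of a subtype; it is isomorphic to the intersection
`D` formed inside `X`. -/
theorem sub_subPair {A B D : SubMulAction G X} (hA : S.IsSubcomplex A) (hB : S.IsSubcomplex B)
    (hD : S.IsSubcomplex D) (h : ∀ x, x ∈ D ↔ x ∈ A ∧ x ∈ B) (hD' : 𝒞 (S.sub D hD)) :
    𝒞 (S.subPair A B hA hB).sub := by
  refine h𝒞.retract_of_eq (Q := S.sub D hD)
    (ofMap (X := (S.subPair A B hA hB).A) (Y := D) (fun x => ⟨x.1.1, (h _).2 ⟨x.2, x.1.2⟩⟩)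
      (by fun_prop) fun _ _ => rfl)
    (ofMap (Y := (S.subPair A B hA hB).A) (X := D)
      (fun x => (⟨⟨x.1, ((h _).1 x.2).2⟩, ((h _).1 x.2).1⟩ : (S.subPair A B hA hB).A))
      ?_ fun _ _ => rfl) (fun _ => rfl) hD'
  exact Continuous.subtype_mk (Continuous.subtype_mk continuous_subtype_val _) _

theorem sub_of_subPair {A B : SubMulAction G X} (hA : S.IsSubcomplex A) (hB : S.IsSubcomplex B)
    (hAB : A ≤ B) (h : 𝒞 (S.subPair A B hA hB)) (h' : 𝒞 (S.sub A hA)) : 𝒞 (S.sub B hB) :=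
  h𝒞.abs (S.subPair A B hA hB) (sub_subPair h𝒞 hA hB hA
    (fun _ => ⟨fun hx => ⟨hx, hAB hx⟩, fun hx => hx.1⟩) h') h

/-- The Mayer-Vietoris property. -/
theorem sub_union {A B D W : SubMulAction G X} (hA : S.IsSubcomplex A) (hB : S.IsSubcomplex B)
    (hD : S.IsSubcomplex D) (hW : S.IsSubcomplex W) (h : ∀ x, x ∈ D ↔ x ∈ A ∧ x ∈ B)
    (h' : ∀ x, x ∈ W ↔ x ∈ A ∨ x ∈ B) (hA' : 𝒞 (S.sub A hA)) (hB' : 𝒞 (S.sub B hB))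
    (hD' : 𝒞 (S.sub D hD)) : 𝒞 (S.sub W hW) := by
  have hAW : ∀ x ∈ A, x ∈ W := fun x hx => (h' x).2 (Or.inl hx)
  have hBW : B ≤ W := fun x hx => (h' x).2 (Or.inr hx)
  -- It remains to treat the pair `(W, B)`. The inclusion of `(A, A ∩ B)` into it satisfies
  -- excision, and `(A, A ∩ B)` belongs to the class because `A` and `A ∩ B` do.
  refine sub_of_subPair h𝒞 hB hW hBW ?_ hB'
  have hBA : 𝒞 (S.subPair B A hB hA) :=
    h𝒞.pair _ (sub_subPair h𝒞 hB hA hD (fun x => (h x).trans and_comm) hD') hA'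
  let F : S.subPair B A hB hA ⟶ S.subPair B W hB hW :=
    Hom.mk (P := S.subPair B A hB hA) (Q := S.subPair B W hB hW)
      (fun x : A => (⟨x.1, hAW _ x.2⟩ : W)) (Continuous.subtype_mk continuous_subtype_val _)
      (fun _ _ => rfl) (fun _ hx => hx)
  refine (h𝒞.excision F ?_ ?_).1 hBA
  · refine ⟨S.restrict A hA, (S.restrict W hW).restrict _ fun n i d hd h d' => hB n i.1 d hd h d',
      fun n i d hd h d' => hB n i.1 d hd h d', fun n x hx => hx⟩
  · refine ⟨⟨fun x hx => hx, fun x _ y _ hxy => ?_, fun x hx => ?_⟩, fun C hC hC' => ?_⟩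
    · exact Subtype.ext (congrArg (fun z : W => z.1) hxy)
    · rcases (h' x.1).1 x.2 with hx' | hx'
      · exact ⟨⟨x.1, hx'⟩, hx, rfl⟩
      · exact (hx hx').elim
    · have c1 := (S.isClosed_subcomplex A hA).isClosedEmbedding_subtypeVal.isClosedMap _ hC
      have c2 := (((S.restrict W hW).isClosed_subcomplex (S.subPair B W hB hW).A
        fun n i d hd h d' => hB n i.1 d hd h d').isClosedEmbedding_subtypeVal).isClosedMap _ hC'
      have c3 : IsClosed (Subtype.val ⁻¹' (Subtype.val '' (F.toFun ⁻¹' C)) ∪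
          Subtype.val '' (Subtype.val ⁻¹' C : Set (S.subPair B W hB hW).A) : Set W) :=
        (c1.preimage continuous_subtype_val).union c2
      refine (congrArg IsClosed (Set.ext fun (x : W) => ?_)).mpr c3
      constructor
      · intro hx
        rcases (h' x.1).1 x.2 with hx' | hx'
        · exact Or.inl ⟨⟨x.1, hx'⟩, hx, rfl⟩
        · exact Or.inr ⟨⟨x, hx'⟩, hx, rfl⟩
      · rintro (⟨y, hy, hyx⟩ | ⟨y, hy, rfl⟩)
        · have : x = F.toFun y := Subtype.ext hyx.symm
          rw [this]
          exact hy
        · exact hy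

end GCWStructure

end

/-! ### Collapsing a subcomplex -/

/-- The space obtained from `X` by collapsing `A` to a point (and adding a point if `A = ∅`). -/
def Collapse {G : Type u} [Group G] {X : Type u} [MulAction G X] (A : SubMulAction G X) : Type u :=
  Option {x : X // x ∉ A}

namespace Collapse

variable {G : Type u} [Group G] {X : Type u} [MulAction G X] {A : SubMulAction G X}

/-- The base point. -/
def base : Collapse A := none

open Classical in
/-- The projection. -/
noncomputable def proj (x : X) : Collapse A := if h : x ∈ A then none else some ⟨x, h⟩

theorem proj_of_mem {x : X} (h : x ∈ A) : (proj x : Collapse A) = base := dif_pos h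

theorem proj_of_notMem {x : X} (h : x ∉ A) : (proj x : Collapse A) = some ⟨x, h⟩ := dif_neg h

theorem proj_eq_base {x : X} : (proj x : Collapse A) = base ↔ x ∈ A := by
  refine ⟨fun h => ?_, proj_of_mem⟩
  by_contra hx
  rw [proj_of_notMem hx] at h
  exact Option.some_ne_none _ h

theorem eq_of_proj_eq {x y : X} (hx : x ∉ A) (h : (proj x : Collapse A) = proj y) : x = y := by
  have hy : y ∉ A := fun hy => hx (proj_eq_base.1 (h.trans (proj_of_mem hy)))
  rw [proj_of_notMem hx, proj_of_notMem hy] at h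
  exact congrArg Subtype.val (Option.some_injective _ h)

theorem eq_base_or (q : Collapse A) : q = base ∨ ∃ x ∉ A, proj x = q := by
  cases q with
  | none => exact Or.inl rfl
  | some x => exact Or.inr ⟨x.1, x.2, proj_of_notMem x.2⟩

instance : MulAction G (Collapse A) where
  smul g q := Option.map (fun x : {x : X // x ∉ A} =>
    ⟨g • x.1, fun h => x.2 ((A.smul_mem_iff' g).1 h)⟩) q
  one_smul q := by
    cases q with
    | none => rfl
    | some x => exact congrArg some (Subtype.ext (one_smul G x.1))
  mul_smul a b q := by
    cases q with
    | none => rfl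
    | some x => exact congrArg some (Subtype.ext (mul_smul a b x.1))

@[simp]
theorem smul_base (g : G) : g • (base : Collapse A) = base := rfl

@[simp]
theorem smul_proj (g : G) (x : X) : g • (proj x : Collapse A) = proj (g • x) := by
  by_cases h : x ∈ A
  · rw [proj_of_mem h, proj_of_mem (A.smul_mem g h), smul_base]
  · rw [proj_of_notMem h, proj_of_notMem fun h' => h ((A.smul_mem_iff' g).1 h')]
    rfl

variable [TopologicalSpace X]

noncomputable instance : TopologicalSpace (Collapse A) := TopologicalSpace.coinduced proj inferInstance

theorem continuous_proj : Continuous (proj : X → Collapse A) := continuous_coinduced_rng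

theorem isClosed_iff {C : Set (Collapse A)} : IsClosed C ↔ IsClosed (proj ⁻¹' C) :=
  isClosed_coinduced

instance [ContinuousConstSMul G X] : ContinuousConstSMul G (Collapse A) where
  continuous_const_smul g := by
    refine continuous_coinduced_dom.2 ?_
    have : (fun q : Collapse A => g • q) ∘ proj = proj ∘ fun x : X => g • x :=
      funext fun x => smul_proj g x
    rw [this]
    exact continuous_proj.comp (continuous_const_smul g)

/-- The `G`-CW-structure on the quotient by a subcomplex. -/
noncomputable def structure_ [ContinuousConstSMul G X] (S : GCWStructure G X)
    (hA : S.IsSubcomplex A) : GCWStructure G (Collapse A) :=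
  have hint : ∀ n (i : S.cell n), (¬ ∀ d, S.map n i d ∈ A) → ∀ (g : G) (d : Disk n), ‖d.1‖ < 1 →
      g • S.map n i d ∉ A := fun n i hi g d hd h =>
    hi (hA n i d hd ((A.smul_mem_iff' g).1 h))
  -- The base point is a new 0-cell, so it belongs to every skeleton with positive index, whatever
  -- the dimensions of the cells of `A`.
  { skel := fun n => {q | 0 < n ∧ (q = base ∨ ∃ x ∈ S.skel n, proj x = q)}
    skel_zero := by
      ext q
      exact iff_of_false (fun h => h.1.false) id
    skel_subset := by
      rintro n q ⟨-, h⟩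
      exact ⟨Nat.succ_pos n, h.imp_right fun ⟨x, hx, hx'⟩ => ⟨x, S.skel_subset n hx, hx'⟩⟩
    iUnion_skel := by
      refine eq_univ_of_forall fun q => mem_iUnion.2 ?_
      rcases eq_base_or q with rfl | ⟨x, hx, rfl⟩
      · exact ⟨1, one_pos, Or.inl rfl⟩
      · obtain ⟨n, hn⟩ := S.exists_mem_skel x
        exact ⟨n + 1, Nat.succ_pos n, Or.inr ⟨x, S.skel_subset n hn, rfl⟩⟩
    smul_mem_skel := by
      rintro n g _ ⟨hn, rfl | ⟨x, hx, rfl⟩⟩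
      · exact ⟨hn, Or.inl rfl⟩
      · exact ⟨hn, Or.inr ⟨g • x, S.smul_mem_skel n g x hx, (smul_proj g x).symm⟩⟩
    isClosed_of_skel := by
      intro C hC
      rw [isClosed_iff, S.isClosed_iff_cells]
      intro n i g
      convert (hC (n + 1)).preimage (f := fun d => proj (g • S.map n i d))
        (continuous_proj.comp ((S.map n i).continuous.const_smul g)) using 1
      ext d
      exact (and_iff_left ⟨Nat.succ_pos n, Or.inr
        ⟨_, S.smul_mem_skel _ g _ (S.map_mem n i d), rfl⟩⟩).symm
    cell := fun n => {i : S.cell n // ¬ ∀ d, S.map n i d ∈ A} ⊕ PLift (n = 0)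
    stab := fun n i => i.elim (fun i => S.stab n i.1) fun _ => ⊤
    map := fun n i => i.elim (fun i => ⟨fun d => proj (S.map n i.1 d),
      continuous_proj.comp (S.map n i.1).continuous⟩) fun _ => ⟨fun _ => base, continuous_const⟩
    smul_map := by
      rintro n (i | i) g hg d
      · exact (smul_proj _ _).trans (congrArg proj (S.smul_map n i.1 g hg d))
      · rfl
    map_mem := by
      rintro n (i | i) d
      · exact ⟨Nat.succ_pos n, Or.inr ⟨_, S.map_mem n i.1 d, rfl⟩⟩
      · exact ⟨Nat.succ_pos n, Or.inl rfl⟩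
    map_boundary := by
      rintro n (i | ⟨⟨rfl⟩⟩) d hd
      · refine ⟨?_, Or.inr ⟨_, S.map_boundary n i.1 d hd, rfl⟩⟩
        rw [Nat.pos_iff_ne_zero]
        rintro rfl
        have : d.1 = 0 := Subsingleton.elim _ _
        simp [this] at hd
      · have : d.1 = 0 := Subsingleton.elim _ _
        simp [this] at hd
    map_interior_notMem := by
      rintro n (i | ⟨⟨rfl⟩⟩) d hd ⟨hn, h⟩
      · have hi := hint n i.1 i.2 1 d hd
        rw [one_smul] at hi
        rcases h with h | ⟨x, hx, h⟩
        · exact hi (proj_eq_base.1 h)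
        · rw [← eq_of_proj_eq hi h.symm] at hx
          exact S.map_interior_notMem n i.1 d hd hx
      · exact hn.false
    map_interior_inj := by
      rintro n (i | i) (j | j) g d d' hd hd' h
      · obtain ⟨h1, h2, h3⟩ := S.map_interior_inj n i.1 j.1 g d d' hd hd'
          (eq_of_proj_eq (hint n i.1 i.2 g d hd) ((smul_proj _ _).symm.trans h))
        exact ⟨congrArg Sum.inl (Subtype.ext h1), h2, h3⟩
      · exact (hint n i.1 i.2 g d hd (proj_eq_base.1 ((smul_proj _ _).symm.trans h))).elim
      · have := hint n j.1 j.2 1 d' hd'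
        rw [one_smul] at this
        exact (this (proj_eq_base.1 h.symm)).elim
      · obtain ⟨rfl⟩ := i
        exact ⟨rfl, Subtype.ext (Subsingleton.elim _ _), trivial⟩
    exists_cell := by
      rintro n q ⟨-, h⟩ h'
      by_cases hq : q = base
      · subst hq
        obtain rfl : n = 0 := by
          by_contra hn
          exact h' ⟨Nat.pos_of_ne_zero hn, Or.inl rfl⟩
        exact ⟨Sum.inr ⟨rfl⟩, 1, ⟨0, by simp⟩, by simp, rfl⟩
      · obtain ⟨x, hx, rfl⟩ := h.resolve_left hq
        have hxA : x ∉ A := fun hx => hq (proj_of_mem hx)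
        obtain ⟨i, g, d, hd, rfl⟩ := S.exists_cell n x hx fun hx' => by
          refine h' ⟨?_, Or.inr ⟨x, hx', rfl⟩⟩
          rw [Nat.pos_iff_ne_zero]
          rintro rfl
          rw [S.skel_zero] at hx'
          exact hx'
        exact ⟨Sum.inl ⟨i, fun hi => hxA (A.smul_mem g (hi d))⟩, g, d, hd, smul_proj _ _⟩
    isClosed_of_cells := by
      intro n C hC h0 h1
      rw [isClosed_iff]
      refine S.isClosed_of_skel _ fun m => ?_
      induction m with
      | zero => simp [S.skel_zero]
      | succ m ih =>
        refine S.isClosed_of_cells m _ inter_subset_right ?_ fun i g => ?_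
        · rwa [inter_assoc, inter_eq_right.2 (S.skel_subset m)]
        have e : {d | g • S.map m i d ∈ proj ⁻¹' C ∩ S.skel (m + 1)} =
            {d | proj (g • S.map m i d) ∈ C} := by
          ext d
          exact and_iff_left (S.smul_mem_skel _ _ _ (S.map_mem m i d))
        rw [e]
        by_cases hi : ∀ d, S.map m i d ∈ A
        · have : ∀ d, (proj (g • S.map m i d) : Collapse A) = base := fun d =>
            proj_of_mem (A.smul_mem g (hi d))
          simp only [this]
          exact isClosed_const
        -- Cells of dimension less than `n` are governed by `h0` and those of dimension `n` by `h1`.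
        -- A cell of larger dimension outside `A` meets the preimage of `C` only along its boundary,
        -- where the induction on `m` applies.
        · rcases lt_trichotomy m n with hm | rfl | hm
          · convert h0.preimage (f := fun d => proj (g • S.map m i d))
              (continuous_proj.comp ((S.map m i).continuous.const_smul g)) using 1
            ext d
            exact (and_iff_left ⟨(Nat.zero_le m).trans_lt hm, Or.inr
              ⟨_, S.skel_mono hm (S.smul_mem_skel _ g _ (S.map_mem m i d)), rfl⟩⟩).symm
          · convert h1 (Sum.inl ⟨i, hi⟩) g using 1
            ext d
            exact Iff.of_eq (congrArg (· ∈ C) (smul_proj g _).symm)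
          · convert ih.preimage ((S.map m i).continuous.const_smul g) using 1
            ext d
            refine ⟨fun hd => ⟨hd, ?_⟩, fun hd => hd.1⟩
            rcases d.norm_le_one.lt_or_eq with hd' | hd'
            · have hA' := hint m i hi g d hd'
              rcases (hC hd).2 with h | ⟨x, hx, h⟩
              · exact (hA' (proj_eq_base.1 h)).elim
              · change g • S.map m i d ∈ S.skel m
                rw [eq_of_proj_eq hA' h.symm]
                exact S.skel_mono hm hx
            · exact S.smul_mem_skel _ _ _ (S.map_boundary m i d hd') }

/-- The pair `(X / A, {•})`. -/
noncomputable def pair [ContinuousConstSMul G X] (S : GCWStructure G X)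
    (hA : S.IsSubcomplex A) : GCWPair G where
  X := Collapse A
  A := { carrier := {base}, smul_mem' := by rintro g _ rfl; rfl }
  isGCW := ⟨structure_ S hA, by
    rintro n (i | i) d hd h d'
    · exact (i.2 (hA n i.1 d hd (proj_eq_base.1 h))).elim
    · rfl⟩

/-- The subcomplex of the target is a single 0-cell, so every map into it is cellular. This is the
purpose of collapsing. -/
theorem isCellularOnSub_pair [ContinuousConstSMul G X] (S : GCWStructure G X)
    (hA : S.IsSubcomplex A) {P : GCWPair G} (F : P ⟶ pair S hA) : IsCellularOnSub F := by
  refine isCellularOnSub_of_skel_one F (structure_ S hA) ?_ ?_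
  · rintro n (i | i) d hd h d'
    · exact (i.2 (hA n i.1 d hd (proj_eq_base.1 h))).elim
    · rfl
  · rintro _ rfl
    exact ⟨one_pos, Or.inl rfl⟩

end Collapse

/-- An adjunction along an arbitrary attaching map satisfies excision. -/
theorem IsLocalizing.of_isAdjunction {G : Type u} [Group G] {𝒞 : GCWPair G → Prop}
    (h𝒞 : IsLocalizing 𝒞) {P Q : GCWPair G} (F : P ⟶ Q) (hF : IsAdjunction F) (hP : 𝒞 P) :
    𝒞 Q := by
  obtain ⟨S, hS⟩ := Q.isGCW
  let π : Q ⟶ Collapse.pair S hS := Hom.mk (P := Q) (Q := Collapse.pair S hS) Collapse.proj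
    Collapse.continuous_proj (fun g x => (Collapse.smul_proj g x).symm)
    fun x hx => Collapse.proj_of_mem hx
  have hπ : BijOn π.toFun (Q.A : Set Q.X)ᶜ ((Collapse.pair S hS).A : Set (Collapse.pair S hS).X)ᶜ := by
    refine ⟨fun x hx h => hx (Collapse.proj_eq_base.1 h), fun x hx y _ h =>
      Collapse.eq_of_proj_eq hx h, fun q hq => ?_⟩
    obtain ⟨x, hx, rfl⟩ := (Collapse.eq_base_or q).resolve_left hq
    exact ⟨x, hx, rfl⟩
  -- Excision requires a cellular attaching map, which `F` need not have. Both `F ≫ π` and `π` are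
  -- adjunctions onto the collapsed pair and are automatically cellular on the subcomplex, so
  -- membership passes from `P` to the collapsed pair and back to `Q`.
  refine (h𝒞.excision π (Collapse.isCellularOnSub_pair S hS π) ⟨hπ, fun C hC _ =>
    Collapse.isClosed_iff.2 hC⟩).2 ((h𝒞.excision (F ≫ π)
    (Collapse.isCellularOnSub_pair S hS _) ⟨hπ.comp hF.bijOn, fun C hC _ => ?_⟩).1 hP)
  refine Collapse.isClosed_iff.2 (hF.isClosed_of _ hC ?_)
  -- The preimage of `C` in the subcomplex is everything or empty, according to whether `C` contains
  -- the base point.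
  by_cases h : (Collapse.base : Collapse Q.A) ∈ C
  · convert isClosed_univ
    refine eq_univ_of_forall fun x => ?_
    change Collapse.proj x.1 ∈ C
    rwa [Collapse.proj_of_mem x.2]
  · convert isClosed_empty
    refine eq_empty_of_forall_notMem fun x hx => h ?_
    change Collapse.proj x.1 ∈ C at hx
    rwa [Collapse.proj_of_mem x.2] at hx

/-! ### Discrete `G`-spaces -/

/-- The `G`-CW-structure on a discrete `G`-space. -/
noncomputable def discreteStructure (G : Type u) [Group G] (X : Type u) [TopologicalSpace X]
    [DiscreteTopology X] [MulAction G X] : GCWStructure G X where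
  skel n := {_x | 0 < n}
  skel_zero := by simp
  skel_subset n := by intro x hx; simp
  iUnion_skel := eq_univ_of_forall fun _ => mem_iUnion.2 ⟨1, by simp⟩
  smul_mem_skel n g x hx := hx
  isClosed_of_skel C _ := isClosed_discrete C
  cell n := {_c : MulAction.orbitRel.Quotient G X // n = 0}
  stab _ c := MulAction.stabilizer G c.1.out
  map _ c := ⟨fun _ => c.1.out, continuous_const⟩
  smul_map _ _ _ hg _ := hg
  map_mem n i d := by simp
  map_boundary n i d hd := by
    obtain ⟨i, rfl⟩ := i
    have : d.1 = 0 := Subsingleton.elim _ _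
    simp [this] at hd
  map_interior_notMem n i d hd := by
    obtain ⟨i, rfl⟩ := i
    simp
  map_interior_inj n i j g d d' _ _ h := by
    obtain ⟨i, rfl⟩ := i
    obtain ⟨j, hj⟩ := j
    have hij : i = j := by
      rw [← Quotient.out_eq j, ← Quotient.out_eq i, eq_comm]
      exact Quotient.sound ⟨g, h⟩
    subst hij
    exact ⟨rfl, Subtype.ext (Subsingleton.elim _ _), h⟩
  exists_cell n x _ hx := by
    have hn : n = 0 := by simpa using hx
    subst hn
    obtain ⟨g, hg⟩ := Quotient.exact (s := MulAction.orbitRel G X)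
      (Quotient.out_eq (Quotient.mk (MulAction.orbitRel G X) x)).symm
    exact ⟨⟨Quotient.mk _ x, rfl⟩, g, ⟨0, by simp⟩, by simp, hg⟩
  isClosed_of_cells n C _ _ _ := isClosed_discrete C

theorem isGCWComplex_of_discrete (G : Type u) [Group G] (X : Type u) [TopologicalSpace X]
    [DiscreteTopology X] [MulAction G X] : IsGCWComplex G X := ⟨discreteStructure G X⟩

/-! ### Wrapping a disk around a sphere -/

namespace Disk

variable {n : ℕ}

/-- The pole of the sphere. -/
noncomputable def pole (n : ℕ) : Disk (n + 1) :=
  ⟨EuclideanSpace.single 0 1, by simp⟩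

theorem norm_pole : ‖(pole n).1‖ = 1 := by simp [pole]

/-- The vector with coordinates `a`, `x`. -/
def consVec (a : ℝ) (x : EuclideanSpace ℝ (Fin n)) : EuclideanSpace ℝ (Fin (n + 1)) :=
  WithLp.toLp 2 (Fin.cons a x.ofLp)

theorem norm_sq_consVec (a : ℝ) (x : EuclideanSpace ℝ (Fin n)) :
    ‖consVec a x‖ ^ 2 = a ^ 2 + ‖x‖ ^ 2 := by
  simp [EuclideanSpace.norm_sq_eq, consVec, Fin.sum_univ_succ]

theorem consVec_inj {a b : ℝ} {x y : EuclideanSpace ℝ (Fin n)} :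
    consVec a x = consVec b y ↔ a = b ∧ x = y := by
  refine ⟨fun h => ?_, fun h => by rw [h.1, h.2]⟩
  have h' := (Fin.cons_inj (α := fun _ => ℝ)).1 (congrArg WithLp.ofLp h)
  exact ⟨h'.1, WithLp.ofLp_injective 2 h'.2⟩

theorem exists_consVec (y : EuclideanSpace ℝ (Fin (n + 1))) : ∃ a x, y = consVec a x :=
  ⟨y 0, WithLp.toLp 2 (Fin.tail y.ofLp), by
    rw [consVec, Fin.cons_self_tail]⟩

theorem pole_eq : (pole n).1 = consVec 1 0 := by
  ext i
  refine Fin.cases ?_ (fun i => ?_) i <;> simp [pole, consVec]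

theorem continuous_consVec : Continuous fun p : ℝ × EuclideanSpace ℝ (Fin n) =>
    consVec p.1 p.2 := by
  refine (PiLp.continuous_toLp 2 _).comp (continuous_pi fun i => ?_)
  refine Fin.cases ?_ (fun i => ?_) i
  · exact continuous_fst
  · simp only [Fin.cons_succ]
    fun_prop

/-- The vector underlying the map `wrap`. -/
noncomputable def wrapVec (d : Disk n) : EuclideanSpace ℝ (Fin (n + 1)) :=
  -- With `r = ‖d‖` the squared norm is `(2r² - 1)² + 4(1 - r²)r² = 1`. The first coordinate rises
  -- from -1 at the centre to 1 on the boundary, where the second component vanishes.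
  consVec (2 * ‖d.1‖ ^ 2 - 1) ((2 * √(1 - ‖d.1‖ ^ 2)) • d.1)

theorem norm_wrapVec (d : Disk n) : ‖wrapVec d‖ = 1 := by
  have h : 0 ≤ 1 - ‖d.1‖ ^ 2 := by nlinarith [d.norm_le_one, norm_nonneg d.1]
  have : ‖wrapVec d‖ ^ 2 = 1 := by
    rw [wrapVec, norm_sq_consVec, norm_smul, mul_pow, Real.norm_eq_abs, sq_abs, mul_pow,
      Real.sq_sqrt h]
    ring
  nlinarith [norm_nonneg (wrapVec d)]

/-- The map from the disk onto the sphere which collapses the boundary to the pole. -/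
noncomputable def wrap (n : ℕ) : C(Disk n, Disk (n + 1)) where
  toFun d := ⟨wrapVec d, mem_closedBall_zero_iff.2 (norm_wrapVec d).le⟩
  continuous_toFun := by
    refine Continuous.subtype_mk ?_ _
    exact continuous_consVec.comp (f := fun d : Disk n =>
      (2 * ‖d.1‖ ^ 2 - 1, (2 * √(1 - ‖d.1‖ ^ 2)) • d.1)) (by fun_prop)

theorem norm_wrap (d : Disk n) : ‖(wrap n d).1‖ = 1 := norm_wrapVec d

theorem wrap_boundary {d : Disk n} (h : ‖d.1‖ = 1) : wrap n d = pole n := by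
  refine Subtype.ext ?_
  rw [pole_eq]
  change wrapVec d = _
  rw [wrapVec, h]
  norm_num

theorem wrap_ne_pole {d : Disk n} (h : ‖d.1‖ < 1) : wrap n d ≠ pole n := by
  intro h'
  have h1 := congrArg Subtype.val h'
  rw [pole_eq] at h1
  have := (consVec_inj.1 h1).1
  nlinarith [norm_nonneg d.1]

theorem wrap_inj {d e : Disk n} (hd : ‖d.1‖ < 1) (h : wrap n d = wrap n e) : d = e := by
  obtain ⟨h1, h2⟩ := consVec_inj.1 (congrArg Subtype.val h)
  have h3 : ‖d.1‖ ^ 2 = ‖e.1‖ ^ 2 := by linarith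
  rw [← h3] at h2
  refine Subtype.ext (smul_right_injective _ ?_ h2)
  have : 0 < 1 - ‖d.1‖ ^ 2 := by nlinarith [norm_nonneg d.1]
  positivity

/-- Solving for the preimage: the first coordinate `a = 2r² - 1` gives `r² = (1 + a) / 2` and `1 -
r² = (1 - a) / 2`, so `d = x / (2√((1 - a) / 2))`. Off the pole `a < 1`, so the division is
legitimate. -/
theorem exists_wrap {y : Disk (n + 1)} (hy : ‖y.1‖ = 1) (h : y ≠ pole n) :
    ∃ d, ‖d.1‖ < 1 ∧ wrap n d = y := by
  obtain ⟨a, x, hax⟩ := exists_consVec y.1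
  have h1 : a ^ 2 + ‖x‖ ^ 2 = 1 := by rw [← norm_sq_consVec, ← hax, hy, one_pow]
  have ha1 : a < 1 := by
    by_contra! ha
    have hx : ‖x‖ ^ 2 = 0 := by nlinarith [sq_nonneg ‖x‖]
    have hx' : x = 0 := by simpa using hx
    have ha' : a = 1 := by nlinarith
    exact h (Subtype.ext (by rw [hax, pole_eq, ha', hx']))
  have hs : 0 < √((1 - a) / 2) := Real.sqrt_pos.2 (by linarith)
  have hs' : √((1 - a) / 2) ^ 2 = (1 - a) / 2 := Real.sq_sqrt (by linarith)
  have hn : ‖(2 * √((1 - a) / 2))⁻¹ • x‖ ^ 2 = (1 + a) / 2 := by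
    rw [norm_smul, norm_inv, Real.norm_of_nonneg (by positivity), mul_pow, inv_pow, mul_pow, hs']
    have : (1 - a) ≠ 0 := by linarith
    field_simp
    nlinarith
  have hn' : ‖(2 * √((1 - a) / 2))⁻¹ • x‖ < 1 := by
    nlinarith [norm_nonneg ((2 * √((1 - a) / 2))⁻¹ • x)]
  refine ⟨⟨_, mem_closedBall_zero_iff.2 hn'.le⟩, hn', Subtype.ext ?_⟩
  change wrapVec _ = _
  rw [hax, wrapVec, consVec_inj]
  dsimp only
  rw [hn]
  refine ⟨by ring, ?_⟩
  have e : 1 - (1 + a) / 2 = (1 - a) / 2 := by ring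
  rw [e, smul_smul, mul_inv_cancel₀ (by positivity), one_smul]

end Disk

/-! ### Equivariant disks -/

/-- The product of an orbit with a space. -/
def OrbitProd {G : Type u} [Group G] (L : Subgroup G) (Y : Type) : Type u := Σ _ : G ⧸ L, Y

namespace OrbitProd

variable {G : Type u} [Group G] {L : Subgroup G} {Y : Type}

instance : MulAction G (OrbitProd L Y) where
  smul g p := ⟨g • p.1, p.2⟩
  one_smul p := congrArg (fun c => (⟨c, p.2⟩ : Σ _ : G ⧸ L, Y)) (one_smul G p.1)
  mul_smul a b p := congrArg (fun c => (⟨c, p.2⟩ : Σ _ : G ⧸ L, Y)) (mul_smul a b p.1)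

variable (L) in
/-- The point `(g L, y)`. -/
def mk (g : G) (y : Y) : OrbitProd L Y := ⟨(g : G ⧸ L), y⟩

theorem exists_mk (p : OrbitProd L Y) : ∃ g y, p = mk L g y := by
  obtain ⟨c, y⟩ := p
  induction c using QuotientGroup.induction_on with
  | H g => exact ⟨g, y, rfl⟩

theorem mk_eq_mk {g h : G} {y y' : Y} : mk L g y = mk L h y' ↔ g⁻¹ * h ∈ L ∧ y = y' := by
  refine ⟨fun e => ⟨QuotientGroup.eq.1 (congrArg Sigma.fst e), congrArg (fun p => p.2) e⟩, ?_⟩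
  rintro ⟨h1, rfl⟩
  exact congrArg (fun c => (⟨c, y⟩ : Σ _ : G ⧸ L, Y)) (QuotientGroup.eq.2 h1)

/-- Maps out of `G / L × Y`. -/
def lift {Z : Type*} (f : G → Y → Z) (hf : ∀ g, ∀ l ∈ L, ∀ y, f (g * l) y = f g y) :
    OrbitProd L Y → Z :=
  fun p => Quotient.liftOn' p.1 (fun g => f g p.2) fun g h e => by
    have := hf g (g⁻¹ * h) (QuotientGroup.leftRel_apply.1 e) p.2
    rw [mul_inv_cancel_left] at this
    exact this.symm

variable [TopologicalSpace Y]

instance : TopologicalSpace (OrbitProd L Y) :=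
  inferInstanceAs (TopologicalSpace (Σ _ : G ⧸ L, Y))

instance [DiscreteTopology Y] : DiscreteTopology (OrbitProd L Y) :=
  inferInstanceAs (DiscreteTopology (Σ _ : G ⧸ L, Y))

theorem isClosed_iff {C : Set (OrbitProd L Y)} :
    IsClosed C ↔ ∀ g, IsClosed {y | mk L g y ∈ C} := by
  refine isClosed_sigma_iff.trans ⟨fun h g => h g, fun h c => ?_⟩
  induction c using QuotientGroup.induction_on with
  | H g => exact h g

theorem continuous_mk (g : G) : Continuous (mk L g : Y → OrbitProd L Y) :=
  continuous_sigmaMk (σ := fun _ : G ⧸ L => Y)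

theorem continuous_lift {Z : Type*} [TopologicalSpace Z] (f : G → Y → Z)
    (hf : ∀ g, ∀ l ∈ L, ∀ y, f (g * l) y = f g y) (hc : ∀ g, Continuous (f g)) :
    Continuous (lift f hf) := by
  refine continuous_sigma fun c => ?_
  induction c using QuotientGroup.induction_on with
  | H g => exact hc g

instance : ContinuousConstSMul G (OrbitProd L Y) where
  continuous_const_smul g := continuous_sigma fun c =>
    continuous_sigmaMk (σ := fun _ : G ⧸ L => Y) (i := g • c)

/-- The map induced by a map of spaces. -/
def map {Y' : Type} (f : Y → Y') (p : OrbitProd L Y) : OrbitProd L Y' := ⟨p.1, f p.2⟩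

theorem continuous_map {Y' : Type} [TopologicalSpace Y'] {f : Y → Y'} (hf : Continuous f) :
    Continuous (map f : OrbitProd L Y → OrbitProd L Y') :=
  continuous_sigma fun _ => (continuous_sigmaMk (σ := fun _ : G ⧸ L => Y')).comp hf

variable (L)

/-- The cells of `Disk (n + 1)`: the pole, the sphere and the disk itself. -/
inductive DiskCell (n : ℕ) : ℕ → Type u
  | pole : DiskCell n 0
  | sphere : DiskCell n n
  | disk : DiskCell n (n + 1)

/-- The characteristic maps of the cells of a disk. -/
noncomputable def DiskCell.map {n : ℕ} : ∀ {m}, DiskCell.{u} n m → C(Disk m, Disk (n + 1))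
  | _, .pole => ⟨fun _ => Disk.pole n, continuous_const⟩
  | _, .sphere => Disk.wrap n
  | _, .disk => ContinuousMap.id _

theorem DiskCell.map_inj {n m : ℕ} {i j : DiskCell.{u} n m} {d d' : Disk m} (hd : ‖d.1‖ < 1)
    (hd' : ‖d'.1‖ < 1) (h : i.map d = j.map d') : i = j ∧ d = d' := by
  cases i with
  | pole =>
    cases j with
    | pole => exact ⟨rfl, Subtype.ext (Subsingleton.elim _ _)⟩
    | sphere => exact (Disk.wrap_ne_pole hd' h.symm).elim
  | sphere =>
    cases j with
    | pole => exact (Disk.wrap_ne_pole hd h).elim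
    | sphere => exact ⟨rfl, Disk.wrap_inj hd h⟩
  | disk =>
    cases j with
    | disk => exact ⟨rfl, h⟩

/-- The cellular filtration of a disk. -/
def diskSkel (n m : ℕ) : Set (Disk (n + 1)) :=
  -- By the index shift of `skel`, a cell of dimension `j` enters at the indices `m > j`; here `j`
  -- is 0, `n` and `n + 1`. For `n = 0` the sphere cell is the point opposite to the pole.
  {y | (0 < m ∧ y = Disk.pole n) ∨ (n < m ∧ ‖y.1‖ = 1) ∨ n + 1 < m}

theorem norm_eq_zero_of_disk_zero (d : Disk 0) : ‖d.1‖ = 0 := by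
  rw [Subsingleton.elim d.1 0, norm_zero]

/-- The `G`-CW-structure on `G / L × Disk (n + 1)`. -/
noncomputable def diskStructure (n : ℕ) : GCWStructure G (OrbitProd L (Disk (n + 1))) where
  skel m := {p | p.2 ∈ diskSkel n m}
  skel_zero := by
    ext p
    simp [diskSkel]
  skel_subset m p hp := by
    rcases hp with h | h | h
    · exact Or.inl ⟨by omega, h.2⟩
    · exact Or.inr (Or.inl ⟨by omega, h.2⟩)
    · exact Or.inr (Or.inr (by omega))
  iUnion_skel := eq_univ_of_forall fun p =>
    mem_iUnion.2 ⟨n + 2, Or.inr (Or.inr (by omega))⟩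
  smul_mem_skel m g p hp := hp
  isClosed_of_skel C hC := by
    convert hC (n + 2)
    refine (inter_eq_left.2 fun p _ => Or.inr (Or.inr (by omega))).symm
  cell m := DiskCell n m
  stab _ _ := L
  map m i := ⟨fun d => mk L 1 (i.map d), (continuous_mk 1).comp (i.map).continuous⟩
  smul_map m i g hg d := by
    change mk L (g * 1) (i.map d) = mk L 1 (i.map d)
    rw [mk_eq_mk]
    exact ⟨by simpa using hg, rfl⟩
  map_mem m i d := by
    cases i with
    | pole => exact Or.inl ⟨by omega, rfl⟩
    | sphere => exact Or.inr (Or.inl ⟨by omega, Disk.norm_wrap d⟩)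
    | disk => exact Or.inr (Or.inr (by omega))
  map_boundary m i d hd := by
    cases i with
    | pole => rw [norm_eq_zero_of_disk_zero] at hd; norm_num at hd
    | sphere =>
      refine Or.inl ⟨?_, Disk.wrap_boundary hd⟩
      rw [Nat.pos_iff_ne_zero]
      rintro rfl
      rw [norm_eq_zero_of_disk_zero] at hd
      norm_num at hd
    | disk => exact Or.inr (Or.inl ⟨by omega, hd⟩)
  map_interior_notMem m i d hd := by
    rintro (h | h | h) <;> cases i with
    | pole => omega
    | sphere => first | exact Disk.wrap_ne_pole hd h.2 | omega
    | disk =>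
      first
      | omega
      | exact hd.ne h.2
      | exact hd.ne ((congrArg (fun y => ‖y.1‖) h.2).trans Disk.norm_pole)
  map_interior_inj m i j g d d' hd hd' h := by
    obtain ⟨h1, h2⟩ := mk_eq_mk.1 (show mk L (g * 1) (i.map d) = mk L 1 (j.map d') from h)
    have hg : g ∈ L := by simpa using h1
    obtain ⟨h3, h4⟩ := DiskCell.map_inj hd hd' h2
    exact ⟨h3, h4, hg⟩
  exists_cell m p hp hp' := by
    obtain ⟨g, y, rfl⟩ := exists_mk p
    change y ∈ diskSkel n (m + 1) at hp
    change y ∉ diskSkel n m at hp'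
    by_cases h1 : y = Disk.pole n
    · have hm : m = 0 := by
        by_contra hm
        exact hp' (Or.inl ⟨by omega, h1⟩)
      subst hm
      exact ⟨.pole, g, ⟨0, by simp⟩, by simp, by
        change mk L (g * 1) (Disk.pole n) = _
        rw [mul_one, h1]⟩
    by_cases h2 : ‖y.1‖ = 1
    · have hm : m = n := by
        refine le_antisymm (not_lt.1 fun hm => hp' (Or.inr (Or.inl ⟨hm, h2⟩))) ?_
        rcases hp with h | h | h
        · exact (h1 h.2).elim
        · omega
        · omega
      subst hm
      obtain ⟨d, hd, rfl⟩ := Disk.exists_wrap h2 h1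
      exact ⟨.sphere, g, d, hd, by
        change mk L (g * 1) (Disk.wrap m d) = _
        rw [mul_one]⟩
    · have hm : m = n + 1 := by
        refine le_antisymm (not_lt.1 fun hm => hp' (Or.inr (Or.inr hm))) ?_
        rcases hp with h | h | h
        · exact (h1 h.2).elim
        · exact (h2 h.2).elim
        · omega
      subst hm
      exact ⟨.disk, g, y, y.norm_le_one.lt_of_ne h2, by
        change mk L (g * 1) y = _
        rw [mul_one]⟩
  isClosed_of_cells m C hC h0 h1 := by
    rw [isClosed_iff]
    intro g
    have h0' := isClosed_iff.1 h0 g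
    have h1' : ∀ i : DiskCell n m, IsClosed {d | mk L g (i.map d) ∈ C} := by
      intro i
      convert h1 i g using 1
      ext d
      change mk L g (i.map d) ∈ C ↔ mk L (g * 1) (i.map d) ∈ C
      rw [mul_one]
    have hp : ∀ s ⊆ ({Disk.pole n} : Set (Disk (n + 1))), IsClosed s := fun s hs =>
      ((finite_singleton _).subset hs).isClosed
    by_cases hm : m = n + 1
    · subst hm
      exact h1' .disk
    by_cases hm' : m = n
    · subst hm'
      -- Here `C` lies over the sphere, so up to the pole each slice is the image of its closed,
      -- hence compact, preimage under `wrap`.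
      have := (h1' .sphere).isCompact.image (Disk.wrap m).continuous
      convert this.isClosed.union (hp ({y | mk L g y ∈ C} ∩ {Disk.pole m}) inter_subset_right)
        using 1
      ext y
      constructor
      · intro hy
        by_cases h2 : y = Disk.pole m
        · exact Or.inr ⟨hy, h2⟩
        · have h3 : ‖y.1‖ = 1 := by
            rcases hC hy with h | h | h
            · exact (h2 h.2).elim
            · exact h.2
            · omega
          obtain ⟨d, -, rfl⟩ := Disk.exists_wrap h3 h2
          exact Or.inl ⟨d, hy, rfl⟩
      · rintro (⟨d, hd, rfl⟩ | hy)
        · exact hd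
        · exact hy.1
    · rcases Nat.eq_zero_or_pos m with rfl | hm0
      · refine hp _ fun y hy => ?_
        rcases hC hy with h | h | h
        · exact h.2
        · omega
        · omega
      · convert h0' using 1
        ext y
        refine ⟨fun hy => ⟨hy, ?_⟩, fun hy => hy.1⟩
        rcases hC hy with h | h | h
        · exact Or.inl ⟨hm0, h.2⟩
        · exact Or.inr (Or.inl ⟨by omega, h.2⟩)
        · exact Or.inr (Or.inr (by omega))

/-- The pair `G / L × (Disk n, ∂ Disk n)`. -/
def diskPair (n : ℕ) : GCWPair G where
  X := OrbitProd L (Disk n)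
  A := { carrier := {p | ‖p.2.1‖ = 1}, smul_mem' := fun _ _ h => h }
  isGCW := by
    cases n with
    | zero =>
      refine ⟨discreteStructure G _, fun n i d hd h d' => ?_⟩
      have : ‖((i.1.out : OrbitProd L (Disk 0)).2).1‖ = 1 := h
      rw [norm_eq_zero_of_disk_zero] at this
      norm_num at this
    | succ n =>
      refine ⟨diskStructure L n, fun m i d hd h d' => ?_⟩
      cases i with
      | pole => exact Disk.norm_pole
      | sphere => exact Disk.norm_wrap _
      | disk => exact (hd.ne h).elim

/-- The orbit of the pole. -/
def poleSub (n : ℕ) : SubMulAction G (OrbitProd L (Disk (n + 1))) where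
  carrier := {p | p.2 = Disk.pole n}
  smul_mem' _ _ h := h

/-- The product of an orbit with the sphere. -/
def sphereSub (n : ℕ) : SubMulAction G (OrbitProd L (Disk (n + 1))) where
  carrier := {p | ‖p.2.1‖ = 1}
  smul_mem' _ _ h := h

theorem isSubcomplex_poleSub (n : ℕ) : (diskStructure L n).IsSubcomplex (poleSub L n) := by
  intro m i d hd h d'
  cases i with
  | pole => rfl
  | sphere => exact (Disk.wrap_ne_pole hd h).elim
  | disk => exact (hd.ne ((congrArg (fun y => ‖y.1‖) h).trans Disk.norm_pole)).elim

theorem isSubcomplex_sphereSub (n : ℕ) : (diskStructure L n).IsSubcomplex (sphereSub L n) := by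
  intro m i d hd h d'
  cases i with
  | pole => exact Disk.norm_pole
  | sphere => exact Disk.norm_wrap _
  | disk => exact (hd.ne h).elim

/-- The map from the disk to the sphere as a map of pairs. -/
noncomputable def wrapPair (n : ℕ) : diskPair L n ⟶ (diskStructure L n).subPair (poleSub L n)
    (sphereSub L n) (isSubcomplex_poleSub L n) (isSubcomplex_sphereSub L n) :=
  Hom.mk (P := diskPair L n) (Q := (diskStructure L n).subPair (poleSub L n)
      (sphereSub L n) (isSubcomplex_poleSub L n) (isSubcomplex_sphereSub L n))
    (fun p : OrbitProd L (Disk n) => (⟨map (Disk.wrap n) p, Disk.norm_wrap p.2⟩ : sphereSub L n))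
    (Continuous.subtype_mk (continuous_map (Disk.wrap n).continuous) _) (fun _ _ => rfl)
    (fun _ h => Disk.wrap_boundary h)

/-- The sphere is the disk with its boundary collapsed to the pole; compactness of the disk gives
the quotient topology. Passing from `(Dⁿ, ∂Dⁿ)` to `(Sⁿ, pole)` raises the dimension in the
induction over disks. -/
theorem isAdjunction_wrapPair (n : ℕ) : IsAdjunction (wrapPair L n) := by
  refine ⟨⟨?_, ?_, ?_⟩, fun C hC hC' => ?_⟩
  · intro (p : OrbitProd L (Disk n)) hp h
    exact Disk.wrap_ne_pole (p.2.norm_le_one.lt_of_ne hp) h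
  · intro (p : OrbitProd L (Disk n)) hp (q : OrbitProd L (Disk n)) _ h
    have h' : map (Disk.wrap n) p = map (Disk.wrap n) q := congrArg Subtype.val h
    obtain ⟨g, d, rfl⟩ := exists_mk p
    obtain ⟨k, e, rfl⟩ := exists_mk q
    obtain ⟨h1, h2⟩ := mk_eq_mk.1 (show mk L g (Disk.wrap n d) = mk L k (Disk.wrap n e) from h')
    exact mk_eq_mk.2 ⟨h1, Disk.wrap_inj (d.norm_le_one.lt_of_ne hp) h2⟩
  · intro (q : sphereSub L n) hq
    obtain ⟨q, hq'⟩ := q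
    obtain ⟨g, y, rfl⟩ := exists_mk q
    obtain ⟨d, hd, rfl⟩ := Disk.exists_wrap hq' hq
    exact ⟨mk L g d, hd.ne, rfl⟩
  · have hcl := ((diskStructure L n).isClosed_subcomplex _
      (isSubcomplex_sphereSub L n)).isClosedEmbedding_subtypeVal
    refine hcl.isClosed_iff_image_isClosed.2 (isClosed_iff.2 fun g => ?_)
    have c1 : IsClosed {d : Disk n | (wrapPair L n).toFun (mk L g d) ∈ C} :=
      (isClosed_iff (L := L) (Y := Disk n)).1 hC g
    convert (c1.isCompact.image (Disk.wrap n).continuous).isClosed.union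
      (((finite_singleton (Disk.pole n)).subset (inter_subset_right
        (s := {y | mk L g y ∈ Subtype.val '' (C : Set (sphereSub L n))}))).isClosed) using 1
    ext y
    constructor
    · intro hy
      by_cases h2 : y = Disk.pole n
      · exact Or.inr ⟨hy, h2⟩
      · obtain ⟨x, hx, hxy⟩ := hy
        have hy' : ‖y.1‖ = 1 := (congrArg (fun p : OrbitProd L (Disk (n + 1)) =>
          ‖p.2.1‖) hxy).symm.trans x.2
        obtain ⟨d, -, rfl⟩ := Disk.exists_wrap hy' h2
        have : x = (wrapPair L n).toFun (mk L g d) := Subtype.ext hxy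
        rw [this] at hx
        exact Or.inl ⟨d, hx, rfl⟩
    · rintro (⟨d, hd, rfl⟩ | hy)
      · exact ⟨_, hd, rfl⟩
      · exact hy.1

theorem isGCWComplex_disk (n : ℕ) : IsGCWComplex G (OrbitProd L (Disk n)) :=
  (diskPair L n).isGCW.elim fun S _ => ⟨S⟩

/-- The product of an orbit with a disk. -/
def disk (n : ℕ) : GCWPair G := ofComplex (OrbitProd L (Disk n)) (isGCWComplex_disk L n)

/-! ### Equivariant disks and spheres in a localizing class. -/

variable {𝒞 : GCWPair G → Prop} (h𝒞 : IsLocalizing 𝒞)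
include h𝒞

/-- The empty space is the coproduct of the empty family. -/
theorem _root_.EquivHom.IsLocalizing.of_isEmpty (P : GCWPair G) [IsEmpty P.X] : 𝒞 P := by
  let f : P ⟶ coprod (ι := PEmpty.{u + 1}) (fun _ => PUnit.{u + 1}) (fun i => i.elim) :=
    Hom.mk (P := P) (Q := coprod (ι := PEmpty.{u + 1}) (fun _ => PUnit.{u + 1}) (fun i => i.elim))
      (fun x => isEmptyElim x) (continuous_of_const fun x => isEmptyElim x)
      (fun _ x => isEmptyElim x) fun x => isEmptyElim x
  let g : coprod (G := G) (ι := PEmpty.{u + 1}) (fun _ => PUnit.{u + 1}) (fun i => i.elim) ⟶ P :=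
    Hom.mk (Q := P) (P := coprod (ι := PEmpty.{u + 1}) (fun _ => PUnit.{u + 1}) (fun i => i.elim))
      (fun x => x.1.elim) (continuous_of_const fun x => x.1.elim)
      (fun _ x => x.1.elim) fun x => x.1.elim
  exact h𝒞.retract_of_eq f g (fun x => isEmptyElim x)
    (h𝒞.coprod (ι := PEmpty.{u + 1}) _ _ fun i => i.elim)

variable (hL : 𝒞 (disk L 0))
include hL

/-- Scaling contracts the disk to its centre, and this is equivariant because `G` acts only on the
orbit factor. -/
theorem disk_mem (n : ℕ) : 𝒞 (disk L n) := by
  let f : disk L n ⟶ disk L 0 :=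
    ofMap (X := OrbitProd L (Disk n)) (Y := OrbitProd L (Disk 0)) (map fun _ => ⟨0, by simp⟩)
      (continuous_map continuous_const) fun _ _ => rfl
  let g : disk L 0 ⟶ disk L n :=
    ofMap (X := OrbitProd L (Disk 0)) (Y := OrbitProd L (Disk n)) (map fun _ => ⟨0, by simp⟩)
      (continuous_map continuous_const) fun _ _ => rfl
  have hb : ∀ (t : unitInterval) (d : Disk n), t.1 • d.1 ∈ Metric.closedBall 0 1 := by
    intro t d
    rw [mem_closedBall_zero_iff, norm_smul, Real.norm_of_nonneg t.2.1]
    exact mul_le_one₀ t.2.2 (norm_nonneg _) d.norm_le_one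
  refine h𝒞.retract f g ⟨fun p : OrbitProd L (Disk n) × unitInterval =>
    (⟨p.1.1, ⟨p.2.1 • p.1.2.1, hb _ _⟩⟩ : OrbitProd L (Disk n)), ?_, fun _ _ _ => rfl,
    fun _ h => h.elim, fun p : OrbitProd L (Disk n) => ?_,
    fun p : OrbitProd L (Disk n) => ?_⟩ hL
  · have : Continuous fun p : (Σ _ : G ⧸ L, Disk n × unitInterval) =>
        (⟨p.1, ⟨p.2.2.1 • p.2.1.1, hb _ _⟩⟩ : Σ _ : G ⧸ L, Disk n) :=
      continuous_sigma fun c => (continuous_sigmaMk (σ := fun _ : G ⧸ L => Disk n)).comp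
        (f := fun p : Disk n × unitInterval => (⟨p.2.1 • p.1.1, hb _ _⟩ : Disk n))
        (Continuous.subtype_mk (by fun_prop) _)
    exact this.comp (Homeomorph.sigmaProdDistrib (X := fun _ : G ⧸ L => Disk n)).continuous
  · exact congrArg (fun d => (⟨p.1, d⟩ : Σ _ : G ⧸ L, Disk n))
      (Subtype.ext (zero_smul ℝ p.2.1) : (⟨(0 : ℝ) • p.2.1, hb 0 _⟩ : Disk n) = ⟨0, by simp⟩)
  · exact congrArg (fun d => (⟨p.1, d⟩ : Σ _ : G ⧸ L, Disk n))
      (Subtype.ext (one_smul ℝ p.2.1) : (⟨(1 : ℝ) • p.2.1, hb 1 _⟩ : Disk n) = p.2)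

/-- Induction on the dimension: `(Dⁿ, ∂Dⁿ)` yields `(Sⁿ, pole)` by excision, then `Sⁿ` because the
orbit of the pole is in the class, and then `(Dⁿ⁺¹, Sⁿ)` because disks are contractible. -/
theorem diskPair_mem (n : ℕ) : 𝒞 (diskPair L n).sub ∧ 𝒞 (diskPair L n) := by
  induction n with
  | zero =>
    have : IsEmpty (diskPair L 0).sub.X := ⟨fun x : (diskPair L 0).A => by
      have h : ‖(x.1.2 : Disk 0).1‖ = 1 := x.2
      rw [norm_eq_zero_of_disk_zero] at h
      norm_num at h⟩
    have h := IsLocalizing.of_isEmpty h𝒞 (diskPair L 0).sub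
    exact ⟨h, h𝒞.pair _ h hL⟩
  | succ n ih =>
    have h1 := h𝒞.of_isAdjunction _ (isAdjunction_wrapPair L n) ih.2
    have h2 : 𝒞 ((diskStructure L n).sub (poleSub L n) (isSubcomplex_poleSub L n)) := by
      refine h𝒞.retract_of_eq (Q := disk L 0)
        (ofMap (X := poleSub L n) (Y := OrbitProd L (Disk 0))
          (fun p => map (fun _ => ⟨0, by simp⟩) p.1)
          ((continuous_map continuous_const).comp continuous_subtype_val) fun _ _ => rfl)
        (ofMap (Y := poleSub L n) (X := OrbitProd L (Disk 0))
          (fun p => ⟨map (fun _ => Disk.pole n) p, rfl⟩)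
          ((continuous_map continuous_const).subtype_mk _) fun _ _ => rfl) ?_ hL
      intro (p : poleSub L n)
      exact Subtype.ext (congrArg (fun d => (⟨p.1.1, d⟩ : Σ _ : G ⧸ L, Disk (n + 1))) p.2.symm)
    have h3 := GCWStructure.sub_of_subPair h𝒞 (isSubcomplex_poleSub L n)
      (isSubcomplex_sphereSub L n) (fun p hp => by
        change ‖p.2.1‖ = 1
        rw [show p.2 = Disk.pole n from hp, Disk.norm_pole]) h1 h2
    exact ⟨h3, h𝒞.pair _ h3 (disk_mem L h𝒞 hL (n + 1))⟩

end OrbitProd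

/-! ### Finite-dimensional complexes -/

section Sigma

variable {G : Type u} [Group G] {ι : Type u} (P : ι → GCWPair G)

/-- The disjoint union of pairs. -/
noncomputable def GCWPair.sigmaPair : GCWPair G where
  X := Σ i, (P i).X
  A := { carrier := {p | p.2 ∈ (P p.1).A}, smul_mem' := fun g p h => (P p.1).A.smul_mem g h }
  isGCW := ⟨sigmaStructure _ fun i => (P i).isGCW.choose,
    fun n i d hd h d' => (P i.1).isGCW.choose_spec n i.2 d hd h d'⟩

/-- The coproduct property concerns absolute complexes only. It extends to pairs once the subcomplex
of the disjoint union is identified with the disjoint union of the subcomplexes. -/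
theorem IsLocalizing.sigmaPair {𝒞 : GCWPair G → Prop} (h𝒞 : IsLocalizing 𝒞)
    (h1 : ∀ i, 𝒞 (P i).sub) (h2 : ∀ i, 𝒞 (P i).abs) : 𝒞 (GCWPair.sigmaPair P) := by
  refine h𝒞.pair _ ?_ (h𝒞.coprod _ _ h2)
  refine h𝒞.retract_of_eq (Q := GCWPair.coprod (fun i => (P i).A) fun i => (P i).isGCW.elim
      fun S hS => ⟨S.restrict _ hS⟩)
    (ofMap (X := (GCWPair.sigmaPair P).A) (Y := Σ i, (P i).A) (fun p : {p : Σ i, (P i).X // p.2 ∈ (P p.1).A} => ⟨p.1.1, p.1.2, p.2⟩) ?_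
      fun _ _ => rfl)
    (ofMap (Y := (GCWPair.sigmaPair P).A) (X := Σ i, (P i).A)
      (fun p => (⟨⟨p.1, p.2.1⟩, p.2.2⟩ : (GCWPair.sigmaPair P).A)) ?_ fun _ _ => rfl)
    (fun _ => rfl) (h𝒞.coprod _ _ h1)
  · have hI : Topology.IsInducing fun p : Σ i, (P i).A => (⟨p.1, p.2.1⟩ : Σ i, (P i).X) :=
      (Topology.isInducing_sigmaMap (f₁ := id) (τ := fun i => (P i).X)
        (f₂ := fun i => (Subtype.val : (P i).A → (P i).X)) Function.injective_id).2
        fun i => Topology.IsInducing.subtypeVal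
    exact hI.continuous_iff.2 (continuous_subtype_val (p := fun p : Σ i, (P i).X => p.2 ∈ (P p.1).A))
  · refine Continuous.subtype_mk (continuous_sigma fun i => ?_) _
    exact (continuous_sigmaMk (σ := fun i => (P i).X)).comp continuous_subtype_val

end Sigma

/-! ### Attaching all equivariant cells of one dimension. -/

namespace GCWStructure

variable {G : Type u} [Group G] {X : Type u} [TopologicalSpace X] [MulAction G X]
  [ContinuousConstSMul G X] (S : GCWStructure G X)

/-- The union of the characteristic maps of the `n`-cells. -/
noncomputable def attach (n : ℕ) : sigmaPair (fun i : S.cell n => OrbitProd.diskPair (S.stab n i) n) ⟶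
    S.subPair (S.skelSub n) (S.skelSub (n + 1)) (S.isSubcomplex_skelSub n)
      (S.isSubcomplex_skelSub (n + 1)) :=
  have hlift : ∀ (i : S.cell n) (g : G), ∀ l ∈ S.stab n i, ∀ d,
      (⟨(g * l) • S.map n i d, S.smul_mem_skel _ _ _ (S.map_mem n i d)⟩ : S.skelSub (n + 1)) =
        ⟨g • S.map n i d, S.smul_mem_skel _ _ _ (S.map_mem n i d)⟩ := fun i g l hl d =>
    Subtype.ext (by
      change (g * l) • S.map n i d = g • S.map n i d
      rw [mul_smul, S.smul_map n i l hl])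
  Hom.mk (P := sigmaPair (fun i : S.cell n => OrbitProd.diskPair (S.stab n i) n))
    (Q := S.subPair (S.skelSub n) (S.skelSub (n + 1)) (S.isSubcomplex_skelSub n)
      (S.isSubcomplex_skelSub (n + 1)))
    (fun p : Σ i : S.cell n, OrbitProd (S.stab n i) (Disk n) => OrbitProd.lift
      (fun g d => (⟨g • S.map n p.1 d, S.smul_mem_skel _ _ _ (S.map_mem n p.1 d)⟩ :
        S.skelSub (n + 1))) (hlift p.1) p.2)
    (continuous_sigma fun i => OrbitProd.continuous_lift (fun g d => (⟨g • S.map n i d,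
      S.smul_mem_skel _ _ _ (S.map_mem n i d)⟩ : S.skelSub (n + 1))) (hlift i) fun g =>
      ((S.map n i).continuous.const_smul g).subtype_mk _)
    (fun g (p : Σ i : S.cell n, OrbitProd (S.stab n i) (Disk n)) => by
      obtain ⟨i, p⟩ := p
      obtain ⟨k, d, rfl⟩ := OrbitProd.exists_mk p
      exact Subtype.ext (mul_smul g k _))
    (fun (p : Σ i : S.cell n, OrbitProd (S.stab n i) (Disk n)) hp => by
      obtain ⟨i, p⟩ := p
      obtain ⟨k, d, rfl⟩ := OrbitProd.exists_mk p
      exact S.smul_mem_skel _ _ _ (S.map_boundary n i d hp))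

/-- The axioms on open cells give the bijection outside of the boundary, and the pushout topology of
`skel (n + 1)` gives the closedness condition. -/
theorem isAdjunction_attach (n : ℕ) : IsAdjunction (S.attach n) := by
  refine ⟨⟨?_, ?_, ?_⟩, fun C hC hC' => ?_⟩
  · intro (p : Σ i : S.cell n, OrbitProd (S.stab n i) (Disk n)) hp h
    obtain ⟨i, p⟩ := p
    obtain ⟨k, d, rfl⟩ := OrbitProd.exists_mk p
    exact S.smul_interior_notMem k (d.norm_le_one.lt_of_ne hp) h
  · intro (p : Σ i : S.cell n, OrbitProd (S.stab n i) (Disk n)) hp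
      (q : Σ i : S.cell n, OrbitProd (S.stab n i) (Disk n)) hq h
    obtain ⟨i, p⟩ := p
    obtain ⟨k, d, rfl⟩ := OrbitProd.exists_mk p
    obtain ⟨j, q⟩ := q
    obtain ⟨l, e, rfl⟩ := OrbitProd.exists_mk q
    have h' : k • S.map n i d = l • S.map n j e := congrArg Subtype.val h
    obtain ⟨rfl, h2, h3⟩ := S.map_interior_inj n i j (l⁻¹ * k) d e
      (d.norm_le_one.lt_of_ne hp) (e.norm_le_one.lt_of_ne hq)
      (by rw [mul_smul, h', inv_smul_smul])
    refine congrArg (Sigma.mk i) (OrbitProd.mk_eq_mk.2 ⟨?_, h2⟩)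
    simpa using inv_mem h3
  · intro (q : S.skelSub (n + 1)) hq
    obtain ⟨i, g, d, hd, h⟩ := S.exists_cell n q.1 q.2 hq
    exact ⟨⟨i, OrbitProd.mk _ g d⟩, hd.ne, Subtype.ext h⟩
  · have hcl := ((S.isClosed_subcomplex _ (S.isSubcomplex_skelSub (n + 1)))).isClosedEmbedding_subtypeVal
    have hcl' := ((S.isClosed_subcomplex _ (S.isSubcomplex_skelSub n))).isClosedEmbedding_subtypeVal
    refine hcl.isClosed_iff_image_isClosed.2 (S.isClosed_of_cells n _ ?_ ?_ fun i g => ?_)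
    · rintro _ ⟨x, -, rfl⟩
      exact x.2
    · have hι : Continuous fun x : S.skelSub n => (⟨⟨x.1, S.skel_subset n x.2⟩, x.2⟩ :
          (S.subPair (S.skelSub n) (S.skelSub (n + 1)) (S.isSubcomplex_skelSub n)
            (S.isSubcomplex_skelSub (n + 1))).A) :=
        Continuous.subtype_mk (Continuous.subtype_mk continuous_subtype_val _) _
      convert hcl'.isClosedMap _ (hC'.preimage hι) using 1
      ext x
      constructor
      · rintro ⟨⟨y, hy, rfl⟩, hx⟩
        exact ⟨⟨y.1, hx⟩, hy, rfl⟩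
      · rintro ⟨y, hy, rfl⟩
        exact ⟨⟨⟨y.1, S.skel_subset n y.2⟩, hy, rfl⟩, y.2⟩
    · have h1 : IsClosed {d : Disk n | (S.attach n).toFun ⟨i, OrbitProd.mk _ g d⟩ ∈ C} :=
        hC.preimage ((continuous_sigmaMk
          (σ := fun i : S.cell n => OrbitProd (S.stab n i) (Disk n))).comp
            (OrbitProd.continuous_mk g))
      convert h1 using 1
      ext d
      constructor
      · rintro ⟨y, hy, hyx⟩
        have : y = (S.attach n).toFun ⟨i, OrbitProd.mk _ g d⟩ := Subtype.ext hyx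
        rw [this] at hy
        exact hy
      · intro hd
        exact ⟨_, hd, rfl⟩

/-- Induction on the skeleta: the pair `(skel (n + 1), skel n)` is obtained by adjunction from a
disjoint union of disk pairs, along a map that is not assumed to be cellular. -/
theorem sub_skel {𝒞 : GCWPair G → Prop} (h𝒞 : IsLocalizing 𝒞)
    (h : ∀ L : Subgroup G, 𝒞 (OrbitProd.disk L 0)) (n : ℕ) :
    𝒞 (S.sub (S.skelSub n) (S.isSubcomplex_skelSub n)) := by
  induction n with
  | zero =>
    have : IsEmpty (S.sub (S.skelSub 0) (S.isSubcomplex_skelSub 0)).X :=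
      ⟨fun x : S.skelSub 0 => by
        have := x.2
        rw [mem_skelSub, S.skel_zero] at this
        exact this⟩
    exact IsLocalizing.of_isEmpty h𝒞 _
  | succ n ih =>
    refine sub_of_subPair h𝒞 _ _ (fun x hx => S.skel_subset n hx) ?_ ih
    exact h𝒞.of_isAdjunction _ (S.isAdjunction_attach n) (h𝒞.sigmaPair _
      (fun i => (OrbitProd.diskPair_mem _ h𝒞 (h _) n).1)
      fun i => OrbitProd.disk_mem _ h𝒞 (h _) n)

end GCWStructure
/-! ### The product of a `G`-CW-complex with the real line -/

namespace Disk

/-- `Dⁿ × [-1, 1]` is the unit ball of the maximum norm on `ℝⁿ × ℝ`. Its preimage under a linear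
identification with `ℝⁿ⁺¹` is a bounded convex body, hence homeomorphic to the round ball with
interiors corresponding. Prisms over cells thus become cells. -/
theorem exists_toPrism (n : ℕ) : ∃ q : C(Disk (n + 1), Disk n × ℝ), Function.Injective q ∧
    range q = {p | 0 ≤ p.2 ∧ p.2 ≤ 1} ∧
    ∀ e, ‖e.1‖ < 1 ↔ ‖(q e).1.1‖ < 1 ∧ 0 < (q e).2 ∧ (q e).2 < 1 := by
  let E := EuclideanSpace ℝ (Fin (n + 1))
  let F := EuclideanSpace ℝ (Fin n) × ℝ
  let l : E ≃L[ℝ] F := ContinuousLinearEquiv.ofFinrankEq (by simp [E, F])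
  let s : Set E := l ⁻¹' Metric.closedBall 0 1
  have hs : IsClosed s := Metric.isClosed_closedBall.preimage l.continuous
  have hi : interior s = l ⁻¹' Metric.ball 0 1 := by
    rw [← interior_closedBall (0 : F) one_ne_zero]
    exact (l.toHomeomorph.preimage_interior _).symm
  obtain ⟨h, h1, h2, -⟩ := exists_homeomorph_image_interior_closure_frontier_eq_unitBall
    (s := s) ((convex_closedBall (0 : F) 1).linear_preimage l.toLinearMap)
    ⟨0, by rw [hi]; simp⟩ (by
      have : s = l.symm '' Metric.closedBall 0 1 := by
        rw [l.symm.image_eq_preimage_symm]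
        rfl
      rw [this]
      exact l.symm.lipschitz.isBounded_image Metric.isBounded_closedBall)
  rw [hs.closure_eq] at h2
  have h3 : ∀ e : E, e ∈ Metric.closedBall (0 : E) 1 ↔ ‖l (h.symm e)‖ ≤ 1 := by
    intro e
    rw [← h2, h.image_eq_preimage_symm]
    exact mem_closedBall_zero_iff
  have h4 : ∀ e : E, ‖e‖ < 1 ↔ ‖l (h.symm e)‖ < 1 := by
    intro e
    rw [← mem_ball_zero_iff, ← h1, h.image_eq_preimage_symm, hi]
    exact mem_ball_zero_iff
  have hn : ∀ p : F, ‖p‖ = max ‖p.1‖ |p.2| := fun p => rfl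
  have h5 : ∀ e : Disk (n + 1), ‖(l (h.symm e.1)).1‖ ≤ 1 ∧ |(l (h.symm e.1)).2| ≤ 1 :=
    fun e => max_le_iff.1 (hn _ ▸ (h3 e.1).1 e.2)
  -- The affine map `t ↦ (t + 1) / 2` turns `[-1, 1]` into `[0, 1]`.
  refine ⟨⟨fun e => (⟨(l (h.symm e.1)).1, mem_closedBall_zero_iff.2 (h5 e).1⟩,
    ((l (h.symm e.1)).2 + 1) / 2), ?_⟩, ?_, ?_, ?_⟩
  · have : Continuous fun e : Disk (n + 1) => l (h.symm e.1) :=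
      l.continuous.comp (h.symm.continuous.comp continuous_subtype_val)
    exact (this.fst.subtype_mk _).prodMk ((this.snd.add continuous_const).div_const 2)
  · intro e e' he
    have he1 := congrArg (fun p => p.1.1) he
    have he2 := congrArg (fun p => p.2) he
    dsimp at he1 he2
    exact Subtype.ext (h.symm.injective (l.injective (Prod.ext he1 (by linarith))))
  · ext p
    constructor
    · rintro ⟨e, rfl⟩
      have := abs_le.1 (h5 e).2
      exact ⟨by dsimp; linarith, by dsimp; linarith⟩
    · rintro ⟨hp1, hp2⟩
      have h6 : ‖((p.1.1, 2 * p.2 - 1) : F)‖ ≤ 1 := by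
        rw [hn, max_le_iff, abs_le]
        exact ⟨p.1.norm_le_one, by linarith, by linarith⟩
      have h7 : l (h.symm (h (l.symm (p.1.1, 2 * p.2 - 1)))) = (p.1.1, 2 * p.2 - 1) := by
        rw [h.symm_apply_apply, l.apply_symm_apply]
      refine ⟨⟨h (l.symm (p.1.1, 2 * p.2 - 1)), (h3 _).2 (by rwa [h7])⟩, ?_⟩
      refine Prod.ext (Subtype.ext ?_) ?_
      · exact congrArg Prod.fst h7
      · change ((l (h.symm (h (l.symm (p.1.1, 2 * p.2 - 1))))).2 + 1) / 2 = p.2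
        rw [h7]
        ring
  · intro e
    rw [h4, hn, max_lt_iff, abs_lt]
    change _ ↔ _ ∧ 0 < ((l (h.symm e.1)).2 + 1) / 2 ∧ ((l (h.symm e.1)).2 + 1) / 2 < 1
    refine and_congr_right fun _ => ⟨fun h => ⟨by linarith, by linarith⟩,
      fun h => ⟨by linarith, by linarith⟩⟩

/-- A homeomorphism from the disk onto the product of a disk with the unit interval. -/
noncomputable def toPrism (n : ℕ) : C(Disk (n + 1), Disk n × ℝ) := (exists_toPrism n).choose

variable {n : ℕ}

theorem toPrism_injective : Function.Injective (toPrism n) := (exists_toPrism n).choose_spec.1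

theorem range_toPrism : range (toPrism n) = {p | 0 ≤ p.2 ∧ p.2 ≤ 1} :=
  (exists_toPrism n).choose_spec.2.1

theorem toPrism_mem (e : Disk (n + 1)) : 0 ≤ (toPrism n e).2 ∧ (toPrism n e).2 ≤ 1 :=
  (range_toPrism (n := n) ▸ mem_range_self e : toPrism n e ∈ {p | 0 ≤ p.2 ∧ p.2 ≤ 1})

theorem exists_toPrism_eq {d : Disk n} {t : ℝ} (h0 : 0 ≤ t) (h1 : t ≤ 1) :
    ∃ e, toPrism n e = (d, t) :=
  (range_toPrism (n := n) ▸ ⟨h0, h1⟩ : (d, t) ∈ range (toPrism n))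

theorem norm_lt_iff_toPrism {e : Disk (n + 1)} : ‖e.1‖ < 1 ↔
    ‖(toPrism n e).1.1‖ < 1 ∧ 0 < (toPrism n e).2 ∧ (toPrism n e).2 < 1 :=
  (exists_toPrism n).choose_spec.2.2 e

/-- Near a given point `f` is bounded, and only finitely many levels `l i` are within distance 1 of
a bounded range. With this, infinite unions of closed pieces lying over different parts of the real
line are closed. -/
theorem locallyFinite_of_le {Y : Type*} [TopologicalSpace Y] {f : Y → ℝ} (hf : Continuous f)
    {ι : Type*} (s : ι → Set Y) (l : ι → ℝ) (hl : ∀ a : ℝ, {i | |l i| ≤ a}.Finite)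
    (hs : ∀ i, ∀ y ∈ s i, |f y - l i| ≤ 1) : LocallyFinite s := by
  intro y
  refine ⟨{z | |f z - f y| < 1}, (isOpen_lt (by fun_prop) continuous_const).mem_nhds (by simp),
    (hl (|f y| + 2)).subset ?_⟩
  rintro i ⟨z, hz, hz'⟩
  have h1 := abs_le.1 (hs i z hz)
  have h2 := abs_lt.1 (show |f z - f y| < 1 from hz')
  refine (abs_le.2 ⟨?_, ?_⟩ : |l i| ≤ |f y| + 2)
  · linarith [neg_abs_le (f y)]
  · linarith [le_abs_self (f y)]

theorem finite_abs_int_le (a : ℝ) : {m : ℤ | |(m : ℝ)| ≤ a}.Finite := by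
  refine (finite_Icc (-⌈a⌉) ⌈a⌉).subset fun m hm => ?_
  have h := abs_le.1 (show |(m : ℝ)| ≤ a from hm)
  have ha := Int.le_ceil a
  constructor
  · exact_mod_cast (by push_cast; linarith : ((-⌈a⌉ : ℤ) : ℝ) ≤ m)
  · exact_mod_cast (by linarith : (m : ℝ) ≤ ⌈a⌉)

/-- A subset of `Disk n × ℝ` is closed if its intersections with all prisms are closed. -/
theorem isClosed_of_toPrism (C : Set (Disk n × ℝ))
    (h : ∀ m : ℤ, IsClosed {e | ((toPrism n e).1, m + (toPrism n e).2) ∈ C}) : IsClosed C := by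
  have e : C = ⋃ m : ℤ, (fun e => ((toPrism n e).1, m + (toPrism n e).2)) ''
      {e | ((toPrism n e).1, m + (toPrism n e).2) ∈ C} := by
    ext p
    simp only [mem_iUnion]
    constructor
    · intro hp
      obtain ⟨e, he⟩ := exists_toPrism_eq (d := p.1) (Int.fract_nonneg p.2)
        (Int.fract_lt_one p.2).le
      have : ((toPrism n e).1, (⌊p.2⌋ : ℝ) + (toPrism n e).2) = p := by
        rw [he]
        exact Prod.ext rfl (Int.floor_add_fract p.2)
      refine ⟨⌊p.2⌋, e, ?_, this⟩
      change ((toPrism n e).1, (⌊p.2⌋ : ℝ) + (toPrism n e).2) ∈ C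
      rwa [this]
    · rintro ⟨m, e, he, rfl⟩
      exact he
  rw [e]
  refine LocallyFinite.isClosed_iUnion ?_ fun m => ?_
  · refine locallyFinite_of_le continuous_snd _ (fun m => (m : ℝ)) finite_abs_int_le ?_
    rintro m _ ⟨e, -, rfl⟩
    have := toPrism_mem e
    rw [abs_le]
    constructor <;> dsimp only <;> linarith
  · exact ((h m).isCompact.image (by fun_prop)).isClosed

end Disk

/-- The product of a `G`-space with the real line. -/
def Cyl (X : Type u) : Type u := X × ℝ

namespace Cyl

instance {X : Type u} [TopologicalSpace X] : TopologicalSpace (Cyl X) :=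
  inferInstanceAs (TopologicalSpace (X × ℝ))

variable {G : Type u} [Group G] {X : Type u} [MulAction G X]

instance : MulAction G (Cyl X) where
  smul g p := (g • p.1, p.2)
  one_smul p := Prod.ext (one_smul G p.1) rfl
  mul_smul a b p := Prod.ext (mul_smul a b p.1) rfl

variable [TopologicalSpace X]

instance [ContinuousConstSMul G X] : ContinuousConstSMul G (Cyl X) where
  continuous_const_smul g :=
    (continuous_fst.const_smul g).prodMk (continuous_snd (X := X) (Y := ℝ))

/-- The cells of the product with the real line. -/
inductive Cell (S : GCWStructure G X) : ℕ → Type u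
  | vert (n : ℕ) (i : S.cell n) (m : ℤ) : Cell S n
  | edge (n : ℕ) (i : S.cell n) (m : ℤ) : Cell S (n + 1)

variable (S : GCWStructure G X)

/-- The isotropy groups of the cells. -/
def Cell.stab {S : GCWStructure G X} : ∀ {n}, Cell S n → Subgroup G
  | _, .vert n i _ => S.stab n i
  | _, .edge n i _ => S.stab n i

/-- The characteristic maps of the cells. -/
noncomputable def Cell.map {S : GCWStructure G X} : ∀ {n}, Cell S n → C(Disk n, Cyl X)
  | _, .vert n i m => ⟨fun d => (S.map n i d, (m : ℝ)),
      (S.map n i).continuous.prodMk continuous_const⟩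
  | _, .edge n i m => ⟨fun e => (S.map n i (Disk.toPrism n e).1, m + (Disk.toPrism n e).2),
      ((S.map n i).continuous.comp (Disk.toPrism n).continuous.fst).prodMk
        (continuous_const.add (Disk.toPrism n).continuous.snd)⟩

/-- The skeleta of the product with the real line. -/
def skel (n : ℕ) : Set (Cyl X) :=
  -- Cells times integer points keep their dimension, while cells times unit intervals gain one. For
  -- `n = 0` the truncated `n - 1` does no harm, since `S.skel 0` is empty.
  {p | (p.1 ∈ S.skel n ∧ ∃ m : ℤ, p.2 = m) ∨ p.1 ∈ S.skel (n - 1)}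

theorem fst_mem_of_mem_skel {S : GCWStructure G X} {n : ℕ} {p : Cyl X} (h : p ∈ skel S n) :
    p.1 ∈ S.skel n :=
  h.elim And.left fun h => S.skel_mono (Nat.sub_le n 1) h

theorem Cell.map_inj {S : GCWStructure G X} {n : ℕ} {i j : Cell S n} {g : G} {d d' : Disk n}
    (hd : ‖d.1‖ < 1) (hd' : ‖d'.1‖ < 1) (h : g • i.map d = j.map d') :
    i = j ∧ d = d' ∧ g ∈ i.stab := by
  -- No integer lies strictly between two consecutive ones, so open cells of the two kinds are
  -- disjoint.
  have hint : ∀ (m m' : ℤ) (b : ℝ), 0 < b → b < 1 → (m : ℝ) ≠ m' + b := by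
    intro m m' b hb hb' e
    have h1 : (m' : ℝ) < m := by linarith
    have h2 : (m : ℝ) < m' + 1 := by linarith
    have h1' : m' < m := by exact_mod_cast h1
    have h2' : m < m' + 1 := by exact_mod_cast h2
    omega
  cases i with
  | vert n i m =>
    cases j with
    | vert _ j m' =>
      have e1 : g • S.map n i d = S.map n j d' := congrArg Prod.fst h
      have e2 : (m : ℝ) = m' := congrArg Prod.snd h
      obtain ⟨rfl, h2, h3⟩ := S.map_interior_inj n i j g d d' hd hd' e1
      obtain rfl : m = m' := by exact_mod_cast e2
      exact ⟨rfl, h2, h3⟩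
    | edge n j m' =>
      obtain ⟨-, h2, h3⟩ := Disk.norm_lt_iff_toPrism.1 hd'
      have e2 : (m : ℝ) = m' + (Disk.toPrism n d').2 := congrArg Prod.snd h
      exact (hint _ _ _ h2 h3 e2).elim
  | edge n i m =>
    obtain ⟨h1, h2, h3⟩ := Disk.norm_lt_iff_toPrism.1 hd
    cases j with
    | vert _ j m' =>
      have e2 : (m : ℝ) + (Disk.toPrism n d).2 = m' := congrArg Prod.snd h
      exact (hint _ _ _ h2 h3 e2.symm).elim
    | edge _ j m' =>
      obtain ⟨h1', h2', h3'⟩ := Disk.norm_lt_iff_toPrism.1 hd'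
      have e1 : g • S.map n i (Disk.toPrism n d).1 = S.map n j (Disk.toPrism n d').1 :=
        congrArg Prod.fst h
      have e2 : (m : ℝ) + (Disk.toPrism n d).2 = m' + (Disk.toPrism n d').2 :=
        congrArg Prod.snd h
      obtain ⟨rfl, h4, h5⟩ := S.map_interior_inj n i j g _ _ h1 h1' e1
      obtain rfl : m = m' := by
        have h6 : (m : ℝ) < m' + 1 := by linarith
        have h7 : (m' : ℝ) < m + 1 := by linarith
        have h6' : m < m' + 1 := by exact_mod_cast h6
        have h7' : m' < m + 1 := by exact_mod_cast h7
        omega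
      exact ⟨rfl, Disk.toPrism_injective (Prod.ext h4 (by linarith)), h5⟩

/-- A subset of the product is closed if it is closed in the prisms. -/
theorem isClosed_prisms (S : GCWStructure G X) {n : ℕ} {i : S.cell n} {g : G} (C : Set (Cyl X))
    (h : ∀ m : ℤ, IsClosed {e | g • (Cell.edge (S := S) n i m).map e ∈ C}) :
    IsClosed {p : Disk n × ℝ | ((g • S.map n i p.1, p.2) : Cyl X) ∈ C} :=
  Disk.isClosed_of_toPrism _ h

/-- The integer levels are a locally finite family of closed subsets of the line. -/
theorem isClosed_slices (C : Set (Cyl X))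
    (h : ∀ m : ℤ, IsClosed {x : X | ((x, (m : ℝ)) : Cyl X) ∈ C}) :
    IsClosed (C ∩ {p : Cyl X | ∃ m : ℤ, p.2 = m}) := by
  have e : C ∩ {p : Cyl X | ∃ m : ℤ, p.2 = m} = ⋃ m : ℤ,
      {p : X × ℝ | p.1 ∈ {x : X | ((x, (m : ℝ)) : Cyl X) ∈ C}} ∩ {p : X × ℝ | p.2 = m} := by
    ext ⟨x, t⟩
    refine Iff.trans ?_ mem_iUnion.symm
    constructor
    · rintro ⟨hp, m, hm⟩
      change t = m at hm
      subst hm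
      exact ⟨m, hp, rfl⟩
    · rintro ⟨m, hp, hm⟩
      change t = m at hm
      subst hm
      exact ⟨hp, m, rfl⟩
  rw [e]
  refine LocallyFinite.isClosed_iUnion (X := X × ℝ) ?_ fun m =>
    ((h m).preimage continuous_fst).inter (isClosed_eq continuous_snd continuous_const)
  refine Disk.locallyFinite_of_le continuous_snd _ (fun m : ℤ => (m : ℝ))
    Disk.finite_abs_int_le ?_
  rintro m p ⟨-, hp⟩
  rw [show p.2 = m from hp]
  simp

/-- The `G`-CW-structure on the product with the real line. -/
noncomputable def structure_ [ContinuousConstSMul G X] : GCWStructure G (Cyl X) where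
  skel := skel S
  skel_zero := by
    ext p
    refine iff_of_false (fun h => ?_) id
    have := fst_mem_of_mem_skel h
    rw [S.skel_zero] at this
    exact this
  skel_subset n p hp := by
    by_cases h : ∃ m : ℤ, p.2 = m
    · exact Or.inl ⟨S.skel_subset n (fst_mem_of_mem_skel hp), h⟩
    · exact Or.inr (fst_mem_of_mem_skel hp)
  iUnion_skel := by
    refine eq_univ_of_forall fun p => mem_iUnion.2 ?_
    obtain ⟨n, hn⟩ := S.exists_mem_skel p.1
    exact ⟨n + 1, Or.inr hn⟩
  smul_mem_skel n g p hp := hp.imp (fun h => ⟨S.smul_mem_skel n g _ h.1, h.2⟩)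
    fun h => S.smul_mem_skel _ g _ h
  isClosed_of_skel C hC := by
    refine (S.isClosed_prod_iff_cells C).2 fun n i g => isClosed_prisms S C fun m => ?_
    convert (hC (n + 2)).preimage (((Cell.edge (S := S) n i m).map).continuous.const_smul g)
      using 1
    ext e
    exact (and_iff_left (Or.inr (S.smul_mem_skel _ g _ (S.map_mem n i _)))).symm
  cell := Cell S
  stab _ i := i.stab
  map _ i := i.map
  smul_map n i g hg d := by
    cases i with
    | vert n i m => exact Prod.ext (S.smul_map n i g hg d) rfl
    | edge n i m => exact Prod.ext (S.smul_map n i g hg _) rfl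
  map_mem n i d := by
    cases i with
    | vert n i m => exact Or.inl ⟨S.map_mem n i d, m, rfl⟩
    | edge n i m => exact Or.inr (S.map_mem n i _)
  map_boundary n i d hd := by
    cases i with
    | vert n i m => exact Or.inl ⟨S.map_boundary n i d hd, m, rfl⟩
    | edge n i m =>
      by_cases h1 : ‖(Disk.toPrism n d).1.1‖ < 1
      · refine Or.inl ⟨S.map_mem n i _, ?_⟩
        have h2 := mt Disk.norm_lt_iff_toPrism.2 hd.not_lt
        have h3 := Disk.toPrism_mem d
        by_cases h4 : 0 < (Disk.toPrism n d).2
        · have h5 : (Disk.toPrism n d).2 = 1 :=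
            le_antisymm h3.2 (not_lt.1 fun h5 => h2 ⟨h1, h4, h5⟩)
          refine ⟨m + 1, ?_⟩
          change (m : ℝ) + (Disk.toPrism n d).2 = _
          rw [h5]
          push_cast
          rfl
        · have h5 : (Disk.toPrism n d).2 = 0 := le_antisymm (not_lt.1 h4) h3.1
          refine ⟨m, ?_⟩
          change (m : ℝ) + (Disk.toPrism n d).2 = _
          rw [h5, add_zero]
      · exact Or.inr (S.map_boundary n i _
          (le_antisymm (Disk.norm_le_one _) (not_lt.1 h1)))
  map_interior_notMem n i d hd h := by
    cases i with
    | vert n i m => exact S.map_interior_notMem n i d hd (fst_mem_of_mem_skel h)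
    | edge n i m =>
      obtain ⟨h1, h2, h3⟩ := Disk.norm_lt_iff_toPrism.1 hd
      rcases h with ⟨-, m', h⟩ | h
      · change (m : ℝ) + (Disk.toPrism n d).2 = m' at h
        have h4 : (m : ℝ) < m' := by linarith
        have h5 : (m' : ℝ) < m + 1 := by linarith
        have h4' : m < m' := by exact_mod_cast h4
        have h5' : m' < m + 1 := by exact_mod_cast h5
        omega
      · exact S.map_interior_notMem n i _ h1 h
  map_interior_inj n i j g d d' hd hd' h := Cell.map_inj hd hd' h
  exists_cell n p hp hp' := by
    by_cases h : ∃ m : ℤ, p.2 = m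
    · obtain ⟨i, g, d, hd, hx⟩ := S.exists_cell n p.1 (fst_mem_of_mem_skel hp)
        fun h' => hp' (Or.inl ⟨h', h⟩)
      obtain ⟨m, hm⟩ := h
      exact ⟨.vert n i m, g, d, hd, Prod.ext hx hm.symm⟩
    · have h1 : p.1 ∈ S.skel n := hp.resolve_left fun h' => h h'.2
      have h2 : p.1 ∉ S.skel (n - 1) := fun h' => hp' (Or.inr h')
      cases n with
      | zero => exact (h2 h1).elim
      | succ n =>
        obtain ⟨i, g, d, hd, hx⟩ := S.exists_cell n p.1 h1 h2
        obtain ⟨e, he⟩ := Disk.exists_toPrism_eq (d := d) (Int.fract_nonneg p.2)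
          (Int.fract_lt_one p.2).le
        refine ⟨.edge n i ⌊p.2⌋, g, e, Disk.norm_lt_iff_toPrism.2 ?_, Prod.ext ?_ ?_⟩
        · rw [he]
          refine ⟨hd, (Int.fract_nonneg p.2).lt_of_ne fun h' => h ⟨⌊p.2⌋, ?_⟩,
            Int.fract_lt_one p.2⟩
          have := Int.floor_add_fract p.2
          rw [← h', add_zero] at this
          exact this.symm
        · change g • S.map n i (Disk.toPrism n e).1 = p.1
          rw [he, hx]
        · change (⌊p.2⌋ : ℝ) + (Disk.toPrism n e).2 = p.2
          rw [he]
          exact Int.floor_add_fract p.2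
  isClosed_of_cells n C hC h0 h1 := by
    -- A subset of the next skeleton is the union of its part at integer levels, tested on the cells
    -- `vert`, and its part over `S.skel n`, tested on the prisms over the cells of dimension `n -
    -- 1`.
    have c1 : IsClosed (C ∩ {p : Cyl X | ∃ m : ℤ, p.2 = m}) := by
      refine isClosed_slices C fun m => S.isClosed_of_cells n _
        (fun x hx => fst_mem_of_mem_skel (hC hx)) ?_ fun i g => h1 (.vert n i m) g
      convert h0.preimage (f := fun x : X => ((x, (m : ℝ)) : Cyl X))
        (continuous_id.prodMk continuous_const) using 1
      ext x
      exact and_congr_right fun _ => ⟨fun h => Or.inl ⟨h, m, rfl⟩, fst_mem_of_mem_skel⟩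
    have c2 : IsClosed (C ∩ {p : Cyl X | p.1 ∈ S.skel n}) := by
      cases n with
      | zero => simp [S.skel_zero]
      | succ n =>
        refine S.isClosed_prod_of_cells n _ inter_subset_right ?_ fun i g => ?_
        · refine (congrArg IsClosed (Set.ext fun (p : X × ℝ) => ?_)).mpr
            (h0.inter ((S.isClosed_skel n).preimage (continuous_fst (X := X) (Y := ℝ))))
          constructor
          · rintro ⟨h, h'⟩
            exact ⟨⟨h.1, Or.inr h'⟩, h'⟩
          · rintro ⟨h, h'⟩
            exact ⟨⟨h.1, S.skel_subset n h'⟩, h'⟩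
        · refine isClosed_prisms S _ fun m => ?_
          convert h1 (.edge n i m) g using 1
          ext e
          exact and_iff_left (S.smul_mem_skel _ g _ (S.map_mem n i _))
    convert c1.union c2 using 1
    ext p
    constructor
    · intro hp
      rcases hC hp with h | h
      · exact Or.inl ⟨hp, h.2⟩
      · exact Or.inr ⟨hp, h⟩
    · rintro (h | h)
      exacts [h.1, h.1]

/-! ### The mapping telescope -/

/-- The subspace of the product consisting of the `skel (a k) × [l k, r k]`. -/
def strip (a l r : ℕ → ℕ) : SubMulAction G (Cyl X) where
  carrier := {p | ∃ k, p.1 ∈ S.skel (a k) ∧ (l k : ℝ) ≤ p.2 ∧ p.2 ≤ r k}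
  smul_mem' := by
    rintro g p ⟨k, h1, h2⟩
    exact ⟨k, S.smul_mem_skel _ g _ h1, h2⟩

variable [ContinuousConstSMul G X] {S}

/-- The ends of the intervals are integers, so a unit interval whose interior meets `[l k, r k]` is
contained in it. -/
theorem isSubcomplex_strip (a l r : ℕ → ℕ) : (structure_ S).IsSubcomplex (strip S a l r) := by
  rintro n i d hd ⟨k, h1, h2, h3⟩ d'
  cases i with
  | vert n i m => exact ⟨k, S.isSubcomplex_skelSub _ n i d hd h1 d', h2, h3⟩
  | edge n i m =>
    obtain ⟨h4, h5, h6⟩ := Disk.norm_lt_iff_toPrism.1 hd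
    change (l k : ℝ) ≤ m + (Disk.toPrism n d).2 at h2
    change (m : ℝ) + (Disk.toPrism n d).2 ≤ r k at h3
    have h2' : ((l k : ℤ) : ℝ) < m + 1 := by push_cast; linarith
    have h3' : (m : ℝ) < (r k : ℤ) := by push_cast; linarith
    have h2'' : (l k : ℤ) < m + 1 := by exact_mod_cast h2'
    have h3'' : m < (r k : ℤ) := by exact_mod_cast h3'
    have h2 : ((l k : ℤ) : ℝ) ≤ m := by exact_mod_cast Int.lt_add_one_iff.1 h2''
    have h3 : (m : ℝ) + 1 ≤ (r k : ℤ) := by exact_mod_cast h3''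
    have h7 := Disk.toPrism_mem d'
    push_cast at h2 h3
    refine ⟨k, S.isSubcomplex_skelSub _ n i _ h4 h1 _, ?_, ?_⟩
    · change (l k : ℝ) ≤ m + (Disk.toPrism n d').2
      linarith
    · change (m : ℝ) + (Disk.toPrism n d').2 ≤ r k
      linarith

variable {𝒞 : GCWPair G → Prop} (h𝒞 : IsLocalizing 𝒞)
  (hskel : ∀ n, 𝒞 (S.sub (S.skelSub n) (S.isSubcomplex_skelSub n)))
include h𝒞 hskel

/-- A strip consisting of disjoint pieces. -/
theorem sub_strip (a l r : ℕ → ℕ) (hlr : ∀ k, l k ≤ r k) (hrl : ∀ k, r k < l (k + 1))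
    (hr : ∀ k, r k ≤ l k + 1) :
    𝒞 ((structure_ S).sub (strip S a l r) (isSubcomplex_strip a l r)) := by
  have hl : StrictMono l := strictMono_nat_of_lt_succ fun k => (hlr k).trans_lt (hrl k)
  have huniq : ∀ (t : ℝ) j k, j < k → t ≤ r j → ¬ (l k : ℝ) ≤ t := by
    intro t j k hjk h1 h2
    have h3 : (l k : ℝ) ≤ r j := h2.trans h1
    have h4 : l k ≤ r j := by exact_mod_cast h3
    have h5 : l (j + 1) ≤ l k := hl.monotone hjk
    have := hrl j
    omega
  have huniq' : ∀ (t : ℝ) j k, (l j : ℝ) ≤ t → t ≤ r j → (l k : ℝ) ≤ t → t ≤ r k → j = k := by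
    intro t j k h1 h2 h3 h4
    rcases lt_trichotomy j k with h | h | h
    · exact (huniq t j k h h2 h3).elim
    · exact h
    · exact (huniq t k j h h4 h1).elim
  have hch : ∀ p : strip S a l r, ∃ k, p.1.1 ∈ S.skel (a k) ∧ (l k : ℝ) ≤ p.1.2 ∧ p.1.2 ≤ r k :=
    fun p => p.2
  -- `κ p` is the index of the piece containing `p`. The pieces are separated by the real
  -- coordinate, so `κ` depends on that coordinate only and is invariant under `G`.
  choose κ h1 h2 h3 using hch
  have hκ : ∀ (p q : strip S a l r), p.1.2 = q.1.2 → κ p = κ q := fun p q h =>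
    huniq' p.1.2 _ _ (h2 p) (h3 p) (h ▸ h2 q) (h ▸ h3 q)
  -- Every piece is pushed linearly to its left end: `f` forgets the real coordinate and `g` inserts
  -- `l k`.
  let f : strip S a l r → Σ k : ULift.{u} ℕ, S.skelSub (a k.down) := fun p =>
    ⟨⟨κ p⟩, ⟨p.1.1, h1 p⟩⟩
  let g : (Σ k : ULift.{u} ℕ, S.skelSub (a k.down)) → strip S a l r := fun q =>
    ⟨(q.2.1, (l q.1.down : ℝ)), q.1.down, q.2.2, le_rfl, Nat.cast_le.2 (hlr _)⟩
  have hg : Continuous g := by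
    refine Continuous.subtype_mk (continuous_sigma fun k => ?_) _
    exact continuous_subtype_val.prodMk (continuous_const (y := (l k.down : ℝ)))
  have hfst : Continuous fun p : strip S a l r => p.1.1 :=
    (continuous_fst (X := X) (Y := ℝ)).comp continuous_subtype_val
  have hsnd : Continuous fun p : strip S a l r => p.1.2 :=
    (continuous_snd (X := X) (Y := ℝ)).comp continuous_subtype_val
  have hf : Continuous f := by
    rw [continuous_iff_isClosed]
    intro C hC
    have e : f ⁻¹' C = ⋃ k : ℕ, {p : strip S a l r |
        p.1.1 ∈ Subtype.val '' {x : S.skelSub (a k) | (⟨⟨k⟩, x⟩ :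
          Σ k : ULift.{u} ℕ, S.skelSub (a k.down)) ∈ C}} ∩
        {p | (l k : ℝ) ≤ p.1.2 ∧ p.1.2 ≤ r k} := by
      ext p
      rw [mem_iUnion]
      constructor
      · exact fun hp => ⟨κ p, ⟨_, hp, rfl⟩, h2 p, h3 p⟩
      · rintro ⟨k, ⟨x, hx, hxp⟩, hk1, hk2⟩
        obtain rfl := huniq' _ _ _ (h2 p) (h3 p) hk1 hk2
        have : x = ⟨p.1.1, h1 p⟩ := Subtype.ext hxp
        rw [this] at hx
        exact hx
    rw [e]
    refine LocallyFinite.isClosed_iUnion ?_ fun k => ?_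
    · refine Disk.locallyFinite_of_le hsnd _ (fun k => (l k : ℝ)) (fun b => ?_) ?_
      · refine (finite_Iic ⌊b⌋₊).subset fun k hk => ?_
        have hk' : (l k : ℝ) ≤ b := (le_abs_self _).trans hk
        exact (hl.le_apply (x := k)).trans (Nat.le_floor hk')
      · rintro k p ⟨-, hk1, hk2⟩
        have : (r k : ℝ) ≤ l k + 1 := by exact_mod_cast hr k
        rw [abs_le]
        constructor <;> linarith
    · have hcl := (S.isClosed_subcomplex _ (S.isSubcomplex_skelSub (a k))).isClosedEmbedding_subtypeVal
      exact ((hcl.isClosedMap _ (hC.preimage continuous_sigmaMk)).preimage hfst).inter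
        ((isClosed_le continuous_const hsnd).inter (isClosed_le hsnd continuous_const))
  refine h𝒞.retract (Q := GCWPair.coprod (fun k : ULift.{u} ℕ => S.skelSub (a k.down)) fun k =>
      ⟨S.restrict _ (S.isSubcomplex_skelSub _)⟩)
    (ofMap (X := strip S a l r) (Y := Σ k : ULift.{u} ℕ, S.skelSub (a k.down)) f hf
      fun k p => ?_)
    (ofMap (Y := strip S a l r) (X := Σ k : ULift.{u} ℕ, S.skelSub (a k.down)) g hg
      fun _ _ => rfl) ⟨fun q : strip S a l r × unitInterval =>
        (⟨(q.1.1.1, (1 - q.2.1) * l (κ q.1) + q.2.1 * q.1.1.2), κ q.1, h1 q.1, ?_, ?_⟩ :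
          strip S a l r), ?_, fun k p t => ?_, fun _ h => h.elim, fun p : strip S a l r => ?_,
          fun p : strip S a l r => ?_⟩ (h𝒞.coprod _ _ fun k => hskel _)
  · have e : κ (k • p) = κ p := hκ _ _ rfl
    refine Sigma.ext (congrArg ULift.up e) ?_
    change HEq (⟨k • p.1.1, h1 (k • p)⟩ : S.skelSub (a (κ (k • p))))
      (⟨k • p.1.1, (S.skelSub _).smul_mem k (h1 p)⟩ : S.skelSub (a (κ p)))
    have : ∀ m (hm : m = κ p) (h : k • p.1.1 ∈ S.skelSub (a m)),
      HEq (⟨k • p.1.1, h⟩ : S.skelSub (a m))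
        (⟨k • p.1.1, (S.skelSub _).smul_mem k (h1 p)⟩ : S.skelSub (a (κ p))) := by
      rintro _ rfl _
      rfl
    exact this _ e _
  · have ht := q.2.2.1
    have := mul_le_mul_of_nonneg_left (h2 q.1) ht
    dsimp only
    linarith
  · have ht := q.2.2
    have e1 := mul_le_mul_of_nonneg_left (h3 q.1) ht.1
    have e2 : (l (κ q.1) : ℝ) ≤ r (κ q.1) := by exact_mod_cast hlr _
    have e3 := mul_le_mul_of_nonneg_left e2 (sub_nonneg.2 ht.2)
    dsimp only
    linarith
  · refine Continuous.subtype_mk ((hfst.comp continuous_fst).prodMk ?_) _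
    -- `l (κ p)` is the real coordinate of `g (f p)`, so its continuity follows from that of `f` and
    -- `g`.
    have hlκ : Continuous fun p : strip S a l r => (l (κ p) : ℝ) := hsnd.comp (hg.comp hf)
    have c1 := hlκ.comp (continuous_fst (X := strip S a l r) (Y := unitInterval))
    have c2 := hsnd.comp (continuous_fst (X := strip S a l r) (Y := unitInterval))
    have c3 : Continuous fun q : strip S a l r × unitInterval => q.2.1 := by fun_prop
    exact ((continuous_const.sub c3).mul c1).add (c3.mul c2)
  · refine Subtype.ext (Prod.ext rfl ?_)
    change (1 - t.1) * (l (κ (k • p)) : ℝ) + _ = _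
    rw [hκ (k • p) p rfl]
    rfl
  · refine Subtype.ext (Prod.ext rfl ?_)
    change (1 - (0 : ℝ)) * l (κ p) + 0 * p.1.2 = l (κ p)
    ring
  · refine Subtype.ext (Prod.ext rfl ?_)
    change (1 - (1 : ℝ)) * l (κ p) + 1 * p.1.2 = p.1.2
    ring

/-- The intervals `[k, k + 1]` with `k` even are pairwise disjoint, and so are those with `k` odd.
The two resulting subcomplexes meet at the levels `k + 1`, where the intersection is the smaller
skeleton `skel k`. All three consist of disjoint pieces, so Mayer-Vietoris applies. -/
theorem sub_telescope :
    𝒞 ((structure_ S).sub (strip S (fun k => k) (fun k => k) fun k => k + 1)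
      (isSubcomplex_strip _ _ _)) := by
  refine GCWStructure.sub_union h𝒞
    (isSubcomplex_strip (fun k => 2 * k) (fun k => 2 * k) fun k => 2 * k + 1)
    (isSubcomplex_strip (fun k => 2 * k + 1) (fun k => 2 * k + 1) fun k => 2 * k + 2)
    (isSubcomplex_strip (fun k => k) (fun k => k + 1) fun k => k + 1) _ ?_ ?_
    (sub_strip h𝒞 hskel _ _ _ (fun k => by omega) (fun k => by omega) fun k => by omega)
    (sub_strip h𝒞 hskel _ _ _ (fun k => by omega) (fun k => by omega) fun k => by omega)
    (sub_strip h𝒞 hskel _ _ _ (fun k => by omega) (fun k => by omega) fun k => by omega)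
  · intro p
    constructor
    · rintro ⟨k, hk, hk1, hk2⟩
      have ht : p.2 = (k + 1 : ℕ) := le_antisymm hk2 hk1
      rcases Nat.even_or_odd' k with ⟨j, rfl | rfl⟩
      · refine ⟨⟨j, hk, ?_, ht.le⟩, j, S.skel_mono (by dsimp only; omega) hk, ht.ge, ?_⟩ <;>
          rw [ht] <;> dsimp only <;> exact_mod_cast (by omega)
      · refine ⟨⟨j + 1, S.skel_mono (by dsimp only; omega) hk, ?_, ?_⟩, j, hk, ?_, ?_⟩ <;>
          rw [ht] <;> dsimp only <;> exact_mod_cast (by omega)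
    · rintro ⟨⟨j, hj, hj1, hj2⟩, k, hk, hk1, hk2⟩
      dsimp only at hj hj1 hj2 hk hk1 hk2
      have e1 : ((2 * j : ℕ) : ℝ) ≤ (2 * k + 2 : ℕ) := hj1.trans hk2
      have e2 : ((2 * k + 1 : ℕ) : ℝ) ≤ (2 * j + 1 : ℕ) := hk1.trans hj2
      have e1' : 2 * j ≤ 2 * k + 2 := by exact_mod_cast e1
      have e2' : 2 * k + 1 ≤ 2 * j + 1 := by exact_mod_cast e2
      obtain rfl | rfl : j = k ∨ j = k + 1 := by omega
      · exact ⟨2 * j, hj, hk1, hj2⟩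
      · exact ⟨2 * k + 1, hk, hj1, hk2⟩
  · intro p
    constructor
    · rintro ⟨k, hk, hk1, hk2⟩
      rcases Nat.even_or_odd' k with ⟨j, rfl | rfl⟩
      · exact Or.inl ⟨j, hk, hk1, hk2⟩
      · exact Or.inr ⟨j, hk, hk1, hk2⟩
    · rintro (⟨k, hk, hk1, hk2⟩ | ⟨k, hk, hk1, hk2⟩)
      · exact ⟨2 * k, hk, hk1, hk2⟩
      · exact ⟨2 * k + 1, hk, hk1, hk2⟩

end Cyl

/-- A localizing class which contains all orbits contains all `G`-CW-complexes. -/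
theorem IsLocalizing.ofComplex_mem {G : Type u} [Group G] {𝒞 : GCWPair G → Prop}
    (h𝒞 : IsLocalizing 𝒞) (h : ∀ L : Subgroup G, 𝒞 ((indFunctor L.subtype).obj (point L)))
    (X : Type u) [TopologicalSpace X] [MulAction G X] [ContinuousConstSMul G X]
    (hX : IsGCWComplex G X) : 𝒞 (ofComplex X hX) := by
  -- `G / L × Disk 0` and `G ×_L {•}` are two models of the same orbit.
  have hdisk : ∀ L : Subgroup G, 𝒞 (OrbitProd.disk L 0) := by
    intro L
    refine h𝒞.retract_of_eq
      (Hom.mk (P := OrbitProd.disk L 0) (Q := (indFunctor L.subtype).obj (point L))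
        (OrbitProd.lift (fun g _ => Ind.mk L.subtype g PUnit.unit)
          fun g l hl _ => Ind.mk_mul (α := L.subtype) g ⟨l, hl⟩ PUnit.unit)
        (OrbitProd.continuous_lift _ _ fun g => continuous_const)
        (fun g (p : OrbitProd L (Disk 0)) => ?_) fun _ hx => hx.elim)
      (Hom.mk (Q := OrbitProd.disk L 0) (P := (indFunctor L.subtype).obj (point L))
        (Ind.lift (X := PUnit) (fun g _ => OrbitProd.mk L g (⟨0, by simp⟩ : Disk 0))
          fun g l _ => OrbitProd.mk_eq_mk.2 ⟨by simp, rfl⟩)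
        (Ind.continuous_lift (X := PUnit) _ _ fun g => continuous_const)
        (fun g => Ind.ind fun k x => rfl) fun x hx => ?_)
      (fun p : OrbitProd L (Disk 0) => ?_) (h L)
    · obtain ⟨k, d, rfl⟩ := OrbitProd.exists_mk p
      rfl
    · rw [indObj_point_A] at hx
      exact hx.elim
    · obtain ⟨k, d, rfl⟩ := OrbitProd.exists_mk p
      exact OrbitProd.mk_eq_mk.2 ⟨by simp, Subtype.ext (Subsingleton.elim _ _)⟩
  obtain ⟨S⟩ := hX
  obtain ⟨Φ, τ, h1, h2, h3, h4, h5, h6, h7⟩ := S.exists_flow_height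
  have hI : (1 / 2 : ℝ) ∈ Icc (1 / 2 : ℝ) 1 := ⟨le_rfl, by norm_num⟩
  have hc : ∀ {Y : Type u} [TopologicalSpace Y] (f : Y → X) (s : Y → ℝ), Continuous f →
      Continuous s → (∀ y, s y ∈ Icc (1 / 2 : ℝ) 1) → Continuous fun y => Φ (f y) (s y) :=
    fun f s hf hs hs' => continuousOn_univ.1 (h1.comp (f := fun y => (f y, s y))
      (hf.prodMk hs).continuousOn fun y _ => ⟨trivial, hs' y⟩)
  -- `X` is a homotopy retract of the telescope. The point `(Φ x (1 / 2), τ x)` lies in the piece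
  -- with index `k = ⌊τ x⌋`, because `τ x < k + 1` forces `Φ x (1 / 2)` into `skel k`. Projecting
  -- back gives `Φ x (1 / 2)`, and running the flow parameter from `1 / 2` to 1 is a homotopy to the
  -- identity.
  refine h𝒞.retract
    (ofMap (Y := Cyl.strip S (fun k => k) (fun k => k) fun k => k + 1)
      (hY := ⟨(Cyl.structure_ S).restrict _ (Cyl.isSubcomplex_strip _ _ _)⟩)
      (fun x => ⟨(Φ x (1 / 2), τ x), ⌊τ x⌋₊, h7 _ x (Nat.lt_floor_add_one _),
        Nat.floor_le (h6 x), ?_⟩) ?_ fun g x => ?_)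
    (ofMap (X := Cyl.strip S (fun k => k) (fun k => k) fun k => k + 1) (fun p => p.1.1)
      ((continuous_fst (X := X) (Y := ℝ)).comp continuous_subtype_val) fun _ _ => rfl)
    ⟨fun p : X × unitInterval => Φ p.1 ((1 + p.2.1) / 2), ?_, fun g (x : X) t => h2 g x _ ?_,
      fun _ h => h.elim, fun x : X => ?_, fun x : X => ?_⟩
    (Cyl.sub_telescope h𝒞 (S.sub_skel h𝒞 hdisk))
  · push_cast
    exact (Nat.lt_floor_add_one _).le
  · exact Continuous.subtype_mk ((hc id (fun _ => 1 / 2) continuous_id continuous_const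
      fun _ => hI).prodMk h4) _
  · exact Subtype.ext (Prod.ext (h2 g x _ hI) (h5 g x))
  · refine hc (fun p : X × unitInterval => p.1) (fun p => (1 + p.2.1) / 2) (by fun_prop)
      (by fun_prop) fun p => ⟨?_, ?_⟩ <;> linarith [p.2.2.1, p.2.2.2]
  · constructor <;> linarith [t.2.1, t.2.2]
  · change Φ x ((1 + 0) / 2) = Φ x (1 / 2)
    rw [add_zero]
  · change Φ x ((1 + 1) / 2) = x
    norm_num [h3]

/-! ### Maps that are equivariant along a group homomorphism -/

/-- A map of pairs which is equivariant along a group homomorphism. -/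
structure SemiHom {H K : Type u} [Group H] [Group K] (α : H →* K) (P : GCWPair H)
    (Q : GCWPair K) where
  toFun : P.X → Q.X
  continuous_toFun : Continuous toFun
  map_smul : ∀ (h : H) (x : P.X), toFun (h • x) = α h • toFun x
  map_mem : ∀ x ∈ P.A, toFun x ∈ Q.A

namespace SemiHom

variable {H K : Type u} [Group H] [Group K] {α : H →* K} {P : GCWPair H} {Q : GCWPair K}

/-- The adjoint map `(k, x) ↦ k f(x)`. -/
def adj (f : SemiHom α P Q) : (indFunctor α).obj P ⟶ Q :=
  Hom.mk (P := indObj α P) (Q := Q)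
    (Ind.lift (fun k x => k • f.toFun x) fun k h x => by rw [f.map_smul, mul_smul])
    (Ind.continuous_lift _ _ fun k => f.continuous_toFun.const_smul k)
    (fun g => Ind.ind fun k x => mul_smul g k (f.toFun x))
    (by
      rintro _ ⟨k, x, hx, rfl⟩
      exact Q.A.smul_mem k (f.map_mem x hx))

/-- The restriction to the subcomplexes. -/
def sub (f : SemiHom α P Q) : SemiHom α P.sub Q.sub where
  toFun := fun x : P.A => (⟨f.toFun x.1, f.map_mem x.1 x.2⟩ : Q.A)
  continuous_toFun := Continuous.subtype_mk (f.continuous_toFun.comp continuous_subtype_val) _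
  map_smul g x := Subtype.ext (f.map_smul g x.1)
  map_mem _ h := h.elim

/-- The unique map between one-point spaces. -/
def point (α : H →* K) : SemiHom α (GCWPair.point H) (GCWPair.point K) where
  toFun := fun _ : PUnit => (PUnit.unit : PUnit)
  continuous_toFun := continuous_const
  map_smul _ _ := rfl
  map_mem _ h := h.elim

end SemiHom

/-! ### Pushforward in homology along maps that are equivariant over a group homomorphism. -/

namespace EquivariantHomologyTheory

variable {Γ : Type z} [Group Γ] {Λ : Type v} [Ring Λ]
  (ℋ : EquivariantHomologyTheory.{u, v, w, z} Γ Λ) {H K L : Type u} [Group H] [Group K] [Group L]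
  (ξ : H →* Γ) (μ : K →* Γ) (ν : L →* Γ) (n : ℤ) {P : GCWPair H} {Q : GCWPair K} {R : GCWPair L}
  {α : H →* K} {β : K →* L} {γ : H →* L}

/-- The homomorphism induced by a map that is equivariant along a group homomorphism. -/
def push (hα : μ.comp α = ξ) (f : SemiHom α P Q) :
    ((ℋ.theory H ξ).H n).obj P ⟶ ((ℋ.theory K μ).H n).obj Q :=
  (ℋ.ind ξ μ α hα n).app P ≫ ((ℋ.theory K μ).H n).map f.adj

/-- `ind_comp`, naturality of induction and the factorization of the adjoint of the composite
through `indComp`. With induction and induced maps merged into one functorial operation, later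
identities in homology reduce to equalities of underlying maps. -/
theorem push_comp (hα : μ.comp α = ξ) (hβ : ν.comp β = μ) (hγ : ν.comp γ = ξ) (f : SemiHom α P Q)
    (g : SemiHom β Q R) (k : SemiHom γ P R) (h : β.comp α = γ)
    (hk : ∀ x, k.toFun x = g.toFun (f.toFun x)) :
    ℋ.push ξ μ n hα f ≫ ℋ.push μ ν n hβ g = ℋ.push ξ ν n hγ k := by
  subst h
  have e : (indFunctor β).map f.adj ≫ g.adj = indComp β α P ≫ k.adj := by
    refine hom_ext (funext (Ind.ind fun l => Ind.ind fun a x => ?_))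
    change l • g.toFun (a • f.toFun x) = (l * β a) • k.toFun x
    rw [g.map_smul, mul_smul, hk]
  unfold push
  rw [ℋ.ind_comp ξ μ ν α β hα hβ hγ n P, Category.assoc,
    ← Category.assoc (((ℋ.theory K μ).H n).map f.adj), (ℋ.ind μ ν β hβ n).naturality]
  simp only [Category.assoc, Functor.comp_map, ← Functor.map_comp, e]

theorem push_map (hα : μ.comp α = ξ) (f : SemiHom α P Q) {Q' : GCWPair K} (b : Q ⟶ Q')
    (k : SemiHom α P Q') (hk : ∀ x, k.toFun x = b.toFun (f.toFun x)) :
    ℋ.push ξ μ n hα f ≫ ((ℋ.theory K μ).H n).map b = ℋ.push ξ μ n hα k := by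
  have e : f.adj ≫ b = k.adj := by
    refine hom_ext (funext (Ind.ind fun a x => ?_))
    change b.toFun (a • f.toFun x) = a • k.toFun x
    rw [b.map_smul, hk]
  rw [push, Category.assoc, ← Functor.map_comp, e, push]

theorem map_push (hα : μ.comp α = ξ) {P' : GCWPair H} (a : P' ⟶ P) (f : SemiHom α P Q)
    (k : SemiHom α P' Q) (hk : ∀ x, k.toFun x = f.toFun (a.toFun x)) :
    ((ℋ.theory H ξ).H n).map a ≫ ℋ.push ξ μ n hα f = ℋ.push ξ μ n hα k := by
  have e : (indFunctor α).map a ≫ f.adj = k.adj := by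
    refine hom_ext (funext (Ind.ind fun b x => ?_))
    change b • f.toFun (a.toFun x) = b • k.toFun x
    rw [hk]
  rw [push, ← Category.assoc, (ℋ.ind ξ μ α hα n).naturality, Category.assoc, Functor.comp_map,
    ← Functor.map_comp, e, push]

/-- `ind_boundary` followed by naturality of the boundary map; `indSub` matches the adjoint of the
restricted map with the restriction of the adjoint. -/
theorem push_boundary (hα : μ.comp α = ξ) (f : SemiHom α P Q) :
    ℋ.push ξ μ n hα f ≫ ((ℋ.theory K μ).boundary n).app Q =
      ((ℋ.theory H ξ).boundary n).app P ≫ ℋ.push ξ μ (n - 1) hα f.sub := by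
  have e : indSub α P ≫ subMap f.adj = f.sub.adj :=
    hom_ext (funext (Ind.ind fun b x => rfl))
  have e' := (((ℋ.theory K μ).H (n - 1)).map_comp (indSub α P) (subMap f.adj)).symm.trans
    (congrArg ((ℋ.theory K μ).H (n - 1)).map e)
  unfold push
  refine (Category.assoc _ _ _).trans ?_
  refine (congrArg (fun k => (ℋ.ind ξ μ α hα n).app P ≫ k)
    (((ℋ.theory K μ).boundary n).naturality f.adj)).trans ?_
  refine (Category.assoc _ _ _).symm.trans ?_
  refine (congrArg (fun k => k ≫ ((ℋ.theory K μ).H (n - 1)).map (subMap f.adj))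
    (ℋ.ind_boundary ξ μ α hα n P)).trans ?_
  refine (Category.assoc _ _ _).trans (congrArg (fun k => _ ≫ k) ?_)
  exact (Category.assoc _ _ _).trans (congrArg (fun k => _ ≫ k) e')

/-- Induction along the identity is not normalized by an axiom of its own, but the identity is
conjugation by 1, to which `ind_conj` applies. -/
theorem push_id {P : GCWPair H} {α : H →* H} (hα : ξ.comp α = ξ) (h : α = MonoidHom.id H)
    (f : SemiHom α P P) (hf : ∀ x, f.toFun x = x) : ℋ.push ξ ξ n hα f = 𝟙 _ := by
  obtain rfl : α = (MulAut.conj (1 : H)).toMonoidHom := by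
    rw [h]
    ext x
    simp
  have e : conjMap 1 P ≫ f.adj = 𝟙 P := by
    refine hom_ext (funext fun x => ?_)
    change (1 : H) • f.toFun ((1 : H)⁻¹ • x) = x
    rw [hf, smul_inv_smul]
  rw [push, ℋ.ind_conj ξ 1 (map_one ξ) hα n P, ← Functor.map_comp, e, CategoryTheory.Functor.map_id]

theorem pointMap_eq_push (hα : μ.comp α = ξ) :
    ℋ.pointMap ξ μ α hα n = ℋ.push ξ μ n hα (SemiHom.point α) := by
  unfold pointMap push
  congr 2

theorem pointMap_id {α : H →* H} (hα : ξ.comp α = ξ) (h : α = MonoidHom.id H) :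
    ℋ.pointMap ξ ξ α hα n = 𝟙 _ := by
  rw [pointMap_eq_push]
  exact ℋ.push_id ξ n hα h _ fun _ => rfl

end EquivariantHomologyTheory

/-! ### Restriction along a group homomorphism -/

/-- A `G`-space regarded as a `K`-space by a homomorphism `K → G`. -/
def Res {K G : Type u} [Group K] [Group G] (_ψ : K →* G) (X : Type u) : Type u := X

namespace Res

variable {K G : Type u} [Group K] [Group G] (ψ : K →* G) {X : Type u}

instance [TopologicalSpace X] : TopologicalSpace (Res ψ X) := inferInstanceAs (TopologicalSpace X)

instance [MulAction G X] : MulAction K (Res ψ X) := MulAction.compHom X ψ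

instance [TopologicalSpace X] [MulAction G X] [ContinuousConstSMul G X] :
    ContinuousConstSMul K (Res ψ X) where
  continuous_const_smul k := continuous_const_smul (T := X) (ψ k)

variable [TopologicalSpace X] [MulAction G X]

/-- A representative of a double coset. -/
noncomputable def rep {L : Subgroup G} (c : MulAction.orbitRel.Quotient K (Res ψ (G ⧸ L))) : G :=
  Quotient.out (s := QuotientGroup.leftRel L) c.out

theorem mk_rep {L : Subgroup G} (c : MulAction.orbitRel.Quotient K (Res ψ (G ⧸ L))) :
    ((rep ψ c : G) : G ⧸ L) = c.out := Quotient.out_eq _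

variable {ψ}

/-- The decomposition of `G` into double cosets `ψ(K) c L`. -/
theorem exists_rep {L : Subgroup G} (g : G) :
    ∃ (c : MulAction.orbitRel.Quotient K (Res ψ (G ⧸ L))) (k : K) (l : L),
      g = ψ k * rep ψ c * l := by
  let c : MulAction.orbitRel.Quotient K (Res ψ (G ⧸ L)) :=
    Quotient.mk (MulAction.orbitRel K (Res ψ (G ⧸ L))) (g : G ⧸ L)
  obtain ⟨k, hk⟩ := Quotient.exact (s := MulAction.orbitRel K (Res ψ (G ⧸ L)))
    (Quotient.out_eq c).symm
  have h2 : ((ψ k * rep ψ c : G) : G ⧸ L) = g := by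
    refine Eq.trans ?_ hk
    change ψ k • ((rep ψ c : G) : G ⧸ L) = _
    rw [mk_rep]
    rfl
  exact ⟨c, k, ⟨_, QuotientGroup.eq.1 h2⟩, by simp [mul_assoc]⟩

theorem rep_inj {L : Subgroup G} {c c' : MulAction.orbitRel.Quotient K (Res ψ (G ⧸ L))} {k : K}
    (h : (rep ψ c')⁻¹ * (ψ k * rep ψ c) ∈ L) : c = c' := by
  rw [← Quotient.out_eq c, ← Quotient.out_eq c', eq_comm]
  refine Quotient.sound ⟨k, ?_⟩
  refine Eq.trans (b := ((ψ k * rep ψ c : G) : G ⧸ L)) ?_ ?_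
  · change _ = ψ k • ((rep ψ c : G) : G ⧸ L)
    rw [mk_rep]
    rfl
  · rw [← QuotientGroup.eq.2 h, mk_rep]

variable (ψ)

/-- The restriction of a `G`-CW-structure. -/
noncomputable def structure_ [ContinuousConstSMul G X] (S : GCWStructure G X) : GCWStructure K (Res ψ X) where
  skel := S.skel
  skel_zero := S.skel_zero
  skel_subset := S.skel_subset
  iUnion_skel := S.iUnion_skel
  smul_mem_skel n k x hx := S.smul_mem_skel n (ψ k) x hx
  isClosed_of_skel := S.isClosed_of_skel
  cell n := Σ i : S.cell n, MulAction.orbitRel.Quotient K (Res ψ (G ⧸ S.stab n i))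
  -- As a `K`-set, `G / L` splits into one orbit for each double coset `ψ(K) c L`, and the isotropy
  -- group of the point `c L` is `ψ⁻¹(c L c⁻¹)`.
  stab n i := ((S.stab n i.1).comap (MulAut.conj (rep ψ i.2)⁻¹).toMonoidHom).comap ψ
  map n i := ⟨fun d => (rep ψ i.2 • S.map n i.1 d : X),
    (S.map n i.1).continuous.const_smul _⟩
  smul_map n i k hk d := by
    have := S.smul_map n i.1 _ hk d
    simp only [MulEquiv.toMonoidHom_eq_coe, MonoidHom.coe_coe, MulAut.conj_apply, inv_inv,
      mul_smul, inv_smul_eq_iff] at this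
    exact this
  map_mem n i d := S.smul_mem_skel _ _ _ (S.map_mem n i.1 d)
  map_boundary n i d hd := S.smul_mem_skel _ _ _ (S.map_boundary n i.1 d hd)
  map_interior_notMem n i d hd := S.smul_interior_notMem _ hd
  map_interior_inj := by
    rintro n ⟨i, c⟩ ⟨j, c'⟩ k d d' hd hd' h
    have h' : ψ k • rep ψ c • S.map n i d = rep ψ c' • S.map n j d' := h
    obtain ⟨rfl, h2, h3⟩ := S.map_interior_inj n i j ((rep ψ c')⁻¹ * (ψ k * rep ψ c)) d d' hd hd'
      (by rw [mul_smul, mul_smul, h', inv_smul_smul])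
    obtain rfl := rep_inj h3
    refine ⟨rfl, h2, ?_⟩
    change (rep ψ c)⁻¹ * ψ k * (rep ψ c)⁻¹⁻¹ ∈ S.stab n i
    rwa [inv_inv, mul_assoc]
  exists_cell n x hx hx' := by
    obtain ⟨i, g, d, hd, rfl⟩ := S.exists_cell n x hx hx'
    obtain ⟨c, k, l, rfl⟩ := exists_rep (ψ := ψ) (L := S.stab n i) g
    refine ⟨⟨i, c⟩, k, d, hd, ?_⟩
    change ψ k • rep ψ c • S.map n i d = _
    rw [mul_smul, S.smul_map n i l l.2, mul_smul]
  isClosed_of_cells n C hC h0 h1 := by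
    refine S.isClosed_of_cells n C hC h0 fun i g => ?_
    obtain ⟨c, k, l, rfl⟩ := exists_rep (ψ := ψ) (L := S.stab n i) g
    convert h1 ⟨i, c⟩ k using 1
    ext d
    change (ψ k * rep ψ c * l) • S.map n i d ∈ C ↔ ψ k • rep ψ c • S.map n i d ∈ C
    rw [mul_smul, S.smul_map n i l l.2, mul_smul]

theorem isSubcomplex [ContinuousConstSMul G X] (S : GCWStructure G X) {A : SubMulAction G X}
    (hA : S.IsSubcomplex A) (B : SubMulAction K (Res ψ X)) (hB : ∀ x : X, x ∈ B ↔ x ∈ A) :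
    (structure_ ψ S).IsSubcomplex B := fun n i d hd h d' =>
  (hB _).2 (A.smul_mem _ (hA n i.1 d hd ((A.smul_mem_iff' _).1 ((hB _).1 h)) d'))

end Res

namespace GCWPair

variable {K G : Type u} [Group K] [Group G] (ψ : K →* G)

/-- The restriction of a pair. -/
def resObj (P : GCWPair G) : GCWPair K where
  X := Res ψ P.X
  A := { carrier := {x : P.X | x ∈ P.A}, smul_mem' := fun k _ hx => P.A.smul_mem (ψ k) hx }
  isGCW := P.isGCW.elim fun S hS => ⟨Res.structure_ (X := P.X) ψ S,
    Res.isSubcomplex (X := P.X) ψ S hS _ fun _ => Iff.rfl⟩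

/-- The restriction of a map. -/
def resMap {P Q : GCWPair G} (f : P ⟶ Q) : resObj ψ P ⟶ resObj ψ Q :=
  Hom.mk (P := resObj ψ P) (Q := resObj ψ Q) f.toFun f.continuous_toFun
    (fun k x => f.map_smul (ψ k) x) f.map_mem

theorem resMap_comp {P Q R : GCWPair G} (f : P ⟶ Q) (g : Q ⟶ R) :
    resMap ψ (f ≫ g) = resMap ψ f ≫ resMap ψ g := rfl

theorem resMap_id (P : GCWPair G) : resMap ψ (𝟙 P) = 𝟙 (resObj ψ P) := rfl

theorem isGCWComplex_res {X : Type u} [TopologicalSpace X] [MulAction G X]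
    [ContinuousConstSMul G X] (h : IsGCWComplex G X) : IsGCWComplex K (Res ψ X) :=
  h.elim fun S => ⟨Res.structure_ ψ S⟩

theorem Homotopic.res {P Q : GCWPair G} {f g : P ⟶ Q} (h : Homotopic f g) :
    Homotopic (resMap ψ f) (resMap ψ g) := by
  obtain ⟨F, h1, h2, h3, h4, h5⟩ := h
  exact ⟨F, h1, fun k x t => h2 (ψ k) x t, h3, h4, h5⟩

theorem IsAdjunction.res {P Q : GCWPair G} {F : P ⟶ Q} (h : IsAdjunction F) :
    IsAdjunction (resMap ψ F) := ⟨h.1, h.2⟩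

theorem IsCellularOnSub.res {P Q : GCWPair G} {F : P ⟶ Q} (h : IsCellularOnSub F) :
    IsCellularOnSub (resMap ψ F) := by
  obtain ⟨S, T, hS, h⟩ := h
  exact ⟨Res.structure_ (X := P.X) ψ S, Res.structure_ (X := Q.A) ψ T,
    Res.isSubcomplex (X := P.X) ψ S hS _ fun _ => Iff.rfl, h⟩

end GCWPair

namespace SemiHom

variable {K G M : Type u} [Group K] [Group G] [Group M]

/-- The identity of `P`. -/
def res (α : K →* M) (ψ : K →* G) (χ : M →* G) (h : χ.comp α = ψ) (P : GCWPair G) :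
    SemiHom α (resObj ψ P) (resObj χ P) where
  toFun x := x
  continuous_toFun := continuous_id
  map_smul k x := by
    subst h
    rfl
  map_mem _ hx := hx

/-- The identity of `P`. -/
def unit (ψ : K →* G) (P : GCWPair G) : SemiHom ψ (resObj ψ P) P where
  toFun x := x
  continuous_toFun := continuous_id
  map_smul _ _ := rfl
  map_mem _ hx := hx

end SemiHom

/-! ### Directed systems of modules over a module -/

/-- A system of modules together with compatible maps to a module. -/
structure ModSystem (I : Type u) [Preorder I] (Λ : Type v) [Ring Λ] where
  obj : I → ModuleCat.{w} Λ
  map : ∀ i j, i ≤ j → (obj i →ₗ[Λ] obj j)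
  pt : ModuleCat.{w} Λ
  toPt : ∀ i, obj i →ₗ[Λ] pt
  map_map : ∀ i j k (h : i ≤ j) (h' : j ≤ k) x, map j k h' (map i j h x) = map i k (h.trans h') x
  toPt_map : ∀ i j (h : i ≤ j) x, toPt j (map i j h x) = toPt i x

namespace ModSystem

variable {I : Type u} [Preorder I] {Λ : Type v} [Ring Λ]

/-- The module is the colimit of the directed system. -/
structure IsColim (D : ModSystem.{u, v, w} I Λ) : Prop where
  surj : ∀ y, ∃ i x, D.toPt i x = y
  inj : ∀ i x, D.toPt i x = 0 → ∃ (j : I) (h : i ≤ j), D.map i j h x = 0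

/-- Maps of systems. -/
structure Hom (D E : ModSystem.{u, v, w} I Λ) where
  app : ∀ i, D.obj i →ₗ[Λ] E.obj i
  pt : D.pt →ₗ[Λ] E.pt
  app_map : ∀ i j (h : i ≤ j) x, app j (D.map i j h x) = E.map i j h (app i x)
  pt_toPt : ∀ i x, pt (D.toPt i x) = E.toPt i (app i x)

theorem IsColim.of_retract {D E : ModSystem.{u, v, w} I Λ} (s : Hom D E) (r : Hom E D)
    (h : ∀ i x, r.app i (s.app i x) = x) (h' : ∀ x, r.pt (s.pt x) = x) (hE : E.IsColim) :
    D.IsColim where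
  surj y := by
    obtain ⟨i, x, hx⟩ := hE.surj (s.pt y)
    exact ⟨i, r.app i x, by rw [← r.pt_toPt, hx, h']⟩
  inj i x hx := by
    obtain ⟨j, hj, e⟩ := hE.inj i (s.app i x) (by rw [← s.pt_toPt, hx, map_zero])
    exact ⟨j, hj, by rw [← h j (D.map i j hj x), s.app_map, e, map_zero]⟩

theorem isColim_iff_of_bijective {D E : ModSystem.{u, v, w} I Λ} (s : Hom D E)
    (h : ∀ i, Function.Bijective (s.app i)) (h' : Function.Bijective s.pt) :
    D.IsColim ↔ E.IsColim := by
  constructor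
  · refine fun hD => ⟨fun y => ?_, fun i x hx => ?_⟩
    · obtain ⟨y, rfl⟩ := h'.2 y
      obtain ⟨i, x, rfl⟩ := hD.surj y
      exact ⟨i, s.app i x, (s.pt_toPt i x).symm⟩
    · obtain ⟨x, rfl⟩ := (h i).2 x
      rw [← s.pt_toPt] at hx
      obtain ⟨j, hj, e⟩ := hD.inj i x (h'.1 (hx.trans (map_zero _).symm))
      exact ⟨j, hj, by rw [← s.app_map, e, map_zero]⟩
  · refine fun hE => ⟨fun y => ?_, fun i x hx => ?_⟩
    · obtain ⟨i, x, hx⟩ := hE.surj (s.pt y)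
      obtain ⟨x, rfl⟩ := (h i).2 x
      rw [← s.pt_toPt] at hx
      exact ⟨i, x, h'.1 hx⟩
    · obtain ⟨j, hj, e⟩ := hE.inj i (s.app i x) (by rw [← s.pt_toPt, hx, map_zero])
      exact ⟨j, hj, (h j).1 (by rw [s.app_map, e, map_zero])⟩

/-- A map of systems that is bijective at each stage is bijective on colimits. Applied to the
projection of the classifying space, this proves the Isomorphism Conjecture in the limit. -/
theorem bijective_pt {D E : ModSystem.{u, v, w} I Λ} (s : Hom D E)
    (h : ∀ i, Function.Bijective (s.app i)) (hD : D.IsColim) (hE : E.IsColim) :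
    Function.Bijective s.pt := by
  constructor
  · refine (injective_iff_map_eq_zero s.pt).2 fun y hy => ?_
    obtain ⟨i, x, rfl⟩ := hD.surj y
    rw [s.pt_toPt] at hy
    obtain ⟨j, hj, e⟩ := hE.inj i _ hy
    rw [← s.app_map] at e
    rw [← D.toPt_map i j hj, (h j).1 (e.trans (map_zero _).symm), map_zero]
  · intro y
    obtain ⟨i, x, rfl⟩ := hE.surj y
    obtain ⟨x, rfl⟩ := (h i).2 x
    exact ⟨D.toPt i x, s.pt_toPt i x⟩

variable [IsDirectedOrder I]

/-- The five lemma for the comparison maps, directed colimits being exact. The chase is carried out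
on representatives, moving to a larger index whenever a relation holds only in the limit. -/
theorem IsColim.five {A B C D E : ModSystem.{u, v, w} I Λ} (f : Hom A B) (g : Hom B C)
    (h : Hom C D) (k : Hom D E) (hfg : ∀ i, Function.Exact (f.app i) (g.app i))
    (hgh : ∀ i, Function.Exact (g.app i) (h.app i)) (hhk : ∀ i, Function.Exact (h.app i) (k.app i))
    (hfg' : Function.Exact f.pt g.pt) (hgh' : Function.Exact g.pt h.pt)
    (hhk' : Function.Exact h.pt k.pt) (hA : A.IsColim) (hB : B.IsColim) (hD : D.IsColim)
    (hE : E.IsColim) : C.IsColim where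
  surj y := by
    obtain ⟨i, d, hd⟩ := hD.surj (h.pt y)
    obtain ⟨j, hj, e⟩ := hE.inj i (k.app i d) (by rw [← k.pt_toPt, hd, hhk'.apply_apply_eq_zero])
    rw [← k.app_map] at e
    obtain ⟨c, hc⟩ := (hhk j _).1 e
    obtain ⟨b, hb⟩ := (hgh' (y - C.toPt j c)).1 (by
      rw [map_sub, h.pt_toPt, hc, D.toPt_map, hd, sub_self])
    obtain ⟨l, b, rfl⟩ := hB.surj b
    obtain ⟨m, hm, hm'⟩ := exists_ge_ge j l
    refine ⟨m, C.map j m hm c + g.app m (B.map l m hm' b), ?_⟩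
    rw [map_add, C.toPt_map, ← g.pt_toPt, B.toPt_map, hb]
    abel
  inj i c hc := by
    obtain ⟨j, hj, e⟩ := hD.inj i (h.app i c) (by rw [← h.pt_toPt, hc, map_zero])
    rw [← h.app_map] at e
    obtain ⟨b, hb⟩ := (hgh j _).1 e
    obtain ⟨a, ha⟩ := (hfg' (B.toPt j b)).1 (by rw [g.pt_toPt, hb, C.toPt_map, hc])
    obtain ⟨l, a, rfl⟩ := hA.surj a
    obtain ⟨m, hm, hm'⟩ := exists_ge_ge j l
    obtain ⟨p, hp, e'⟩ := hB.inj m (B.map j m hm b - f.app m (A.map l m hm' a)) (by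
      rw [map_sub, B.toPt_map, ← f.pt_toPt, A.toPt_map, ha, sub_self])
    refine ⟨p, hj.trans (hm.trans hp), ?_⟩
    rw [map_sub, B.map_map, ← f.app_map, sub_eq_zero] at e'
    rw [← C.map_map i j p hj (hm.trans hp), ← hb, ← g.app_map, e', (hfg p).apply_apply_eq_zero]

-- Directed colimits commute with direct sums: an element of a direct sum has finite support, so the
-- finitely many indices at which its components vanish have a common upper bound.
open Classical in
theorem IsColim.directSum [Nonempty I] {ι : Type u} {D : ι → ModSystem.{u, v, w} I Λ}
    {E : ModSystem.{u, v, w} I Λ} (s : ∀ a, Hom (D a) E)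
    (h : ∀ i, Function.Bijective (DirectSum.toModule Λ ι (E.obj i) fun a => (s a).app i))
    (h' : Function.Bijective (DirectSum.toModule Λ ι E.pt fun a => (s a).pt))
    (hD : ∀ a, (D a).IsColim) : E.IsColim where
  surj y := by
    obtain ⟨x, rfl⟩ := h'.2 y
    induction x using DirectSum.induction_on with
    | zero => exact ⟨Classical.arbitrary I, 0, by simp⟩
    | of a x =>
      obtain ⟨i, x, rfl⟩ := (hD a).surj x
      refine ⟨i, (s a).app i x, ?_⟩
      rw [← (s a).pt_toPt]
      exact (DirectSum.toModule_lof Λ (φ := fun a => (s a).pt) a _).symm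
    | add x y hx hy =>
      obtain ⟨i, a, ha⟩ := hx
      obtain ⟨j, b, hb⟩ := hy
      obtain ⟨k, hk, hk'⟩ := exists_ge_ge i j
      exact ⟨k, E.map i k hk a + E.map j k hk' b, by
        rw [map_add, E.toPt_map, E.toPt_map, ha, hb, map_add]⟩
  inj i z hz := by
    obtain ⟨x, rfl⟩ := (h i).2 z
    have e1 : E.toPt i ∘ₗ DirectSum.toModule Λ ι (E.obj i) (fun a => (s a).app i) =
        DirectSum.toModule Λ ι E.pt (fun a => (s a).pt) ∘ₗ
          DirectSum.lmap fun a => (D a).toPt i := by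
      refine DirectSum.linearMap_ext _ fun a => LinearMap.ext fun t => ?_
      simp [DirectSum.lmap_lof, (s a).pt_toPt]
    have e2 : ∀ j hj, E.map i j hj ∘ₗ DirectSum.toModule Λ ι (E.obj i) (fun a => (s a).app i) =
        DirectSum.toModule Λ ι (E.obj j) (fun a => (s a).app j) ∘ₗ
          DirectSum.lmap fun a => (D a).map i j hj := by
      refine fun j hj => DirectSum.linearMap_ext _ fun a => LinearMap.ext fun t => ?_
      simp [DirectSum.lmap_lof, (s a).app_map]
    have h0 : DirectSum.lmap (fun a => (D a).toPt i) x = 0 :=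
      h'.1 ((LinearMap.congr_fun e1 x).symm.trans (hz.trans (map_zero _).symm))
    have h1 : ∀ a, (D a).toPt i (x a) = 0 := fun a =>
      (DirectSum.lmap_apply (fun a => (D a).toPt i) x a).symm.trans (by rw [h0]; rfl)
    choose j hj hj' using fun a => (hD a).inj i (x a) (h1 a)
    obtain ⟨k, hk⟩ := Finset.exists_le (insert i ((DFinsupp.support x).image j))
    have hik : i ≤ k := hk i (Finset.mem_insert_self _ _)
    refine ⟨k, hik, ?_⟩
    have h2 : DirectSum.lmap (fun a => (D a).map i k hik) x = 0 := by
      refine DFinsupp.ext fun a => ?_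
      refine (DirectSum.lmap_apply (fun a => (D a).map i k hik) x a).trans ?_
      by_cases ha : x a = 0
      · rw [ha, map_zero]
        rfl
      · rw [← (D a).map_map i (j a) k (hj a) (hk _ (Finset.mem_insert_of_mem
          (Finset.mem_image_of_mem _ (DFinsupp.mem_support_toFun x a |>.2 ha)))), hj', map_zero]
        rfl
    exact (LinearMap.congr_fun (e2 k hik) x).trans (by
      rw [LinearMap.comp_apply, h2, map_zero])

end ModSystem

/-! ### The systems of homology groups of a system of groups -/

namespace EquivariantHomologyTheory

variable {Γ : Type z} [Group Γ] {Λ : Type v} [Ring Λ]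
  (ℋ : EquivariantHomologyTheory.{u, v, w, z} Γ Λ)

theorem push_naturality {H K : Type u} [Group H] [Group K] {α : H →* K} (ξ : H →* Γ) (μ : K →* Γ)
    (n : ℤ) (hα : μ.comp α = ξ) {P P' : GCWPair H} {Q Q' : GCWPair K} (a : P ⟶ P') (b : Q ⟶ Q')
    (f : SemiHom α P Q) (g : SemiHom α P' Q')
    (h : ∀ x, g.toFun (a.toFun x) = b.toFun (f.toFun x)) (x : ((ℋ.theory H ξ).H n).obj P) :
    (ℋ.push ξ μ n hα g).hom ((((ℋ.theory H ξ).H n).map a).hom x) =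
      (((ℋ.theory K μ).H n).map b).hom ((ℋ.push ξ μ n hα f).hom x) := by
  let k : SemiHom α P Q' := ⟨fun x => b.toFun (f.toFun x),
    b.continuous_toFun.comp f.continuous_toFun, fun h x => by rw [f.map_smul, b.map_smul],
    fun x hx => b.map_mem _ (f.map_mem x hx)⟩
  have h1 := (ℋ.map_push ξ μ n hα a g k fun x => (h x).symm).trans
    (ℋ.push_map ξ μ n hα f b k fun x => rfl).symm
  exact congrArg (fun t => t.hom x) h1

variable {G : Type u} [Group G] (ξ : G →* Γ) {I : Type u} [Preorder I] {Gi : I → Type u}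
  [∀ i, Group (Gi i)] {φ : ∀ i j, i ≤ j → Gi i →* Gi j} {ψ : ∀ i, Gi i →* G}
  (hφ : ∀ i j k (h : i ≤ j) (h' : j ≤ k), (φ j k h').comp (φ i j h) = φ i k (h.trans h'))
  (hψ : ∀ i j (h : i ≤ j), (ψ j).comp (φ i j h) = ψ i)

/-- The homology groups of the restrictions of a pair to a system of groups. -/
def resSystem (P : GCWPair G) (n : ℤ) : ModSystem.{u, v, w} I Λ where
  obj i := ((ℋ.theory (Gi i) (ξ.comp (ψ i))).H n).obj (resObj (ψ i) P)
  map i j h := (ℋ.push (ξ.comp (ψ i)) (ξ.comp (ψ j)) n (by rw [MonoidHom.comp_assoc, hψ i j h])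
    (SemiHom.res (φ i j h) (ψ i) (ψ j) (hψ i j h) P)).hom
  pt := ((ℋ.theory G ξ).H n).obj P
  toPt i := (ℋ.push (ξ.comp (ψ i)) ξ n rfl (SemiHom.unit (ψ i) P)).hom
  map_map i j k _ _ x := congrArg (fun t => t.hom x) (ℋ.push_comp (ξ.comp (ψ i)) (ξ.comp (ψ j))
    (ξ.comp (ψ k)) n _ _ (by rw [MonoidHom.comp_assoc, hψ]) _ _
    (SemiHom.res (φ i k _) (ψ i) (ψ k) (hψ _ _ _) P) (hφ i j k _ _) fun _ => rfl)
  toPt_map i j _ x := congrArg (fun t => t.hom x) (ℋ.push_comp (ξ.comp (ψ i)) (ξ.comp (ψ j))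
    ξ n _ _ rfl _ _ (SemiHom.unit (ψ i) P) (hψ i j _) fun _ => rfl)

/-- The map of systems induced by a map of pairs. -/
def resSystemMap {P Q : GCWPair G} (f : P ⟶ Q) (n : ℤ) :
    ModSystem.Hom (ℋ.resSystem ξ hφ hψ P n) (ℋ.resSystem ξ hφ hψ Q n) where
  app i := (((ℋ.theory (Gi i) (ξ.comp (ψ i))).H n).map (resMap (ψ i) f)).hom
  pt := (((ℋ.theory G ξ).H n).map f).hom
  app_map i j h x := (ℋ.push_naturality (ξ.comp (ψ i)) (ξ.comp (ψ j)) n _ (resMap (ψ i) f)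
    (resMap (ψ j) f) _ _ (fun _ => rfl) x).symm
  pt_toPt i x := (ℋ.push_naturality (ξ.comp (ψ i)) ξ n rfl (resMap (ψ i) f)
    f _ _ (fun _ => rfl) x).symm

/-- The map of systems given by the boundary maps. -/
def resSystemBoundary (P : GCWPair G) (n : ℤ) :
    ModSystem.Hom (ℋ.resSystem ξ hφ hψ P n) (ℋ.resSystem ξ hφ hψ P.sub (n - 1)) where
  app i := (((ℋ.theory (Gi i) (ξ.comp (ψ i))).boundary n).app (resObj (ψ i) P)).hom
  pt := (((ℋ.theory G ξ).boundary n).app P).hom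
  app_map i j h x := congrArg (fun t => t.hom x) (ℋ.push_boundary (ξ.comp (ψ i)) (ξ.comp (ψ j)) n
    (by rw [MonoidHom.comp_assoc, hψ i j h]) (SemiHom.res (φ i j h) (ψ i) (ψ j) (hψ i j h) P))
  pt_toPt i x := congrArg (fun t => t.hom x) (ℋ.push_boundary (ξ.comp (ψ i)) ξ n
    rfl (SemiHom.unit (ψ i) P))

/-- Each closure property comes from an axiom that holds for `G` and all `G_i` simultaneously, since
restriction preserves homotopies, subcomplexes, excision squares and disjoint unions. The lemmas on
systems of modules carry it over to the colimit property. -/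
theorem isLocalizing_resSystem [IsDirectedOrder I] [Nonempty I] :
    IsLocalizing fun P => ∀ n, (ℋ.resSystem ξ hφ hψ P n).IsColim where
  retract f g h hQ n := by
    refine (hQ n).of_retract (ℋ.resSystemMap ξ hφ hψ f n) (ℋ.resSystemMap ξ hφ hψ g n)
      (fun i x => ?_) fun x => ?_
    · have e := (ℋ.theory (Gi i) (ξ.comp (ψ i))).homotopy_invariance _ _ (h.res (ψ i)) n
      rw [resMap_comp, resMap_id, Functor.map_comp, CategoryTheory.Functor.map_id] at e
      exact congrArg (fun t => t.hom x) e
    · have e := (ℋ.theory G ξ).homotopy_invariance _ _ h n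
      rw [Functor.map_comp, CategoryTheory.Functor.map_id] at e
      exact congrArg (fun t => t.hom x) e
  pair P h1 h2 n := by
    exact ModSystem.IsColim.five (ℋ.resSystemMap ξ hφ hψ P.incl n)
      (ℋ.resSystemMap ξ hφ hψ P.toPair n) (ℋ.resSystemBoundary ξ hφ hψ P n)
      (ℋ.resSystemMap ξ hφ hψ P.incl (n - 1))
      (fun i => (ℋ.theory (Gi i) (ξ.comp (ψ i))).exact_abs (resObj (ψ i) P) n)
      (fun i => (ℋ.theory (Gi i) (ξ.comp (ψ i))).exact_pair (resObj (ψ i) P) n)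
      (fun i => (ℋ.theory (Gi i) (ξ.comp (ψ i))).exact_sub (resObj (ψ i) P) n)
      ((ℋ.theory G ξ).exact_abs P n) ((ℋ.theory G ξ).exact_pair P n)
      ((ℋ.theory G ξ).exact_sub P n) (h1 n) (h2 n) (h1 (n - 1)) (h2 (n - 1))
  abs P h1 h2 := by
    -- The long exact sequence is entered at the boundary map from degree `n` to `n - 1`, so it
    -- yields the statement in degree `n - 1`; the shift is undone afterwards.
    have key : ∀ n, (ℋ.resSystem ξ hφ hψ P.abs (n - 1)).IsColim := fun n =>
      ModSystem.IsColim.five (ℋ.resSystemBoundary ξ hφ hψ P n)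
      (ℋ.resSystemMap ξ hφ hψ P.incl (n - 1)) (ℋ.resSystemMap ξ hφ hψ P.toPair (n - 1))
      (ℋ.resSystemBoundary ξ hφ hψ P (n - 1))
      (fun i => (ℋ.theory (Gi i) (ξ.comp (ψ i))).exact_sub (resObj (ψ i) P) n)
      (fun i => (ℋ.theory (Gi i) (ξ.comp (ψ i))).exact_abs (resObj (ψ i) P) (n - 1))
      (fun i => (ℋ.theory (Gi i) (ξ.comp (ψ i))).exact_pair (resObj (ψ i) P) (n - 1))
      ((ℋ.theory G ξ).exact_sub P n) ((ℋ.theory G ξ).exact_abs P (n - 1))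
      ((ℋ.theory G ξ).exact_pair P (n - 1)) (h2 n) (h1 (n - 1)) (h2 (n - 1)) (h1 (n - 1 - 1))
    intro n
    have := key (n + 1)
    rwa [add_sub_cancel_right] at this
  excision F h h' := forall_congr' fun n =>
    ModSystem.isColim_iff_of_bijective (ℋ.resSystemMap ξ hφ hψ F n)
      (fun i => (ℋ.theory (Gi i) (ξ.comp (ψ i))).excision _ (h.res (ψ i)) (h'.res (ψ i)) n)
      ((ℋ.theory G ξ).excision F h h' n)
  coprod X _ _ _ hX h n := ModSystem.IsColim.directSum
    (fun a => ℋ.resSystemMap ξ hφ hψ (coprodIncl X hX a) n)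
    (fun i => (ℋ.theory (Gi i) (ξ.comp (ψ i))).disjoint_union (fun a => Res (ψ i) (X a))
      (fun a => isGCWComplex_res (ψ i) (hX a)) n)
    ((ℋ.theory G ξ).disjoint_union X hX n) fun a => h a n

end EquivariantHomologyTheory

/-! ### Homology of discrete spaces -/

instance {H G : Type u} [Group H] [Group G] (α : H →* G) {X : Type u} [MulAction H X]
    [TopologicalSpace X] [DiscreteTopology X] : DiscreteTopology (Ind α X) :=
  discreteTopology_iff_forall_isClosed.2 fun C =>
    (Ind.isClosed_iff C).2 fun _ => isClosed_discrete _

/-- An orbit as an invariant subset. -/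
def orbitSub (G : Type u) [Group G] {X : Type u} [MulAction G X]
    (c : MulAction.orbitRel.Quotient G X) : SubMulAction G X where
  carrier := {x | Quotient.mk (MulAction.orbitRel G X) x = c}
  smul_mem' := by
    rintro g x rfl
    exact Quotient.sound ⟨g, rfl⟩

/-- The homology of a discrete space is generated by the homology of its orbits. -/
theorem GHomologyTheory.orbit_induction {G : Type u} [Group G] {Λ : Type v} [Ring Λ]
    (T : GHomologyTheory.{u, v, w} G Λ) (P : GCWPair G) [DiscreteTopology P.X] (n : ℤ)
    (p : (T.H n).obj P → Prop) (zero : p 0) (add : ∀ x y, p x → p y → p (x + y))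
    (orbit : ∀ (Q : GCWPair G) (f : Q ⟶ P) (q : Q.X), DiscreteTopology Q.X → Q.A = ⊥ →
      (∀ y, ∃ g : G, y = g • q) → ∀ x, p (((T.H n).map f).hom x))
    (hP : P.A = ⊥) (x : (T.H n).obj P) : p x := by
  classical
  let X : MulAction.orbitRel.Quotient G P.X → Type u := fun c => orbitSub G c
  have hX : ∀ c, IsGCWComplex G (X c) := fun c => isGCWComplex_of_discrete G _
  let f : ∀ c, ofComplex (X c) (hX c) ⟶ P := fun c =>
    Hom.mk (P := ofComplex (X c) (hX c)) (Q := P) (fun x : orbitSub G c => (x.1 : P.X))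
      continuous_subtype_val (fun _ _ => rfl) (fun _ h => h.elim)
  let F : coprod X hX ⟶ P := Hom.mk (P := coprod X hX) (Q := P)
    (fun x : Σ c, orbitSub G c => (x.2.1 : P.X))
    (continuous_sigma (σ := fun c => orbitSub G c) fun c => continuous_subtype_val)
    (fun _ _ => rfl) (fun _ h => h.elim)
  let S : P ⟶ coprod X hX := Hom.mk (P := P) (Q := coprod X hX)
    (fun x : P.X => (⟨Quotient.mk _ x, ⟨x, rfl⟩⟩ : Σ c, orbitSub G c)) continuous_of_discreteTopology
    (fun g x => by
      have : ∀ c (hc : Quotient.mk (MulAction.orbitRel G P.X) (g • x) = c)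
        (hc' : Quotient.mk (MulAction.orbitRel G P.X) x = c),
        (⟨Quotient.mk (MulAction.orbitRel G P.X) (g • x), ⟨g • x, rfl⟩⟩ : Σ c, orbitSub G c) =
          g • (⟨Quotient.mk (MulAction.orbitRel G P.X) x, ⟨x, rfl⟩⟩ : Σ c, orbitSub G c) := by
        rintro c hc rfl
        change _ = (⟨_, g • ⟨x, rfl⟩⟩ : Σ c, orbitSub G c)
        exact Sigma.subtype_ext hc rfl
      exact this _ (Quotient.sound ⟨g, rfl⟩) rfl)
    (fun x hx => by rw [hP] at hx; exact hx.elim)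
  -- A discrete `G`-space is the disjoint union of its orbits. Because of the section `S`, every
  -- class comes from the disjoint union, where it is a finite sum of classes on single orbits.
  have hSF : S ≫ F = 𝟙 P := rfl
  have key : ∀ z, p (((T.H n).map F).hom z) := by
    intro z
    obtain ⟨z, rfl⟩ := (T.disjoint_union X hX n).2 z
    induction z using DirectSum.induction_on with
    | zero => simpa using zero
    | of c z =>
      have e : coprodIncl X hX c ≫ F = f c := rfl
      have e' : ((T.H n).map F).hom (((T.H n).map (coprodIncl X hX c)).hom z) =
          ((T.H n).map (f c)).hom z := by
        rw [← e, Functor.map_comp]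
        rfl
      refine (congrArg (fun t => p (((T.H n).map F).hom t)) (DirectSum.toModule_lof Λ
        (φ := fun i => ((T.H n).map (coprodIncl X hX i)).hom) c z)).mpr ?_
      rw [e']
      obtain ⟨x, rfl⟩ := Quotient.exists_rep c
      refine orbit _ (f _) (⟨x, rfl⟩ : orbitSub G _)
        (inferInstanceAs (DiscreteTopology (orbitSub G _))) rfl (fun y => ?_) z
      obtain ⟨y, hy⟩ := (y : orbitSub G (Quotient.mk (MulAction.orbitRel G P.X) x))
      obtain ⟨g, hg⟩ := Quotient.exact hy
      exact ⟨g, Subtype.ext hg.symm⟩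
    | add a b ha hb =>
      rw [map_add, map_add]
      exact add _ _ ha hb
  have e : ((T.H n).map F).hom (((T.H n).map S).hom x) = x := by
    have := (T.H n).map_comp S F
    rw [hSF, CategoryTheory.Functor.map_id] at this
    exact (congrArg (fun t => t.hom x) this).symm
  rw [← e]
  exact key _

/-! ### Coefficient systems and the colimit property for orbits. -/

namespace EquivariantHomologyTheory

variable {Γ : Type z} [Group Γ] {Λ : Type v} [Ring Λ]
  (ℋ : EquivariantHomologyTheory.{u, v, w, z} Γ Λ)

/-! ### The systems of coefficients -/

section Coefficients

variable {G : Type u} [Group G] (ξ : G →* Γ) {I : Type u} [Preorder I] {Gi : I → Type u}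
  [∀ i, Group (Gi i)] {φ : ∀ i j, i ≤ j → Gi i →* Gi j} {ψ : ∀ i, Gi i →* G}
  (hφ : ∀ i j k (h : i ≤ j) (h' : j ≤ k), (φ j k h').comp (φ i j h) = φ i k (h.trans h'))
  (hψ : ∀ i j (h : i ≤ j), (ψ j).comp (φ i j h) = ψ i)

/-- The system of the coefficients `H_n^{G_i}({•})`. -/
def pointSystem (n : ℤ) : ModSystem.{u, v, w} I Λ where
  obj i := ℋ.coeff (ξ.comp (ψ i)) n
  map i j h := (ℋ.pointMap (ξ.comp (ψ i)) (ξ.comp (ψ j)) (φ i j h)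
    (by rw [MonoidHom.comp_assoc, hψ]) n).hom
  pt := ℋ.coeff ξ n
  toPt i := (ℋ.pointMap (ξ.comp (ψ i)) ξ (ψ i) rfl n).hom
  map_map i j k _ _ x := congrArg (fun t => t.hom x) (ℋ.pointMap_comp (ξ.comp (ψ i))
    (ξ.comp (ψ j)) (ξ.comp (ψ k)) _ _ (φ i k _) _ _ _ (hφ i j k _ _) n)
  toPt_map i j _ x := congrArg (fun t => t.hom x) (ℋ.pointMap_comp (ξ.comp (ψ i))
    (ξ.comp (ψ j)) ξ _ _ (ψ i) _ rfl rfl (hψ i j _) n)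

end Coefficients

/-! ### The homology of an orbit -/

section Orbit

/-- The inclusion of the base point of an orbit. -/
def orbitPoint {G : Type u} [Group G] (L : Subgroup G) :
    SemiHom L.subtype (point L) ((indFunctor L.subtype).obj (point L)) where
  toFun := fun x : PUnit => Ind.mk L.subtype 1 x
  continuous_toFun := Ind.continuous_mk 1
  map_smul l x := by
    change Ind.mk L.subtype 1 (l • x) = Ind.mk L.subtype (l * 1) x
    rw [← Ind.mk_mul, mul_one, one_mul]
    rfl
  map_mem _ h := h.elim

/-- The bijectivity axiom for induction from `L`: the adjoint of the base point inclusion is the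
identity of `G ×_L {•}`, so the pushforward is `ind` itself. -/
theorem push_orbitPoint_bijective {G : Type u} [Group G] (μ : G →* Γ) (L : Subgroup G) (n : ℤ) :
    Function.Bijective (ℋ.push (μ.comp L.subtype) μ n rfl (orbitPoint L)).hom := by
  have e : (orbitPoint L).adj = 𝟙 _ := by
    refine hom_ext (funext (Ind.ind fun g x => ?_))
    change Ind.mk L.subtype (g * 1) x = Ind.mk L.subtype g x
    rw [mul_one]
  unfold push
  rw [e, CategoryTheory.Functor.map_id]
  exact ℋ.ind_bijective μ L n

variable {G : Type u} [Group G] (ξ : G →* Γ) {I : Type u} [Preorder I] {Gi : I → Type u}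
  [∀ i, Group (Gi i)] {φ : ∀ i j, i ≤ j → Gi i →* Gi j} {ψ : ∀ i, Gi i →* G}
  (hφ : ∀ i j k (h : i ≤ j) (h' : j ≤ k), (φ j k h').comp (φ i j h) = φ i k (h.trans h'))
  (hψ : ∀ i j (h : i ≤ j), (ψ j).comp (φ i j h) = ψ i)

/-- The structure maps of the system of the preimages of a subgroup. -/
def comapMap (hψ : ∀ i j (h : i ≤ j), (ψ j).comp (φ i j h) = ψ i) (L : Subgroup G) (i j : I)
    (h : i ≤ j) : L.comap (ψ i) →* L.comap (ψ j) :=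
  ((φ i j h).comp (L.comap (ψ i)).subtype).codRestrict _ fun x => by
    change (ψ j).comp (φ i j h) x.1 ∈ L
    rw [hψ]
    exact x.2

/-- The maps of the preimages of a subgroup to that subgroup. -/
def comapToPt (ψ : ∀ i, Gi i →* G) (L : Subgroup G) (i : I) : L.comap (ψ i) →* L :=
  ((ψ i).comp (L.comap (ψ i)).subtype).codRestrict _ fun x => x.2

include hφ in
theorem comapMap_comp (L : Subgroup G) (i j k : I) (h : i ≤ j) (h' : j ≤ k) :
    (comapMap hψ L j k h').comp (comapMap hψ L i j h) = comapMap hψ L i k (h.trans h') :=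
  MonoidHom.ext fun x => Subtype.ext (DFunLike.congr_fun (hφ i j k h h') x.1)

theorem comapToPt_comp (L : Subgroup G) (i j : I) (h : i ≤ j) :
    (comapToPt ψ L j).comp (comapMap hψ L i j h) = comapToPt ψ L i :=
  MonoidHom.ext fun x => Subtype.ext (DFunLike.congr_fun (hψ i j h) x.1)

/-- The inclusion of the base point of an orbit into its restriction. -/
def resOrbitPoint {K : Type u} [Group K] (ψ : K →* G) (L : Subgroup G) :
    SemiHom (L.comap ψ).subtype (point (L.comap ψ))
      (resObj ψ ((indFunctor L.subtype).obj (point L))) where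
  toFun _ := (Ind.mk L.subtype 1 PUnit.unit : Ind L.subtype PUnit.{u + 1})
  continuous_toFun := continuous_const
  map_smul l _ := (orbitPoint L).map_smul ⟨ψ l.1, l.2⟩ (PUnit.unit : PUnit)
  map_mem _ h := h.elim

/-- The stabilizer of the base coset under `K` is `ψ⁻¹(L)`, so `K / ψ⁻¹(L)` is embedded in `G / L`
as an orbit. -/
theorem resOrbitPoint_adj_injective {K : Type u} [Group K] (ψ : K →* G) (L : Subgroup G) :
    Function.Injective (resOrbitPoint ψ L).adj.toFun := by
  refine Ind.ind fun k _ => Ind.ind fun k' _ => fun h => ?_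
  change Ind.mk L.subtype (ψ k * 1) PUnit.unit = Ind.mk L.subtype (ψ k' * 1) PUnit.unit at h
  obtain ⟨l, hl, -⟩ := Ind.mk_eq_mk.1 h
  rw [mul_one, mul_one] at hl
  refine Ind.mk_eq_mk.2 ⟨⟨k⁻¹ * k', ?_⟩, ?_, rfl⟩
  · change ψ (k⁻¹ * k') ∈ L
    rw [map_mul, map_inv, hl, inv_mul_cancel_left]
    exact l.2
  · exact (mul_inv_cancel_left k k').symm

/-- Both composites send the point to the base coset and are therefore the pushforward along the
same map `k`. So base point classes are compatible with the transition maps of the two systems. -/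
theorem resSystem_map_push (L : Subgroup G) (n : ℤ) (i j : I) (h : i ≤ j)
    (x : ℋ.coeff ((ξ.comp (ψ i)).comp (L.comap (ψ i)).subtype) n) :
    (ℋ.resSystem ξ hφ hψ ((indFunctor L.subtype).obj (point L)) n).map i j h
        ((ℋ.push ((ξ.comp (ψ i)).comp (L.comap (ψ i)).subtype) (ξ.comp (ψ i)) n rfl
          (resOrbitPoint (ψ i) L)).hom x) =
      (ℋ.push ((ξ.comp (ψ j)).comp (L.comap (ψ j)).subtype) (ξ.comp (ψ j)) n rfl
          (resOrbitPoint (ψ j) L)).hom ((ℋ.pointSystem (ξ.comp L.subtype) (comapMap_comp hφ hψ L)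
      (comapToPt_comp hψ L) n).map i j h x) := by
  have hφ' : (ξ.comp (ψ j)).comp (φ i j h) = ξ.comp (ψ i) := by
    rw [MonoidHom.comp_assoc, hψ]
  have hc : ((ξ.comp (ψ j)).comp (L.comap (ψ j)).subtype).comp (comapMap hψ L i j h) =
      (ξ.comp (ψ i)).comp (L.comap (ψ i)).subtype := by
    rw [← hφ']
    rfl
  let k : SemiHom ((φ i j h).comp (L.comap (ψ i)).subtype) (point (L.comap (ψ i)))
      (resObj (ψ j) ((indFunctor L.subtype).obj (point L))) :=
    { toFun := fun _ => (Ind.mk L.subtype 1 PUnit.unit : Ind L.subtype PUnit.{u + 1})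
      continuous_toFun := continuous_const
      map_smul := fun l _ =>
        (resOrbitPoint (ψ j) L).map_smul (comapMap hψ L i j h l) PUnit.unit
      map_mem := fun _ hx => hx.elim }
  have e1 := congrArg (fun t => t.hom x) (ℋ.push_comp _ _ (ξ.comp (ψ j)) n rfl hφ'
    (by rw [← hφ']; rfl) (resOrbitPoint (ψ i) L)
    (SemiHom.res (φ i j h) (ψ i) (ψ j) (hψ i j h) _) k rfl fun _ => rfl)
  have e2 := congrArg (fun t => t.hom x) (ℋ.push_comp _ _ (ξ.comp (ψ j)) n hc rfl
    (by rw [← hφ']; rfl) (SemiHom.point (comapMap hψ L i j h))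
    (resOrbitPoint (ψ j) L) k rfl fun _ => rfl)
  refine e1.trans (e2.symm.trans ?_)
  exact congrArg (ℋ.push _ (ξ.comp (ψ j)) n rfl (resOrbitPoint (ψ j) L)).hom
    (congrArg (fun t => t.hom x) (ℋ.pointMap_eq_push _ _ n hc).symm)

theorem resSystem_toPt_push (L : Subgroup G) (n : ℤ) (i : I)
    (x : ℋ.coeff ((ξ.comp (ψ i)).comp (L.comap (ψ i)).subtype) n) :
    (ℋ.resSystem ξ hφ hψ ((indFunctor L.subtype).obj (point L)) n).toPt i
        ((ℋ.push ((ξ.comp (ψ i)).comp (L.comap (ψ i)).subtype) (ξ.comp (ψ i)) n rfl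
          (resOrbitPoint (ψ i) L)).hom x) =
      (ℋ.push (ξ.comp L.subtype) ξ n rfl (orbitPoint L)).hom
        ((ℋ.pointSystem (ξ.comp L.subtype) (comapMap_comp hφ hψ L)
          (comapToPt_comp hψ L) n).toPt i x) := by
  let k : SemiHom ((ψ i).comp (L.comap (ψ i)).subtype) (point (L.comap (ψ i)))
      ((indFunctor L.subtype).obj (point L)) :=
    { toFun := fun _ => (Ind.mk L.subtype 1 PUnit.unit : Ind L.subtype PUnit.{u + 1})
      continuous_toFun := continuous_const
      map_smul := fun l _ => (orbitPoint L).map_smul ⟨ψ i l.1, l.2⟩ PUnit.unit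
      map_mem := fun _ hx => hx.elim }
  have e1 := congrArg (fun t => t.hom x) (ℋ.push_comp _ _ ξ n rfl rfl
    rfl (resOrbitPoint (ψ i) L) (SemiHom.unit (ψ i) _) k rfl fun _ => rfl)
  have e2 := congrArg (fun t => t.hom x) (ℋ.push_comp _ _ ξ n rfl rfl
    rfl (SemiHom.point (comapToPt ψ L i)) (orbitPoint L) k rfl fun _ => rfl)
  refine e1.trans (e2.symm.trans ?_)
  exact congrArg (ℋ.push _ ξ n rfl (orbitPoint L)).hom
    (congrArg (fun t => t.hom x) (ℋ.pointMap_eq_push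
      ((ξ.comp (ψ i)).comp (L.comap (ψ i)).subtype) (ξ.comp L.subtype)
      (α := comapToPt ψ L i) n rfl).symm)

/-- Every class in the restriction of an orbit is eventually supported at the base point. -/
theorem exists_push_resOrbitPoint [IsDirectedOrder I] (hsurj : ∀ g, ∃ i x, ψ i x = g)
    (L : Subgroup G) (n : ℤ) (i : I)
    (x : (ℋ.resSystem ξ hφ hψ ((indFunctor L.subtype).obj (point L)) n).obj i) :
    ∃ (j : I) (h : i ≤ j) (x' : ℋ.coeff ((ξ.comp (ψ j)).comp (L.comap (ψ j)).subtype) n),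
      (ℋ.resSystem ξ hφ hψ ((indFunctor L.subtype).obj (point L)) n).map i j h x =
        (ℋ.push ((ξ.comp (ψ j)).comp (L.comap (ψ j)).subtype) (ξ.comp (ψ j)) n rfl
          (resOrbitPoint (ψ j) L)).hom x' := by
  let P := (indFunctor L.subtype).obj (point L)
  have hdisc : DiscreteTopology P.X :=
    inferInstanceAs (DiscreteTopology (Ind L.subtype PUnit))
  have hdisc' : DiscreteTopology (resObj (ψ i) P).X :=
    inferInstanceAs (DiscreteTopology (Ind L.subtype PUnit))
  have hA : (resObj (ψ i) P).A = ⊥ := by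
    ext y
    constructor
    · rintro ⟨_, _, hx, _⟩
      exact hx.elim
    · intro h
      exact h.elim
  let D := ℋ.resSystem ξ hφ hψ P n
  refine GHomologyTheory.orbit_induction (ℋ.theory (Gi i) (ξ.comp (ψ i))) (resObj (ψ i) P) n
    (fun x => ∃ (j : I) (h : i ≤ j)
      (x' : ℋ.coeff ((ξ.comp (ψ j)).comp (L.comap (ψ j)).subtype) n),
      D.map i j h x = (ℋ.push ((ξ.comp (ψ j)).comp (L.comap (ψ j)).subtype) (ξ.comp (ψ j)) n rfl
          (resOrbitPoint (ψ j) L)).hom x') ?_ ?_ ?_ hA x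
  · exact ⟨i, le_rfl, 0, (map_zero _).trans (map_zero _).symm⟩
  · rintro x y ⟨j, hj, x', hx⟩ ⟨k, hk, y', hy⟩
    obtain ⟨l, hl, hl'⟩ := exists_ge_ge j k
    refine ⟨l, hj.trans hl, ((ℋ.pointSystem (ξ.comp L.subtype) (comapMap_comp hφ hψ L)
      (comapToPt_comp hψ L) n).map j l hl x' + (ℋ.pointSystem (ξ.comp L.subtype)
      (comapMap_comp hφ hψ L) (comapToPt_comp hψ L) n).map k l hl' y'), ?_⟩
    refine (map_add (D.map i l _) x y).trans (Eq.trans ?_ (map_add _ _ _).symm)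
    exact congrArg₂ (· + ·)
      ((D.map_map i j l hj hl x).symm.trans ((congrArg (D.map j l hl) hx).trans
        (ℋ.resSystem_map_push ξ hφ hψ L n j l hl x')))
      ((D.map_map i k l hk hl' y).symm.trans ((congrArg (D.map k l hl') hy).trans
        (ℋ.resSystem_map_push ξ hφ hψ L n k l hl' y')))
  -- On a single orbit let `q` go to `g L` and write `g = ψ l a`. At a stage `j` above `i` and `l`,
  -- the coset `g L` is a translate of the base coset by an element of `Gi j`. So the whole orbit is
  -- mapped into the orbit of the base coset.
  · intro Q f q hQ hQA hq x
    obtain ⟨g, hg⟩ : ∃ g : G, f.toFun q = Ind.mk L.subtype g PUnit.unit :=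
      Ind.ind (p := fun y => ∃ g : G, y = Ind.mk L.subtype g PUnit.unit)
        (fun g _ => ⟨g, rfl⟩) (f.toFun q)
    obtain ⟨l, a, rfl⟩ := hsurj g
    obtain ⟨j, hij, hlj⟩ := exists_ge_ge i l
    let k : SemiHom (φ i j hij) Q (resObj (ψ j) P) :=
      { toFun := f.toFun
        continuous_toFun := f.continuous_toFun
        map_smul := fun h x => (f.map_smul h x).trans
          ((SemiHom.res (φ i j hij) (ψ i) (ψ j) (hψ i j hij) P).map_smul h (f.toFun x))
        map_mem := f.map_mem }
    have hk : ∀ y, ∃ z, (resOrbitPoint (ψ j) L).adj.toFun z = k.toFun y := by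
      intro y
      obtain ⟨h, rfl⟩ := hq y
      let z : ((indFunctor (L.comap (ψ j)).subtype).obj (point (L.comap (ψ j)))).X :=
        (Ind.mk _ (φ l j hlj a) PUnit.unit : Ind (L.comap (ψ j)).subtype PUnit.{u + 1})
      have hz : (resOrbitPoint (ψ j) L).adj.toFun z = k.toFun q := by
        change Ind.mk L.subtype (ψ j (φ l j hlj a) * 1) PUnit.unit = f.toFun q
        rw [hg, mul_one, ← hψ l j hlj]
        rfl
      exact ⟨φ i j hij h • z, ((resOrbitPoint (ψ j) L).adj.map_smul _ z).trans
        ((congrArg (fun t => φ i j hij h • t) hz).trans (k.map_smul h q).symm)⟩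
    -- The pointwise lift is equivariant because the orbit of the base coset is embedded, and
    -- continuous because `Q` is discrete.
    choose r hr using hk
    let r' : SemiHom (φ i j hij) Q
        ((indFunctor (L.comap (ψ j)).subtype).obj (point (L.comap (ψ j)))) :=
      { toFun := r
        continuous_toFun := continuous_of_discreteTopology
        map_smul := fun h x => resOrbitPoint_adj_injective (ψ j) L (by
          rw [hr, (resOrbitPoint (ψ j) L).adj.map_smul, hr, k.map_smul])
        map_mem := fun x hx => by
          rw [hQA] at hx
          exact hx.elim }
    have hφ' : (ξ.comp (ψ j)).comp (φ i j hij) = ξ.comp (ψ i) := by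
      rw [MonoidHom.comp_assoc, hψ]
    -- The lifted class lives on `G_j / ψ_j⁻¹(L)`, whose homology is the coefficient group of
    -- `ψ_j⁻¹(L)` by induction.
    obtain ⟨x', hx'⟩ := (ℋ.ind_bijective (ξ.comp (ψ j)) (L.comap (ψ j)) n).2
      ((ℋ.push (ξ.comp (ψ i)) (ξ.comp (ψ j)) n hφ' r').hom x)
    refine ⟨j, hij, x', ?_⟩
    have e1 := congrArg (fun t => t.hom x) (ℋ.map_push (ξ.comp (ψ i)) (ξ.comp (ψ j)) n hφ' f
      (SemiHom.res (φ i j hij) (ψ i) (ψ j) (hψ i j hij) P) k fun _ => rfl)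
    have e2 := congrArg (fun t => t.hom x) (ℋ.push_map (ξ.comp (ψ i)) (ξ.comp (ψ j)) n hφ' r'
      (resOrbitPoint (ψ j) L).adj k fun x => (hr x).symm)
    refine e1.trans (e2.symm.trans ?_)
    exact congrArg ((((ℋ.theory (Gi j) (ξ.comp (ψ j))).H n).map
      (resOrbitPoint (ψ j) L).adj).hom) hx'.symm

/-- `H_n^G(G / L)` is `H_n^L({•})`, and up to passing to later stages `H_n^{G_j}(G / L)` may be
replaced by the coefficients of `ψ_j⁻¹(L)`. A class that dies in the limit is first moved to the
orbit of the base coset and then killed at a later stage by the colimit property for `L`. -/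
theorem isColim_orbit [IsDirectedOrder I] (hsurj : ∀ g, ∃ i x, ψ i x = g) (L : Subgroup G) (n : ℤ)
    (hL : (ℋ.pointSystem (ξ.comp L.subtype) (comapMap_comp hφ hψ L)
      (comapToPt_comp hψ L) n).IsColim) :
    (ℋ.resSystem ξ hφ hψ ((indFunctor L.subtype).obj (point L)) n).IsColim where
  surj y := by
    obtain ⟨y, rfl⟩ := (ℋ.push_orbitPoint_bijective ξ L n).2 y
    obtain ⟨i, x, rfl⟩ := hL.surj y
    exact ⟨i, _, ℋ.resSystem_toPt_push ξ hφ hψ L n i x⟩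
  inj i x hx := by
    obtain ⟨j, hj, x', e⟩ := ℋ.exists_push_resOrbitPoint ξ hφ hψ hsurj L n i x
    have h1 := (ℋ.resSystem ξ hφ hψ ((indFunctor L.subtype).obj (point L)) n).toPt_map i j hj x
    rw [e, hx, ℋ.resSystem_toPt_push ξ hφ hψ] at h1
    obtain ⟨k, hk, e'⟩ := hL.inj j x' ((ℋ.push_orbitPoint_bijective ξ L n).1
      (h1.trans (map_zero _).symm))
    refine ⟨k, hj.trans hk, ?_⟩
    rw [← ModSystem.map_map _ i j k hj hk, e, ℋ.resSystem_map_push ξ hφ hψ]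
    exact (congrArg _ e').trans (map_zero (ℋ.push _ _ n rfl (resOrbitPoint (ψ k) L)).hom)

end Orbit

end EquivariantHomologyTheory

/-! ### Colimits of directed systems of groups -/

section GroupColimit

variable {I : Type u} [Preorder I] [IsDirectedOrder I] [Nonempty I] {Gi : I → Type u}
  [∀ i, Group (Gi i)] {φ : ∀ i j, i ≤ j → Gi i →* Gi j} {G : Type u} [Group G]
  {ψ : ∀ i, Gi i →* G}

/-- The universal property is tested on the concrete direct limit, in which equality is detected at
a finite stage. -/
theorem IsGroupColimit.exists_desc_directLimit [DirectedSystem Gi (fun i j h => φ i j h)]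
    (h : IsGroupColimit φ ψ) :
    ∃ d : G →* DirectLimit Gi φ, ∀ i x, d (ψ i x) = Quotient.mk _ ⟨i, x⟩ := by
  let ι : ∀ i, Gi i →* DirectLimit Gi φ := fun i =>
    { toFun := fun x => Quotient.mk _ ⟨i, x⟩
      map_one' := (DirectLimit.one_def i).symm
      map_mul' := fun x y => (DirectLimit.mul_def i x y).symm }
  obtain ⟨d, hd, -⟩ := h.existsUnique_desc (DirectLimit Gi φ) ι fun i j hij =>
    MonoidHom.ext fun x => DirectLimit.mk_apply i j x hij
  exact ⟨d, fun i x => DFunLike.congr_fun (hd i) x⟩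

theorem IsGroupColimit.exists_map_eq_one [DirectedSystem Gi (fun i j h => φ i j h)]
    (h : IsGroupColimit φ ψ) (i : I) (x : Gi i) (hx : ψ i x = 1) :
    ∃ (j : I) (hij : i ≤ j), φ i j hij x = 1 := by
  obtain ⟨d, hd⟩ := h.exists_desc_directLimit
  exact (DirectLimit.exists_eq_one (f := φ) ⟨i, x⟩).1 (by rw [← hd, hx, map_one])

/-- The composite `G → DirectLimit → G` is the identity by uniqueness in the universal property, and
elements of the direct limit are represented at a finite stage. -/
theorem IsGroupColimit.exists_apply_eq [DirectedSystem Gi (fun i j h => φ i j h)]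
    (h : IsGroupColimit φ ψ) (g : G) : ∃ i x, ψ i x = g := by
  obtain ⟨d, hd⟩ := h.exists_desc_directLimit
  let e : DirectLimit Gi φ →* G := MonoidHom.mk' (DirectLimit.lift φ (fun i => ψ i)
    fun i j hij x => (DFunLike.congr_fun (h.comp_eq i j hij) x).symm) (DirectLimit.lift_mul ψ _)
  have he : e.comp d = MonoidHom.id G :=
    (h.existsUnique_desc G ψ h.comp_eq).unique
      (fun i => MonoidHom.ext fun x => by
        rw [MonoidHom.comp_apply, MonoidHom.comp_apply, hd]
        rfl)
      fun i => MonoidHom.id_comp _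
  obtain ⟨i, x, hx⟩ := DirectLimit.exists_eq_mk φ (d g)
  refine ⟨i, x, ?_⟩
  have := DFunLike.congr_fun he g
  rw [MonoidHom.comp_apply, hx] at this
  exact this

-- Converse to the two preceding results; with it the universal property can be verified for the
-- preimages of a subgroup. A compatible family of maps is well defined on `G`, since elements with
-- equal images in `G` become equal at a later stage.
omit [Nonempty I] in
theorem isGroupColimit_of_exists (h : ∀ i j (h : i ≤ j), (ψ j).comp (φ i j h) = ψ i)
    (hsurj : ∀ g, ∃ i x, ψ i x = g)
    (hinj : ∀ i x, ψ i x = 1 → ∃ (j : I) (hij : i ≤ j), φ i j hij x = 1) :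
    IsGroupColimit φ ψ := by
  refine ⟨h, fun M _ f hf => ?_⟩
  have h' : ∀ i j (hij : i ≤ j) x, ψ j (φ i j hij x) = ψ i x := fun i j hij x =>
    DFunLike.congr_fun (h i j hij) x
  have hf' : ∀ i j (hij : i ≤ j) x, f j (φ i j hij x) = f i x := fun i j hij x =>
    DFunLike.congr_fun (hf i j hij) x
  have key : ∀ i j x y, ψ i x = ψ j y → f i x = f j y := by
    intro i j x y hxy
    obtain ⟨k, hik, hjk⟩ := exists_ge_ge i j
    obtain ⟨l, hl, e⟩ := hinj k (φ i k hik x * (φ j k hjk y)⁻¹) (by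
      rw [map_mul, map_inv, h', h', hxy, mul_inv_cancel])
    have e' := congrArg (f l) e
    rwa [hf', map_mul, map_inv, hf', hf', map_one, mul_inv_eq_one] at e'
  choose i x hx using hsurj
  let d : G →* M := MonoidHom.mk' (fun g => f (i g) (x g)) (by
    intro a b
    obtain ⟨k, hik, hjk⟩ := exists_ge_ge (i a) (i b)
    rw [← hf' _ k hik, ← hf' _ k hjk, ← map_mul]
    refine key _ _ _ _ ?_
    rw [map_mul, h', h', hx, hx, hx])
  refine ⟨d, fun j => MonoidHom.ext fun y => key _ _ _ _ (hx _), fun d' hd' => ?_⟩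
  refine MonoidHom.ext fun g => ?_
  rw [← hx g]
  exact (DFunLike.congr_fun (hd' _) _).trans (key _ _ _ _ (hx _)).symm

end GroupColimit

namespace EquivariantHomologyTheory

variable {Γ : Type z} [Group Γ] {Λ : Type v} [Ring Λ]
  (ℋ : EquivariantHomologyTheory.{u, v, w, z} Γ Λ)

/-! ### From continuity to the colimit property of the coefficients of all subgroups. -/

section

variable {I : Type u} [Preorder I] {Gi : I → Type u} [∀ i, Group (Gi i)]
  {φ : ∀ i j, i ≤ j → Gi i →* Gi j} {G : Type u} [Group G] {ψ : ∀ i, Gi i →* G} (ξ : G →* Γ)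
  (hφ : ∀ i j k (h : i ≤ j) (h' : j ≤ k), (φ j k h').comp (φ i j h) = φ i k (h.trans h'))
  (hψ : ∀ i j (h : i ≤ j), (ψ j).comp (φ i j h) = ψ i) (n : ℤ)

/-- Elements of the direct limit come from a finite stage and vanish at a finite stage. The latter
uses that the transition maps are a directed system including identities, whence `hφ'`. -/
theorem isColim_pointSystem [IsDirectedOrder I] [Nonempty I]
    (hφ' : ∀ i, φ i i le_rfl = MonoidHom.id _)
    (h : Function.Bijective (ℋ.colimMap φ ψ hψ ξ n)) : (ℋ.pointSystem ξ hφ hψ n).IsColim := by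
  classical
  let D := ℋ.pointSystem ξ hφ hψ n
  have : DirectedSystem (fun i => D.obj i) (fun i j h => D.map i j h) :=
    { map_self := fun i x => congrArg (fun t => t.hom x)
        (ℋ.pointMap_id (ξ.comp (ψ i)) n (by rw [hφ' i]; rfl) (hφ' i))
      map_map := fun k j i hij hjk x => D.map_map i j k hij hjk x }
  refine ⟨fun y => ?_, fun i x hx => ?_⟩
  · obtain ⟨y, rfl⟩ := h.2 y
    obtain ⟨i, x, rfl⟩ := Module.DirectLimit.exists_of y
    exact ⟨i, x, (Module.DirectLimit.lift_of (R := Λ) (f := D.map) D.toPt D.toPt_map x).symm⟩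
  · refine Module.DirectLimit.of.zero_exact (R := Λ) (f := D.map) (x := x) (h.1 ?_)
    refine Eq.trans ?_ (hx.trans (map_zero _).symm)
    exact Module.DirectLimit.lift_of (R := Λ) (f := D.map) D.toPt D.toPt_map x

/-- Isomorphic systems of groups have isomorphic coefficients. This is needed because `K i ∩ L`
appears as a subgroup of `K i` in the orbit argument and as a subgroup of `L` in the definition of
continuity. -/
theorem isColim_pointSystem_of_equiv {Gi' : I → Type u} [∀ i, Group (Gi' i)]
    {φ' : ∀ i j, i ≤ j → Gi' i →* Gi' j} {ψ' : ∀ i, Gi' i →* G}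
    (hφ' : ∀ i j k (h : i ≤ j) (h' : j ≤ k), (φ' j k h').comp (φ' i j h) = φ' i k (h.trans h'))
    (hψ' : ∀ i j (h : i ≤ j), (ψ' j).comp (φ' i j h) = ψ' i) (θ : ∀ i, Gi i ≃* Gi' i)
    (h1 : ∀ i j h, (φ' i j h).comp (θ i).toMonoidHom = (θ j).toMonoidHom.comp (φ i j h))
    (h2 : ∀ i, (ψ' i).comp (θ i).toMonoidHom = ψ i) (h : (ℋ.pointSystem ξ hφ' hψ' n).IsColim) :
    (ℋ.pointSystem ξ hφ hψ n).IsColim := by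
  have h3 : ∀ i, (ξ.comp (ψ' i)).comp (θ i).toMonoidHom = ξ.comp (ψ i) := fun i => by
    rw [MonoidHom.comp_assoc, h2]
  have h4 : ∀ i, (ξ.comp (ψ i)).comp (θ i).symm.toMonoidHom = ξ.comp (ψ' i) := fun i => by
    rw [← h3]
    ext x
    simp
  refine (ModSystem.isColim_iff_of_bijective (D := ℋ.pointSystem ξ hφ hψ n)
    (E := ℋ.pointSystem ξ hφ' hψ' n)
    { app := fun i => (ℋ.pointMap (ξ.comp (ψ i)) (ξ.comp (ψ' i)) (θ i).toMonoidHom (h3 i) n).hom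
      pt := LinearMap.id
      app_map := fun i j h x => ?_
      pt_toPt := fun i x => ?_ } (fun i => ?_) Function.bijective_id).2 h
  · have hc : (ξ.comp (ψ' j)).comp ((θ j).toMonoidHom.comp (φ i j h)) = ξ.comp (ψ i) := by
      rw [← MonoidHom.comp_assoc, h3, MonoidHom.comp_assoc, hψ]
    exact (congrArg (fun t => t.hom x) (ℋ.pointMap_comp (ξ.comp (ψ i)) (ξ.comp (ψ j))
      (ξ.comp (ψ' j)) (φ i j h) (θ j).toMonoidHom _ _ _ hc rfl n)).trans
      (congrArg (fun t => t.hom x) (ℋ.pointMap_comp (ξ.comp (ψ i)) (ξ.comp (ψ' i))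
      (ξ.comp (ψ' j)) (θ i).toMonoidHom (φ' i j h) _ _
        (by rw [MonoidHom.comp_assoc, hψ']) hc (h1 i j h) n)).symm
  · exact (congrArg (fun t => t.hom x) (ℋ.pointMap_comp (ξ.comp (ψ i)) (ξ.comp (ψ' i)) ξ
      (θ i).toMonoidHom (ψ' i) (ψ i) (h3 i) rfl rfl (h2 i) n)).symm
  · refine Function.bijective_iff_has_inverse.2
      ⟨(ℋ.pointMap (ξ.comp (ψ' i)) (ξ.comp (ψ i)) (θ i).symm.toMonoidHom (h4 i) n).hom,
        fun x => ?_, fun x => ?_⟩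
    · have e := ℋ.pointMap_comp _ _ _ (θ i).toMonoidHom (θ i).symm.toMonoidHom
        (MonoidHom.id _) (h3 i) (h4 i) rfl (by ext x; simp) n
      rw [ℋ.pointMap_id _ _ _ rfl] at e
      exact congrArg (fun t => t.hom x) e
    · have e := ℋ.pointMap_comp _ _ _ (θ i).symm.toMonoidHom (θ i).toMonoidHom
        (MonoidHom.id _) (h4 i) (h3 i) rfl (by ext x; simp) n
      rw [ℋ.pointMap_id _ _ _ rfl] at e
      exact congrArg (fun t => t.hom x) e

variable [IsDirectedOrder I] [Nonempty I]

/-- `L` is the colimit of its preimages: elements of `L` lift to some `G_i`, necessarily into the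
preimage, and elements with trivial image die at a later stage. So strong continuity applies to `L`.
-/
theorem IsStronglyContinuous.isColim [DirectedSystem Gi (fun i j h => φ i j h)]
    (hℋ : ℋ.IsStronglyContinuous) (h : IsGroupColimit φ ψ) (L : Subgroup G) :
    (ℋ.pointSystem (ξ.comp L.subtype) (comapMap_comp hφ hψ L) (comapToPt_comp hψ L) n).IsColim := by
  have hid : ∀ i, φ i i le_rfl = MonoidHom.id _ := fun i => MonoidHom.ext fun x =>
    DirectedSystem.map_self' φ x
  have hid' : ∀ i, comapMap hψ L i i le_rfl = MonoidHom.id _ := fun i => MonoidHom.ext fun x =>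
    Subtype.ext (DFunLike.congr_fun (hid i) x.1)
  have : DirectedSystem (fun i => L.comap (ψ i)) (fun i j h => comapMap hψ L i j h) :=
    { map_self := fun i x => DFunLike.congr_fun (hid' i) x
      map_map := fun k j i hij hjk x => DFunLike.congr_fun (comapMap_comp hφ hψ L i j k hij hjk) x }
  have hL : IsGroupColimit (comapMap hψ L) (comapToPt ψ L) := by
    refine isGroupColimit_of_exists (comapToPt_comp hψ L) (fun l => ?_) fun i x hx => ?_
    · obtain ⟨i, x, hx⟩ := h.exists_apply_eq l.1
      exact ⟨i, ⟨x, by rw [Subgroup.mem_comap, hx]; exact l.2⟩, Subtype.ext hx⟩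
    · obtain ⟨j, hij, e⟩ := h.exists_map_eq_one i x.1 (congrArg Subtype.val hx)
      exact ⟨j, hij, Subtype.ext e⟩
  exact ℋ.isColim_pointSystem _ _ _ n hid' (hℋ L (ξ.comp L.subtype) I _ _ _ hL n)

/-- `L` is the directed union of the subgroups `K i ∩ L`, so continuity applies to `L`. -/
theorem IsContinuous.isColim (hℋ : ℋ.IsContinuous) {K : I → Subgroup G} (hK : Monotone K)
    (hG : ∀ g, ∃ i, g ∈ K i) (L : Subgroup G) :
    (ℋ.pointSystem (ξ.comp L.subtype)
      (comapMap_comp (φ := fun _ _ h => Subgroup.inclusion (hK h))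
        (fun _ _ _ _ _ => rfl) (ψ := fun i => (K i).subtype) (fun _ _ _ => rfl) L)
      (comapToPt_comp (fun _ _ _ => rfl) L) n).IsColim := by
  have hK' : Monotone fun i => (K i).subgroupOf L := fun i j h x hx => hK h hx
  refine ℋ.isColim_pointSystem_of_equiv (ξ.comp L.subtype) _ _ n
    (φ' := fun _ _ h => Subgroup.inclusion (hK' h)) (ψ' := fun i => ((K i).subgroupOf L).subtype)
    (fun _ _ _ _ _ => rfl) (fun _ _ _ => rfl)
    (fun i => { toFun := fun x => ⟨⟨x.1.1, x.2⟩, x.1.2⟩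
                invFun := fun x => ⟨⟨x.1.1, x.2⟩, x.1.2⟩
                map_mul' := fun _ _ => rfl }) (fun _ _ _ => rfl) (fun _ => rfl) ?_
  exact ℋ.isColim_pointSystem _ _ _ n (fun _ => rfl)
    (hℋ L (ξ.comp L.subtype) I _ hK' (fun l => hG l.1) n)

end

/-! ### The inheritance of the Isomorphism Conjecture under colimits -/

/-- A subgroup `L` of `K` acts through `ψ(L)`, so its fixed points are those of `ψ(L)` on `E`, and
`L` belongs to the pulled back family exactly if `ψ(L)` belongs to `F`. -/
theorem _root_.EquivHom.IsClassifyingSpace.res {K G : Type u} [Group K] [Group G] (ψ : K →* G)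
    {F : SubgroupFamily G} {E : Type u} [TopologicalSpace E] [MulAction G E]
    [ContinuousConstSMul G E] (h : IsClassifyingSpace F E) :
    IsClassifyingSpace (F.comap ψ) (Res ψ E) := by
  have key : ∀ L : Subgroup K, {x : Res ψ E | ∀ k ∈ L, k • x = x} =
      {x : E | ∀ g ∈ L.map ψ, g • x = x} := by
    intro L
    refine Set.ext fun x => ⟨?_, fun hx k hk => hx _ ⟨k, hk, rfl⟩⟩
    rintro hx _ ⟨k, hk, rfl⟩
    exact hx k hk
  refine ⟨isGCWComplex_res ψ h.isGCW, fun L hL => ?_, fun L hL => ?_⟩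
  · rw [key]
    exact h.contractible _ hL
  · rw [key]
    exact h.empty _ hL

/-- The common core of both parts: the colimit property extends from orbits to all complexes and is
then used for the classifying space and for the point. -/
theorem isomorphismConjecture_of_isColim {I : Type u} [Preorder I] [IsDirectedOrder I] [Nonempty I]
    {Gi : I → Type u} [∀ i, Group (Gi i)] {φ : ∀ i j, i ≤ j → Gi i →* Gi j} {G : Type u} [Group G]
    {ψ : ∀ i, Gi i →* G} (ξ : G →* Γ) (F : SubgroupFamily G)
    (hφ : ∀ i j k (h : i ≤ j) (h' : j ≤ k), (φ j k h').comp (φ i j h) = φ i k (h.trans h'))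
    (hψ : ∀ i j (h : i ≤ j), (ψ j).comp (φ i j h) = ψ i) (hsurj : ∀ g, ∃ i x, ψ i x = g)
    (hL : ∀ (L : Subgroup G) n, (ℋ.pointSystem (ξ.comp L.subtype) (comapMap_comp hφ hψ L)
      (comapToPt_comp hψ L) n).IsColim)
    (h : ∀ i, ℋ.IsomorphismConjecture (ξ.comp (ψ i)) (F.comap (ψ i))) :
    ℋ.IsomorphismConjecture ξ F := by
  intro E _ _ _ hE n
  have key : ∀ (X : Type u) [TopologicalSpace X] [MulAction G X] [ContinuousConstSMul G X]
      (hX : IsGCWComplex G X), ∀ n, (ℋ.resSystem ξ hφ hψ (ofComplex X hX) n).IsColim := by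
    intro X _ _ _ hX
    exact (ℋ.isLocalizing_resSystem ξ hφ hψ).ofComplex_mem
      (fun L n => ℋ.isColim_orbit ξ hφ hψ hsurj L n (hL L n)) X hX
  -- The restriction of the projection to the point is the projection of the restricted classifying
  -- space, so the hypothesis gives bijectivity at each stage.
  exact ModSystem.bijective_pt (ℋ.resSystemMap ξ hφ hψ (toPoint (ofComplex E hE.isGCW) rfl) n)
    (fun i => h i (Res (ψ i) E) (hE.res (ψ i)) n) (key E _ n) (key PUnit _ n)

end EquivariantHomologyTheory

end EquivHom

/-! ### Inheritance under directed unions and under directed colimits. -/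

theorem mainTheorem6 {Γ : Type z} [Group Γ] {Λ : Type v} [Ring Λ]
    (ℋ : EquivHom.EquivariantHomologyTheory.{u, v, w, z} Γ Λ)
    (G : Type u) [Group G] (ξ : G →* Γ) (F : EquivHom.SubgroupFamily G) :
    (ℋ.IsContinuous →
      ∀ (I : Type u) [Preorder I] [IsDirectedOrder I] [Nonempty I] (K : I → Subgroup G),
        Monotone K → (∀ g : G, ∃ i, g ∈ K i) →
        (∀ i, ℋ.IsomorphismConjecture (ξ.comp (K i).subtype) (F.comap (K i).subtype)) →
        ℋ.IsomorphismConjecture ξ F) ∧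
    (ℋ.IsStronglyContinuous →
      ∀ (I : Type u) [Preorder I] [IsDirectedOrder I] [Nonempty I]
        (Gi : I → Type u) [∀ i, Group (Gi i)] (φ : ∀ i j, i ≤ j → Gi i →* Gi j)
        [DirectedSystem Gi (fun i j h => φ i j h)] (ψ : ∀ i, Gi i →* G),
        EquivHom.IsGroupColimit φ ψ →
        (∀ i, ℋ.IsomorphismConjecture (ξ.comp (ψ i)) (F.comap (ψ i))) →
        ℋ.IsomorphismConjecture ξ F) := by
  refine ⟨fun hℋ I _ _ _ K hK hG h => ?_, fun hℋ I _ _ _ Gi _ φ _ ψ hψ h => ?_⟩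
  · refine ℋ.isomorphismConjecture_of_isColim ξ F (φ := fun _ _ h => Subgroup.inclusion (hK h))
      (ψ := fun i => (K i).subtype) (fun _ _ _ _ _ => rfl) (fun _ _ _ => rfl) (fun g => ?_)
      (fun L n => hℋ.isColim ℋ ξ n hK hG L) h
    obtain ⟨i, hi⟩ := hG g
    exact ⟨i, ⟨g, hi⟩, rfl⟩
  · have hφ : ∀ i j k (h : i ≤ j) (h' : j ≤ k),
        (φ j k h').comp (φ i j h) = φ i k (h.trans h') := fun i j k h h' =>
      MonoidHom.ext fun x => DirectedSystem.map_map' φ h h' x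
    exact ℋ.isomorphismConjecture_of_isColim ξ F hφ hψ.comp_eq hψ.exists_apply_eq
      (fun L n => hℋ.isColim ℋ ξ hφ hψ.comp_eq n hψ L) h
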